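/- Let $\Omega\subset\mathbb R^3$ be a bounded open set with $C^\infty$ boundary, $\nu$ its outer unit normal and $dS$ the surface measure on $\partial\Omega$. Write $D=-i\nabla$, let $\sigma=(\sigma_1,\sigma_2,\sigma_3)$ be the Pauli matrices $$\sigma_1=\begin{pmatrix}0&1\\1&0\end{pmatrix},\quad \sigma_2=\begin{pmatrix}0&-i\\i&0\end{pmatrix},\quad \sigma_3=\begin{pmatrix}1&0\\0&-1\end{pmatrix},$$ $\sigma\cdot a=\sum_j a_j\sigma_j$, and let $\|\cdot\|$ be the norm of $L^2(\Omega)$ (for functions with values in $\mathbb C^2$ or in triples of such vectors). Let $A\in C^\infty(\overline\Omega;\mathbb R^3)$ and $q_-,\tilde q\in C^\infty(\overline\Omega;\mathbb C)$. Let $\varphi$ be a limiting Carleman weight in an open neighbourhood $U$ of $\overline\Omega$: $\varphi\in C^\infty(U;\mathbb R)$, $\nabla\varphi\neq0$ in $U$, and, with $a(x,\xi)=|\xi|^2-|\nabla\varphi(x)|^2$ and $b(x,\xi)=2\nabla\varphi(x)\cdot\xi$, the Poisson bracket $\{a,b\}=\nabla_\xi a\cdot\nabla_x b-\nabla_x a\cdot\nabla_\xi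 b$ vanishes at every $(x,\xi)\in U\times\mathbb R^3$ with $a(x,\xi)=b(x,\xi)=0$. Put $\partial\Omega_\pm=\{x\in\partial\Omega : \pm\nabla\varphi(x)\cdot\nu(x)\ge0\}$. For $0<\alpha<1$ and $0<h<1$ let $$\hat A(x,D)=\begin{cases}2A\cdot D-\frac1{q_-}(\sigma\cdot Dq_-)\,\sigma\cdot D,&\left|\frac1{q_-}\right|\le\sqrt{|\log h^\alpha|},\\ 2A\cdot D,&\text{otherwise},\end{cases}$$ $$\hat q(x)=\begin{cases}-\frac1{q_-}(\sigma\cdot Dq_-)\,\sigma\cdot A+\tilde q,&\left|\frac1{q_-}\right|\le\sqrt{|\log h^\alpha|},\\ \tilde q,&\text{otherwise},\end{cases}$$ where points with $q_-(x)=0$ belong to the second case. Then there are constants $C_0,C>0$, independent of $\alpha$, such that for every $\alpha\in(0,1)$ there is $h_0\in(0,1)$ such that, whenever $0<h\le h_0$ and $$\tilde\varphi=\varphi+\frac{h}{\varepsilon(h)}\frac{\varphi^2}{2},\qquad \varepsilon(h)=(C_0|\log h^\alpha|)^{-1},$$ one has $$\frac{h^2}{\varepsilon(h)}\left(\|e^{\tilde\varphi/h}v\|^2+\|e^{\tilde\varphi/h}hDv\|^2\right)-h^3\int_{\partial\Omega_-}\partial_\nu\varphi\,|e^{\tilde\varphi/h}\partial_\nu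 v|^2\,dS$$ $$\le C\,\|e^{\tilde\varphi/h}h^2(-\Delta+\hat A(x,D)+\hat q)v\|^2+C h^3\int_{\partial\Omega_+}\partial_\nu\varphi\,|e^{\tilde\varphi/h}\partial_\nu v|^2\,dS$$ for every $v\in H^2(\Omega;\mathbb C^2)$ with $v|_{\partial\Omega}=0$. -/

import Mathlib

open MeasureTheory Filter Topology
open scoped ContDiff

noncomputable section

/-- Euclidean three-space. -/
abbrev E3 : Type := EuclideanSpace ℝ (Fin 3)

/-- The classical partial derivative `∂_j f (x)`. -/
def pderiv3 {F : Type*} [NormedAddCommGroup F] [NormedSpace ℝ F]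
    (j : Fin 3) (f : E3 → F) (x : E3) : F :=
  fderiv ℝ f x (EuclideanSpace.single j 1)

/-! ### Open sets with smooth boundary -/

/-- Near `x`, the set `Ω` is `{ρ < 0}`, where `ρ` is smooth, `ρ x = 0` and `∇ρ x ≠ 0`. -/
def IsLocalDefiningFunction (Ω : Set E3) (x : E3) (ρ : E3 → ℝ) : Prop :=
  ContDiff ℝ ∞ ρ ∧ ρ x = 0 ∧ gradient ρ x ≠ 0 ∧ ∀ᶠ y in 𝓝 x, (y ∈ Ω ↔ ρ y < 0)

/-- The boundary of `Ω` is `C^∞` (and `Ω` lies locally on one side of it). -/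
def HasSmoothBoundary (Ω : Set E3) : Prop :=
  ∀ x ∈ frontier Ω, ∃ ρ : E3 → ℝ, IsLocalDefiningFunction Ω x ρ

open Classical in
/-- The outer unit normal `ν = ∇ρ / |∇ρ|`; it does not depend on the local defining function. -/
def outerNormal (Ω : Set E3) (x : E3) : E3 :=
  if hx : ∃ ρ : E3 → ℝ, IsLocalDefiningFunction Ω x ρ then
    ‖gradient hx.choose x‖⁻¹ • gradient hx.choose x
  else 0

/-- The surface measure `dS` on `∂Ω`: two-dimensional Hausdorff measure, normalized to agree with
Lebesgue measure on planes. -/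
def surfaceMeasure (Ω : Set E3) : Measure E3 :=
  (Measure.euclideanHausdorffMeasure 2 : Measure E3).restrict (frontier Ω)

/-! ### Sobolev spaces and traces -/

/-- `w'` is the weak partial derivative `∂_j w` in `Ω`. -/
def HasWeakPartial (Ω : Set E3) (j : Fin 3) (w w' : E3 → ℂ) : Prop :=
  ∀ ψ : E3 → ℝ, ContDiff ℝ ∞ ψ → HasCompactSupport ψ → tsupport ψ ⊆ Ω →
    ∫ x in Ω, pderiv3 j ψ x • w x = - ∫ x in Ω, ψ x • w' x

/-- The complex space `L²(Ω)`. -/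
def MemL2 (Ω : Set E3) (w : E3 → ℂ) : Prop :=
  MemLp w 2 (volume.restrict Ω)

/-- The Sobolev space `H¹(Ω)`. -/
def MemH1 (Ω : Set E3) (w : E3 → ℂ) : Prop :=
  MemL2 Ω w ∧ ∀ j, ∃ w' : E3 → ℂ, MemL2 Ω w' ∧ HasWeakPartial Ω j w w'

open Classical in
/-- The weak partial derivative `∂_j w ∈ L²(Ω)` (unique almost everywhere in `Ω`). -/
def weakPartial (Ω : Set E3) (j : Fin 3) (w : E3 → ℂ) : E3 → ℂ :=
  if hw : ∃ w' : E3 → ℂ, MemL2 Ω w' ∧ HasWeakPartial Ω j w w' then hw.choose else 0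

/-- The Sobolev space `H²(Ω)`. -/
def MemH2 (Ω : Set E3) (w : E3 → ℂ) : Prop :=
  MemH1 Ω w ∧ ∀ j, MemH1 Ω (weakPartial Ω j w)

/-- `g ∈ L²(∂Ω)` is the trace of `w ∈ H¹(Ω)`: some functions `u k`, smooth up to the boundary,
converge to `w` in `H¹(Ω)`, and their boundary values converge to `g` in `L²(∂Ω)`. -/
def IsTrace (Ω : Set E3) (w g : E3 → ℂ) : Prop :=
  MemH1 Ω w ∧ MemLp g 2 (surfaceMeasure Ω) ∧
    ∃ u : ℕ → E3 → ℂ, (∀ k, ContDiff ℝ ∞ (u k)) ∧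
      Tendsto (fun k => eLpNorm (u k - w) 2 (volume.restrict Ω)) atTop (𝓝 0) ∧
      (∀ j, Tendsto (fun k => eLpNorm (pderiv3 j (u k) - weakPartial Ω j w) 2
        (volume.restrict Ω)) atTop (𝓝 0)) ∧
      Tendsto (fun k => eLpNorm (u k - g) 2 (surfaceMeasure Ω)) atTop (𝓝 0)

open Classical in
/-- The trace operator on `H¹(Ω)`. -/
def boundaryTrace (Ω : Set E3) (w : E3 → ℂ) : E3 → ℂ :=
  if hw : ∃ g : E3 → ℂ, IsTrace Ω w g then hw.choose else 0

/-- The normal derivative `∂_ν w = ν · (∇w)|_{∂Ω}` of `w ∈ H²(Ω)`. -/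
def normalDeriv (Ω : Set E3) (w : E3 → ℂ) (x : E3) : ℂ :=
  ∑ j, (outerNormal Ω x j : ℂ) * boundaryTrace Ω (weakPartial Ω j w) x

/-- `D_j w = -i ∂_j w`, in the weak sense. -/
def weakD (Ω : Set E3) (j : Fin 3) (w : E3 → ℂ) (x : E3) : ℂ :=
  -Complex.I * weakPartial Ω j w x

/-- `Δ w`, in the weak sense. -/
def weakLaplacian (Ω : Set E3) (w : E3 → ℂ) (x : E3) : ℂ :=
  ∑ j, weakPartial Ω j (weakPartial Ω j w) x

/-! ### Limiting Carleman weights -/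

/-- The Poisson bracket `{a, b} = ∇_ξ a · ∇_x b - ∇_x a · ∇_ξ b`. -/
def poissonBracket (a b : E3 → E3 → ℝ) (x ξ : E3) : ℝ :=
  inner ℝ (gradient (fun η => a x η) ξ) (gradient (fun y => b y ξ) x)
    - inner ℝ (gradient (fun y => a y ξ) x) (gradient (fun η => b x η) ξ)

/-- Real part of the semiclassical principal symbol of `e^{φ/h} (-h²Δ) e^{-φ/h}`. -/
def symbolRe (φ : E3 → ℝ) (x ξ : E3) : ℝ := ‖ξ‖ ^ 2 - ‖gradient φ x‖ ^ 2

/-- Imaginary part of the semiclassical principal symbol of `e^{φ/h} (-h²Δ) e^{-φ/h}`. -/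
def symbolIm (φ : E3 → ℝ) (x ξ : E3) : ℝ := 2 * inner ℝ (gradient φ x) ξ

/-- `φ` is a limiting Carleman weight in the open set `U`: it is smooth with nonvanishing gradient,
and the Poisson bracket of the real and imaginary part of the symbol vanishes where the symbol
does. -/
def IsLimitingCarlemanWeight (φ : E3 → ℝ) (U : Set E3) : Prop :=
  ContDiffOn ℝ ∞ φ U ∧ (∀ x ∈ U, gradient φ x ≠ 0) ∧
    ∀ x ∈ U, ∀ ξ : E3, symbolRe φ x ξ = 0 → symbolIm φ x ξ = 0 →
      poissonBracket (symbolRe φ) (symbolIm φ) x ξ = 0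

/-! ### The operator with cut-off coefficients -/

/-- The Pauli matrices. -/
def pauli : Fin 3 → Matrix (Fin 2) (Fin 2) ℂ :=
  ![!![0, 1; 1, 0], !![0, -Complex.I; Complex.I, 0], !![1, 0; 0, -1]]

/-- `σ · a` for `a ∈ ℂ³`. -/
def sigmaDot (a : Fin 3 → ℂ) : Matrix (Fin 2) (Fin 2) ℂ := ∑ j, a j • pauli j

/-- `|log h^α|`. -/
def absLog (α h : ℝ) : ℝ := |Real.log (h ^ α)|

/-- The set where `|1/q| ≤ √|log h^α|`; where `q = 0` one has `|1/q| = ∞`. -/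
def cutoffSet (q : E3 → ℂ) (α h : ℝ) : Set E3 :=
  {x | q x ≠ 0 ∧ ‖1 / q x‖ ≤ Real.sqrt (absLog α h)}

open Classical in
/-- The matrix `(1/q) (σ · Dq)` in the set where `|1/q| ≤ √|log h^α|`, and `0` elsewhere. -/
def cutoffMatrix (q : E3 → ℂ) (α h : ℝ) (x : E3) : Matrix (Fin 2) (Fin 2) ℂ :=
  if x ∈ cutoffSet q α h then (1 / q x) • sigmaDot (fun j => -Complex.I * pderiv3 j q x) else 0

/-- `Â(x,D) v = 2 A · D v - (1/q)(σ · Dq) σ · D v`, the second term being cut off. Here `v a` is the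
`a`-th component of a `ℂ²`-valued function `v`. -/
def hatA (Ω : Set E3) (A : E3 → E3) (q : E3 → ℂ) (α h : ℝ) (v : Fin 2 → E3 → ℂ) (x : E3) :
    Fin 2 → ℂ :=
  (fun a => 2 * ∑ j, (A x j : ℂ) * weakD Ω j (v a) x)
    - (cutoffMatrix q α h x).mulVec (∑ j, (pauli j).mulVec (fun a => weakD Ω j (v a) x))

/-- `q̂ = -(1/q)(σ · Dq) σ · A + q̃`, the first term being cut off. -/
def hatq (A : E3 → E3) (q qt : E3 → ℂ) (α h : ℝ) (x : E3) : Matrix (Fin 2) (Fin 2) ℂ :=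
  -(cutoffMatrix q α h x * sigmaDot (fun j => (A x j : ℂ))) + qt x • 1

/-- `(-Δ + Â(x,D) + q̂) v`. -/
def hatOp (Ω : Set E3) (A : E3 → E3) (q qt : E3 → ℂ) (α h : ℝ) (v : Fin 2 → E3 → ℂ) (x : E3) :
    Fin 2 → ℂ :=
  (fun a => -weakLaplacian Ω (v a) x) + hatA Ω A q α h v x
    + (hatq A q qt α h x).mulVec (fun a => v a x)

/-! ### The convexified weight -/

/-- `ε(h) = (C₀ |log h^α|)⁻¹`. -/
def epsh (C₀ α h : ℝ) : ℝ := (C₀ * absLog α h)⁻¹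

/-- `φ̃ = φ + (h/ε(h)) φ²/2`. -/
def convexWeight (φ : E3 → ℝ) (C₀ α h : ℝ) (x : E3) : ℝ :=
  φ x + h / epsh C₀ α h * (φ x ^ 2 / 2)

/-- `e^{φ̃/h}`. -/
def expWeight (φ : E3 → ℝ) (C₀ α h : ℝ) (x : E3) : ℝ :=
  Real.exp (convexWeight φ C₀ α h x / h)

/-- `∂_ν φ` on `∂Ω`. -/
def normalDerivWeight (Ω : Set E3) (φ : E3 → ℝ) (x : E3) : ℝ :=
  inner ℝ (gradient φ x) (outerNormal Ω x)

/-- `∂Ω₊ = {x ∈ ∂Ω : ∇φ · ν ≥ 0}`. -/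
def boundaryPlus (Ω : Set E3) (φ : E3 → ℝ) : Set E3 :=
  {x ∈ frontier Ω | 0 ≤ normalDerivWeight Ω φ x}

/-- `∂Ω₋ = {x ∈ ∂Ω : -∇φ · ν ≥ 0}`. -/
def boundaryMinus (Ω : Set E3) (φ : E3 → ℝ) : Set E3 :=
  {x ∈ frontier Ω | 0 ≤ -normalDerivWeight Ω φ x}

end

/-! The theorem is a Carleman estimate for the Laplacian with a convexified weight, strong enough to
absorb first order terms whose coefficients grow like `√|log h^α|`. Write ψ for the convexified
weight, κ = h/ε and η = 1 + κφ, so that ∇ψ = η∇φ, and put w = e^{ψ/h} v. Conjugation turns -h²Δ into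
a + b, with a = -h²Δw - |∇ψ|²w symmetric and b = h(2∇ψ·∇w + Δψ w) antisymmetric. Expanding ∫ (a +
b)² and integrating the cross term by parts leaves, up to lower order, 4h³ψ''(∇w,∇w) +
4hψ''(∇ψ,∇ψ)w². The boundary contributes 2h³ ∫ ∂_νψ |∂_νw|² on the side of the upper bound. The
limiting condition forces φ''(ξ,ξ) = -λ|ξ|² + 2(∇φ·ξ) φ''(∇φ,ξ)/|∇φ|²
(`IsLimitingCarlemanWeight.exists_extension`). In the commutator the λ part becomes a multiple of
w·a and the other part a multiple of b, both up to errors O(h²), so a² + b² absorbs them. The extra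
Hessian κ∇φ⊗∇φ of the convexification is positive: it gives 4hκ(h²(∇φ·∇w)² + η²|∇φ|⁴w²). This
controls w but only one component of ∇w. Adding a small multiple δκ of the identity for ∫ w a
restores the full gradient. Since h² = ε·hκ, all remaining errors are beaten once ε is small. The
integrations by parts enter as three integral identities, the Rellich identity `IsH2Zero.rellich`
and two with vanishing integral, so that everything else is the pointwise algebraic inequality
`carleman_pointwise`. They are combined in `exists_carleman_conjugated`. The operator is real, so
the estimate is applied to real and imaginary parts of each component and summed. Because 1/2 ≤ η ≤
3/2, the boundary term splits by the sign of ∂_νφ. The square of the lower order terms is at most a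
constant times |log h^α| h⁴(|v|² + |∇v|²), while the gain is (h²/ε)(|v|² + h²|∇v|²) with 1/ε =
C₀|log h^α|. A large C₀, depending only on the Carleman constant and on coefficient bounds, absorbs
them (`sum_laplacian_le`). Only the threshold for h depends on α. Since v is merely in H² and the
surface measure is a Hausdorff measure, the identities rest on the area formula for graphs, the
divergence theorem `setIntegral_fderiv_eq_integral_surfaceMeasure`, density of smooth functions in
H¹, existence of traces (`exists_isTrace`), and the fact that the gradient of a function vanishing
on the boundary is normal there (`trace_partial_eq_normal_mul`). -/

open MeasureTheory Filter Topology
open scoped ContDiff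

noncomputable section

/-! ### Area formula for embeddings, and surface integrals over graphs. -/

section AreaFormula

set_option linter.unusedSectionVars false

open Module Set
open scoped NNReal ENNReal

/-- A map that is `K`-Lipschitz relative to another one increases the Hausdorff measure of images by
at most `K ^ d`. -/
theorem euclideanHausdorffMeasure_image_le_of_edist_le {X Y Z : Type*} [EMetricSpace Y]
    [MeasurableSpace Y] [BorelSpace Y] [EMetricSpace Z] [MeasurableSpace Z] [BorelSpace Z]
    (f : X → Y) (g : X → Z) (s : Set X) (K : ℝ≥0) (d : ℕ)
    (h : ∀ x ∈ s, ∀ y ∈ s, edist (f x) (f y) ≤ K * edist (g x) (g y)) :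
    (μHE[d] : Measure Y) (f '' s) ≤ (K : ℝ≥0∞) ^ d * (μHE[d] : Measure Z) (g '' s) := by
  rcases isEmpty_or_nonempty X with hX | hX
  · simp [Set.eq_empty_of_isEmpty s]
  have hinv : ∀ x ∈ s, Function.invFunOn g s (g x) ∈ s ∧ g (Function.invFunOn g s (g x)) = g x :=
    fun x hx => ⟨Function.invFunOn_mem ⟨x, hx, rfl⟩, Function.invFunOn_eq ⟨x, hx, rfl⟩⟩
  -- On `s` the map `f` factors through `g`, and the factor is `K`-Lipschitz between the images. The
  -- bound for Lipschitz maps then applies.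
  have hlip : LipschitzOnWith K (f ∘ Function.invFunOn g s) (g '' s) := by
    rintro _ ⟨x, hx, rfl⟩ _ ⟨y, hy, rfl⟩
    have := h _ (hinv x hx).1 _ (hinv y hy).1
    rwa [(hinv x hx).2, (hinv y hy).2] at this
  have himg : f '' s = (f ∘ Function.invFunOn g s) '' (g '' s) := by
    rw [Set.image_image]
    refine Set.image_congr fun x hx => ?_
    have := h x hx _ (hinv x hx).1
    rw [(hinv x hx).2, edist_self, mul_zero, nonpos_iff_eq_zero, edist_eq_zero] at this
    exact this
  have := hlip.hausdorffMeasure_image_le (d := d) (by positivity)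
  rw [himg]
  simp only [Measure.euclideanHausdorffMeasure_def, Measure.smul_apply, ENNReal.smul_def,
    smul_eq_mul]
  rw [mul_left_comm]
  gcongr
  simpa using this

variable {U V : Type*} [NormedAddCommGroup U] [InnerProductSpace ℝ U] [FiniteDimensional ℝ U]
  [MeasurableSpace U] [BorelSpace U] [NormedAddCommGroup V] [InnerProductSpace ℝ V]
  [MeasurableSpace V] [BorelSpace V]

/-- Near a point where its derivative `L` is injective, a map distorts Hausdorff measure almost as
`L` does. -/
theorem exists_nhds_euclideanHausdorffMeasure_image_le {γ : U → V} {L : U →L[ℝ] V} {x₀ : U}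
    (hγ : HasStrictFDerivAt γ L x₀) (hL : Function.Injective L) {K : ℝ≥0} (hK : 1 < K) :
    ∃ N ∈ 𝓝 x₀, ∀ s ⊆ N,
      μHE[finrank ℝ U] (γ '' s) ≤
          (K : ℝ≥0∞) ^ finrank ℝ U * (ENNReal.ofReal L.toLinearMap.normDet * volume s) ∧
      ENNReal.ofReal L.toLinearMap.normDet * volume s ≤
          (K : ℝ≥0∞) ^ finrank ℝ U * μHE[finrank ℝ U] (γ '' s) := by
  obtain ⟨k, hk0, hk⟩ := L.toLinearMap.exists_antilipschitzWith (LinearMap.ker_eq_bot.2 hL)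
  have hk' : ∀ v, ‖v‖ ≤ k * ‖L v‖ := fun v => by
    simpa [dist_zero_right] using hk.le_mul_dist v 0
  have hK' : (1 : ℝ) < K := by exact_mod_cast hK
  have hkpos : (0 : ℝ) < k := by exact_mod_cast hk0
  -- With this tolerance the linearization error is at most (1 - K⁻¹)‖L(x - y)‖. As 1 - K⁻¹ ≤ K - 1,
  -- it follows that γ and L are `K`-Lipschitz relative to each other, in both directions.
  set δ : ℝ := (1 - (K : ℝ)⁻¹) / k with hδ
  have hδpos : 0 < δ := div_pos (by simpa using inv_lt_one_of_one_lt₀ hK') hkpos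
  have hev := hγ.isLittleO.def hδpos
  rw [nhds_prod_eq] at hev
  obtain ⟨N, hN, hN'⟩ := Filter.eventually_prod_self_iff'.1 hev
  have hest : ∀ x ∈ N, ∀ y ∈ N,
      ‖γ x - γ y - L (x - y)‖ ≤ (1 - (K : ℝ)⁻¹) * ‖L (x - y)‖ := fun x hx y hy => by
    refine (hN' x hx y hy).trans ?_
    calc δ * ‖x - y‖ ≤ δ * (k * ‖L (x - y)‖) := by gcongr; exact hk' _
      _ = _ := by rw [hδ]; field_simp
  have hKi : 1 - (K : ℝ)⁻¹ ≤ K - 1 := by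
    have : (K : ℝ) * (K : ℝ)⁻¹ = 1 := mul_inv_cancel₀ (by positivity)
    nlinarith [inv_pos.2 (zero_lt_one.trans hK')]
  have key : ∀ s ⊆ N, (∀ x ∈ s, ∀ y ∈ s, edist (γ x) (γ y) ≤ K * edist (L x) (L y)) ∧
      (∀ x ∈ s, ∀ y ∈ s, edist (L x) (L y) ≤ K * edist (γ x) (γ y)) := by
    intro s hs
    constructor
    · intro x hx y hy
      rw [edist_dist, edist_dist, ← ENNReal.ofReal_coe_nnreal, ← ENNReal.ofReal_mul K.coe_nonneg]
      refine ENNReal.ofReal_le_ofReal ?_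
      rw [dist_eq_norm, dist_eq_norm, ← map_sub]
      have h1 := hest x (hs hx) y (hs hy)
      have h2 : ‖γ x - γ y‖ ≤ ‖γ x - γ y - L (x - y)‖ + ‖L (x - y)‖ := by
        simpa using norm_add_le (γ x - γ y - L (x - y)) (L (x - y))
      nlinarith [norm_nonneg (L (x - y))]
    · intro x hx y hy
      rw [edist_dist, edist_dist, ← ENNReal.ofReal_coe_nnreal, ← ENNReal.ofReal_mul K.coe_nonneg]
      refine ENNReal.ofReal_le_ofReal ?_
      rw [dist_eq_norm, dist_eq_norm, ← map_sub]
      have h1 := hest x (hs hx) y (hs hy)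
      have h2 : ‖L (x - y)‖ ≤ ‖γ x - γ y‖ + ‖γ x - γ y - L (x - y)‖ := by
        simpa using norm_sub_le (γ x - γ y) (γ x - γ y - L (x - y))
      have h3 : (K : ℝ)⁻¹ * ‖L (x - y)‖ ≤ ‖γ x - γ y‖ := by linarith
      rwa [inv_mul_le_iff₀ (by positivity)] at h3
  refine ⟨N, hN, fun s hs => ?_⟩
  have hLs := L.toLinearMap.euclideanHausdorffMeasure_image_eq_normDet_mul_volume s
  rw [← hLs]
  exact ⟨euclideanHausdorffMeasure_image_le_of_edist_le _ _ _ _ _ (key s hs).1,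
    euclideanHausdorffMeasure_image_le_of_edist_le _ _ _ _ _ (key s hs).2⟩

/-- The area formula for a `C¹` embedding. -/
theorem comap_euclideanHausdorffMeasure_eq_withDensity {γ : U → V} (hγ : ContDiff ℝ 1 γ)
    (hemb : MeasurableEmbedding γ) (hinj : ∀ x, Function.Injective (fderiv ℝ γ x)) :
    (μHE[finrank ℝ U] : Measure V).comap γ =
      volume.withDensity fun x => ENNReal.ofReal (fderiv ℝ γ x).toLinearMap.normDet := by
  set m := (μHE[finrank ℝ U] : Measure V).comap γ with hm
  have hms : ∀ s, m s = μHE[finrank ℝ U] (γ '' s) := fun s => hemb.comap_apply _ _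
  have hstrict : ∀ x, HasStrictFDerivAt γ (fderiv ℝ γ x) x := fun x =>
    hγ.contDiffAt.hasStrictFDerivAt (by simp)
  have hloc : ∀ x, ∃ N ∈ 𝓝 x, ∀ s ⊆ N, m s ≤ (2 : ℝ≥0) ^ finrank ℝ U *
      (ENNReal.ofReal (fderiv ℝ γ x).toLinearMap.normDet * volume s) := fun x => by
    obtain ⟨N, hN, h⟩ := exists_nhds_euclideanHausdorffMeasure_image_le (hstrict x) (hinj x)
      (K := 2) (by norm_num)
    exact ⟨N, hN, fun s hs => by rw [hms]; exact (h s hs).1⟩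
  have hac : m ≪ volume := by
    intro s hs
    refine measure_null_of_locally_null s fun x _ => ?_
    obtain ⟨N, hN, h⟩ := hloc x
    refine ⟨s ∩ N, inter_mem_nhdsWithin s hN, ?_⟩
    have := h _ (inter_subset_right : s ∩ N ⊆ N)
    rw [measure_mono_null inter_subset_left hs] at this
    simpa using this
  have hfin : IsLocallyFiniteMeasure m := by
    refine ⟨fun x => ?_⟩
    obtain ⟨N, hN, h⟩ := hloc x
    obtain ⟨r, hr, hball⟩ := Metric.nhds_basis_closedBall.mem_iff.1 hN
    refine ⟨_, Metric.closedBall_mem_nhds x hr, (h _ hball).trans_lt ?_⟩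
    refine ENNReal.mul_lt_top (by simp) (ENNReal.mul_lt_top (by simp) ?_)
    exact (isCompact_closedBall x r).measure_lt_top
  -- The density is the almost everywhere limit of ratios over shrinking balls. The local comparison
  -- pins it between the Jacobian times K^{-d} and times K^d for every K > 1, and K → 1 identifies
  -- it.
  rw [← Measure.withDensity_rnDeriv_eq m volume hac]
  refine withDensity_congr_ae ?_
  filter_upwards [Besicovitch.ae_tendsto_rnDeriv m volume] with x hx
  set D := ENNReal.ofReal (fderiv ℝ γ x).toLinearMap.normDet
  set R := m.rnDeriv volume x
  have hbounds : ∀ K : ℝ≥0, 1 < K → R ≤ (K : ℝ≥0∞) ^ finrank ℝ U * D ∧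
      D ≤ (K : ℝ≥0∞) ^ finrank ℝ U * R := by
    intro K hK
    obtain ⟨N, hN, h⟩ := exists_nhds_euclideanHausdorffMeasure_image_le (hstrict x) (hinj x) hK
    obtain ⟨r, hr, hball⟩ := Metric.nhds_basis_closedBall.mem_iff.1 hN
    have hev : ∀ᶠ t in 𝓝[>] (0 : ℝ), 0 < t ∧ Metric.closedBall x t ⊆ N := by
      filter_upwards [Ioc_mem_nhdsGT hr] with t ht
      exact ⟨ht.1, (Metric.closedBall_subset_closedBall ht.2).trans hball⟩
    have hvol : ∀ t, 0 < t → volume (Metric.closedBall x t) ≠ 0 ∧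
        volume (Metric.closedBall x t) ≠ ⊤ := fun t ht =>
      ⟨(Metric.measure_closedBall_pos volume x ht).ne', measure_closedBall_lt_top.ne⟩
    constructor
    · refine le_of_tendsto hx ?_
      filter_upwards [hev] with t ht
      rw [ENNReal.div_le_iff (hvol t ht.1).1 (hvol t ht.1).2, hms, mul_assoc]
      exact (h _ ht.2).1
    · have hx' := ENNReal.Tendsto.const_mul (a := (K : ℝ≥0∞) ^ finrank ℝ U) hx
        (Or.inr (by simp))
      refine ge_of_tendsto hx' ?_
      filter_upwards [hev] with t ht
      rw [← mul_div_assoc, ENNReal.le_div_iff_mul_le (Or.inl (hvol t ht.1).1)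
        (Or.inl (hvol t ht.1).2), hms]
      exact (h _ ht.2).2
  have hlim : ∀ a : ℝ≥0∞, Tendsto (fun K : ℝ≥0 => (K : ℝ≥0∞) ^ finrank ℝ U * a) (𝓝[>] 1)
      (𝓝 a) := by
    intro a
    have h1 : Tendsto (fun K : ℝ≥0 => (K : ℝ≥0∞) ^ finrank ℝ U) (𝓝[>] 1) (𝓝 1) := by
      have : Continuous fun K : ℝ≥0 => ((K ^ finrank ℝ U : ℝ≥0) : ℝ≥0∞) := by fun_prop
      simpa using (this.tendsto 1).mono_left nhdsWithin_le_nhds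
    simpa using ENNReal.Tendsto.mul_const (b := a) h1 (Or.inl one_ne_zero)
  refine le_antisymm (ge_of_tendsto (hlim D) ?_) (ge_of_tendsto (hlim R) ?_)
  · filter_upwards [self_mem_nhdsWithin] with K hK using (hbounds K hK).1
  · filter_upwards [self_mem_nhdsWithin] with K hK using (hbounds K hK).2

/-- The graph of `g` over `U`, in the orthogonal coordinates `e`. -/
def graphMap (e : WithLp 2 (U × ℝ) ≃ₗᵢ[ℝ] V) (g : U → ℝ) (y : U) : V :=
  e (WithLp.toLp 2 (y, g y))

theorem hasFDerivAt_graphMap (e : WithLp 2 (U × ℝ) ≃ₗᵢ[ℝ] V) {g : U → ℝ} {g' : U →L[ℝ] ℝ} {y : U}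
    (hg : HasFDerivAt g g' y) :
    HasFDerivAt (graphMap e g) ((e.toContinuousLinearEquiv : WithLp 2 (U × ℝ) →L[ℝ] V) ∘L
      ((WithLp.prodContinuousLinearEquiv 2 ℝ U ℝ).symm : U × ℝ →L[ℝ] WithLp 2 (U × ℝ)) ∘L
      (ContinuousLinearMap.id ℝ U).prod g') y :=
  HasFDerivAt.comp (g := e) y
    (e.toContinuousLinearEquiv : WithLp 2 (U × ℝ) →L[ℝ] V).hasFDerivAt
    (HasFDerivAt.comp (g := WithLp.toLp 2) y
      ((WithLp.prodContinuousLinearEquiv 2 ℝ U ℝ).symm :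
        U × ℝ →L[ℝ] WithLp 2 (U × ℝ)).hasFDerivAt ((hasFDerivAt_id y).prodMk hg))

theorem contDiff_graphMap (e : WithLp 2 (U × ℝ) ≃ₗᵢ[ℝ] V) {g : U → ℝ} {n : ℕ∞ω}
    (hg : ContDiff ℝ n g) : ContDiff ℝ n (graphMap e g) :=
  e.toContinuousLinearEquiv.contDiff.comp
    ((WithLp.prodContinuousLinearEquiv 2 ℝ U ℝ).symm.contDiff.comp (contDiff_id.prodMk hg))

theorem measurableEmbedding_graphMap (e : WithLp 2 (U × ℝ) ≃ₗᵢ[ℝ] V) {g : U → ℝ}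
    (hg : Continuous g) : MeasurableEmbedding (graphMap e g) := by
  -- The graph of a continuous function over a closed set is closed in the product.
  have h1 : IsClosedEmbedding fun y : U => (y, g y) :=
    .of_continuous_injective_isClosedMap (by fun_prop) (fun a b h => congrArg Prod.fst h) <| by
      intro s hs
      have : (fun y : U => (y, g y)) '' s = {p : U × ℝ | p.1 ∈ s ∧ p.2 = g p.1} := by
        ext ⟨a, b⟩
        simp only [mem_image, Prod.mk.injEq, mem_ofPred_eq]
        constructor
        · rintro ⟨x, hx, rfl, rfl⟩; exact ⟨hx, rfl⟩
        · rintro ⟨hx, rfl⟩; exact ⟨a, hx, rfl, rfl⟩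
      rw [this]
      exact (hs.preimage continuous_fst).inter (isClosed_eq continuous_snd (by fun_prop))
  exact ((e.toHomeomorph.isClosedEmbedding.comp
    (WithLp.prodContinuousLinearEquiv 2 ℝ U ℝ).symm.toHomeomorph.isClosedEmbedding).comp
      h1).measurableEmbedding

theorem injective_fderiv_graphMap (e : WithLp 2 (U × ℝ) ≃ₗᵢ[ℝ] V) {g : U → ℝ} {y : U}
    (hg : DifferentiableAt ℝ g y) : Function.Injective (fderiv ℝ (graphMap e g) y) := by
  rw [(hasFDerivAt_graphMap e hg.hasFDerivAt).fderiv]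
  intro a b h
  have := e.injective h
  exact congrArg Prod.fst ((WithLp.prodContinuousLinearEquiv 2 ℝ U ℝ).symm.injective this)

/-- The area element of a two-dimensional graph. -/
theorem normDet_fderiv_graphMap (hU : finrank ℝ U = 2) (e : WithLp 2 (U × ℝ) ≃ₗᵢ[ℝ] V) {g : U → ℝ}
    {y : U} (hg : DifferentiableAt ℝ g y) :
    (fderiv ℝ (graphMap e g) y).toLinearMap.normDet = √(1 + ‖gradient g y‖ ^ 2) := by
  let b : OrthonormalBasis (Fin 2) ℝ U := (stdOrthonormalBasis ℝ U).reindex (finCongr hU)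
  have h := (fderiv ℝ (graphMap e g) y).toLinearMap.normDet_sq_eq_det_gram b
  rw [eq_comm, Real.sqrt_eq_iff_mul_self_eq (by positivity) (LinearMap.normDet_nonneg _), ← sq]
  -- The Gram matrix is I + ppᵀ with p the gradient of g, so its determinant is 1 + |p|².
  have hb : ∀ i j, inner ℝ (fderiv ℝ (graphMap e g) y (b i)) (fderiv ℝ (graphMap e g) y (b j)) =
      (if i = j then 1 else 0) + fderiv ℝ g y (b i) * fderiv ℝ g y (b j) := by
    intro i j
    rw [(hasFDerivAt_graphMap e hg.hasFDerivAt).fderiv]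
    change inner ℝ (e (WithLp.toLp 2 (b i, fderiv ℝ g y (b i))))
      (e (WithLp.toLp 2 (b j, fderiv ℝ g y (b j)))) = _
    rw [e.inner_map_map, WithLp.prod_inner_apply]
    simp [orthonormal_iff_ite.1 b.orthonormal, mul_comm]
  have hn : ‖gradient g y‖ ^ 2 = ∑ i, fderiv ℝ g y (b i) ^ 2 := by
    rw [← b.sum_sq_norm_inner_left]
    refine Finset.sum_congr rfl fun i _ => ?_
    rw [gradient, InnerProductSpace.toDual_symm_apply]
    simp
  rw [Matrix.det_fin_two] at h
  simp only [Matrix.gram_apply, ContinuousLinearMap.coe_coe, hb] at h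
  rw [hn, Fin.sum_univ_two]
  simp at h
  rw [h]
  ring

theorem restrict_range_graphMap_eq (hU : finrank ℝ U = 2) (e : WithLp 2 (U × ℝ) ≃ₗᵢ[ℝ] V)
    {g : U → ℝ} (hg : ContDiff ℝ 1 g) :
    (μHE[2] : Measure V).restrict (range (graphMap e g)) =
      (volume.withDensity fun y => ENNReal.ofReal √(1 + ‖gradient g y‖ ^ 2)).map (graphMap e g) := by
  have hd : ∀ y, DifferentiableAt ℝ g y := fun y => hg.differentiable (by simp) y
  rw [← (measurableEmbedding_graphMap e hg.continuous).map_comap, ← hU,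
    comap_euclideanHausdorffMeasure_eq_withDensity (contDiff_graphMap e hg)
      (measurableEmbedding_graphMap e hg.continuous) fun y => injective_fderiv_graphMap e (hd y)]
  simp_rw [normDet_fderiv_graphMap hU e (hd _), hU]

theorem continuous_sqrt_one_add_gradient {g : U → ℝ} (hg : ContDiff ℝ 1 g) :
    Continuous fun y => √(1 + ‖gradient g y‖ ^ 2) := by
  have : Continuous (gradient g) :=
    (InnerProductSpace.toDual ℝ U).symm.continuous.comp (hg.continuous_fderiv (by simp))
  fun_prop

/-- Surface integrals over a two-dimensional graph. -/
theorem setIntegral_range_graphMap (hU : finrank ℝ U = 2) (e : WithLp 2 (U × ℝ) ≃ₗᵢ[ℝ] V)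
    {g : U → ℝ} (hg : ContDiff ℝ 1 g) (F : V → ℝ) :
    ∫ x in range (graphMap e g), F x ∂(μHE[2] : Measure V) =
      ∫ y, √(1 + ‖gradient g y‖ ^ 2) * F (graphMap e g y) := by
  rw [restrict_range_graphMap_eq hU e hg,
    (measurableEmbedding_graphMap e hg.continuous).integral_map,
    integral_withDensity_eq_integral_toReal_smul₀]
  · simp [ENNReal.toReal_ofReal (Real.sqrt_nonneg _)]
  · exact ((continuous_sqrt_one_add_gradient hg).measurable.ennreal_ofReal).aemeasurable
  · simp

theorem euclideanHausdorffMeasure_image_graphMap_lt_top (hU : finrank ℝ U = 2)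
    (e : WithLp 2 (U × ℝ) ≃ₗᵢ[ℝ] V) {g : U → ℝ} (hg : ContDiff ℝ 1 g) {K : Set U}
    (hK : IsCompact K) : (μHE[2] : Measure V) (graphMap e g '' K) < ⊤ := by
  have hemb := measurableEmbedding_graphMap e hg.continuous
  have h1 : (μHE[2] : Measure V) (graphMap e g '' K) =
      (μHE[2] : Measure V).restrict (range (graphMap e g)) (graphMap e g '' K) := by
    rw [Measure.restrict_apply (hemb.measurableSet_image.2 hK.measurableSet),
      inter_eq_left.2 (image_subset_range _ _)]
  rw [h1, restrict_range_graphMap_eq hU e hg, hemb.map_apply, preimage_image_eq _ hemb.injective,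
    withDensity_apply _ hK.measurableSet]
  have := ((continuous_sqrt_one_add_gradient hg).continuousOn.integrableOn_compact hK
    (μ := volume)).lintegral_lt_top
  exact this

end AreaFormula

/-! ### Independence of the outer normal from the defining function. -/

section Normal

open Set

/-- A short step from x in a direction along which ρ₁ decreases lands in Ω, where ρ₂ is negative
too; hence the difference quotients of ρ₂ along this ray are nonpositive. -/
theorem inner_gradient_nonpos_of_isLocalDefiningFunction {Ω : Set E3} {x : E3} {ρ₁ ρ₂ : E3 → ℝ}
    (h₁ : IsLocalDefiningFunction Ω x ρ₁) (h₂ : IsLocalDefiningFunction Ω x ρ₂) {v : E3}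
    (hv : inner ℝ (gradient ρ₁ x) v < 0) : inner ℝ (gradient ρ₂ x) v ≤ 0 := by
  have hline : HasDerivAt (fun t : ℝ => x + t • v) v 0 := by
    simpa using ((hasDerivAt_id (0 : ℝ)).smul_const v).const_add x
  have hder : ∀ ρ : E3 → ℝ, ContDiff ℝ ∞ ρ →
      HasDerivAt (fun t : ℝ => ρ (x + t • v)) (inner ℝ (gradient ρ x) v) 0 := by
    intro ρ hρ
    have h := ((hρ.differentiable (by simp)) x).hasGradientAt.hasFDerivAt
    have h' : HasFDerivAt ρ ((InnerProductSpace.toDual ℝ E3) (gradient ρ x)) (x + (0 : ℝ) • v) := by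
      simpa using h
    exact h'.comp_hasDerivAt (0 : ℝ) hline
  have ht : Tendsto (fun t : ℝ => x + t • v) (𝓝[>] 0) (𝓝 x) := by
    have := hline.continuousAt.tendsto
    simp only [zero_smul, add_zero] at this
    exact this.mono_left nhdsWithin_le_nhds
  have hneg : ∀ᶠ t : ℝ in 𝓝[>] 0, ρ₁ (x + t • v) < 0 := by
    have := (hder ρ₁ h₁.1).tendsto_slope_zero_right.eventually (gt_mem_nhds hv)
    filter_upwards [this, self_mem_nhdsWithin] with t ht1 ht2
    have ht2 : 0 < t := ht2
    simp only [zero_add, zero_smul, add_zero, h₁.2.1, sub_zero, smul_eq_mul] at ht1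
    by_contra hcon
    exact absurd ht1 (not_lt.2 (mul_nonneg (inv_pos.2 ht2).le (not_lt.1 hcon)))
  refine le_of_tendsto (hder ρ₂ h₂.1).tendsto_slope_zero_right ?_
  filter_upwards [hneg, ht.eventually h₁.2.2.2, ht.eventually h₂.2.2.2, self_mem_nhdsWithin]
    with t h3 h4 h5 h6
  have h6 : 0 < t := h6
  simp only [zero_add, zero_smul, add_zero, h₂.2.1, sub_zero, smul_eq_mul]
  exact mul_nonpos_of_nonneg_of_nonpos (inv_pos.2 h6).le (h5.1 (h4.2 h3)).le

/-- The outer normal can be computed with any local defining function. -/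
theorem outerNormal_eq_of_isLocalDefiningFunction {Ω : Set E3} {x : E3} {ρ : E3 → ℝ}
    (hρ : IsLocalDefiningFunction Ω x ρ) :
    outerNormal Ω x = ‖gradient ρ x‖⁻¹ • gradient ρ x := by
  have hex : ∃ ρ : E3 → ℝ, IsLocalDefiningFunction Ω x ρ := ⟨ρ, hρ⟩
  rw [outerNormal, dif_pos hex]
  have hc := hex.choose_spec
  set a := gradient hex.choose x with ha
  set b := gradient ρ x with hb
  have ha0 : a ≠ 0 := hc.2.2.1
  have hb0 : b ≠ 0 := hρ.2.2.1
  have hna : 0 < ‖a‖ := norm_pos_iff.2 ha0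
  have hnb : 0 < ‖b‖ := norm_pos_iff.2 hb0
  have hab : 0 ≤ inner ℝ a b := by
    have : inner ℝ b (-a) ≤ 0 := inner_gradient_nonpos_of_isLocalDefiningFunction hc hρ (by
      rw [inner_neg_right, real_inner_self_eq_norm_sq]; nlinarith)
    rw [inner_neg_right, real_inner_comm] at this
    linarith
  -- Test direction: the component of b orthogonal to a, tilted by -εa so that the first defining
  -- function strictly decreases. As ε → 0 this component must vanish, which with ⟨a, b⟩ ≥ 0 is
  -- equality in Cauchy–Schwarz.
  have key : ∀ ε : ℝ, 0 < ε → ‖b‖ ^ 2 - inner ℝ a b ^ 2 / ‖a‖ ^ 2 ≤ ε * inner ℝ a b := by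
    intro ε hε
    have h1 : inner ℝ a (b - (inner ℝ a b / ‖a‖ ^ 2) • a - ε • a) = -(ε * ‖a‖ ^ 2) := by
      rw [inner_sub_right, inner_sub_right, inner_smul_right, inner_smul_right,
        real_inner_self_eq_norm_sq]
      field_simp
      ring
    have h2 := inner_gradient_nonpos_of_isLocalDefiningFunction hc hρ
      (v := b - (inner ℝ a b / ‖a‖ ^ 2) • a - ε • a) (by rw [← ha, h1]; nlinarith [sq_pos_of_pos hna])
    rw [← hb, inner_sub_right, inner_sub_right, inner_smul_right, inner_smul_right,
      real_inner_self_eq_norm_sq, real_inner_comm a b] at h2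
    have : inner ℝ a b / ‖a‖ ^ 2 * inner ℝ a b = inner ℝ a b ^ 2 / ‖a‖ ^ 2 := by ring
    linarith
  have hle : ‖b‖ ^ 2 - inner ℝ a b ^ 2 / ‖a‖ ^ 2 ≤ 0 := by
    have ht : Tendsto (fun ε : ℝ => ε * inner ℝ a b) (𝓝[>] 0) (𝓝 0) := by
      have : Continuous fun ε : ℝ => ε * inner ℝ a b := by fun_prop
      simpa using (this.tendsto 0).mono_left nhdsWithin_le_nhds
    refine ge_of_tendsto ht ?_
    filter_upwards [self_mem_nhdsWithin] with ε hε using key ε hε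
  have heq : inner ℝ a b = ‖a‖ * ‖b‖ := by
    refine le_antisymm (real_inner_le_norm a b) ?_
    rw [sub_nonpos, le_div_iff₀ (by positivity), ← mul_pow] at hle
    rw [mul_comm]
    exact le_of_sq_le_sq hle hab
  have := inner_eq_norm_mul_iff_real.1 heq
  rw [inv_smul_eq_iff₀ hna.ne', smul_comm, ← this, smul_smul, inv_mul_cancel₀ hnb.ne', one_smul]

theorem IsLocalDefiningFunction.eventually_of_frontier {Ω : Set E3} {x : E3} {ρ : E3 → ℝ}
    (h : IsLocalDefiningFunction Ω x ρ) :
    ∀ᶠ y in 𝓝 x, ρ y = 0 → IsLocalDefiningFunction Ω y ρ := by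
  have hcont : Continuous (gradient ρ) :=
    (InnerProductSpace.toDual ℝ E3).symm.continuous.comp (h.1.continuous_fderiv (by simp))
  filter_upwards [hcont.continuousAt.eventually_ne h.2.2.1, h.2.2.2.eventually_nhds] with y h1 h2 h3
  exact ⟨h.1, h3, h1, h2⟩

end Normal

/-! ### Local description of Ω as a rotated subgraph. -/

section Chart

open Set

/-- The Euclidean plane. -/
abbrev E2 : Type := EuclideanSpace ℝ (Fin 2)

/-- In the open set `W`, and in the orthogonal coordinates `e`, the set `Ω` lies below the graph
of `g`. -/
structure IsGraphChart (Ω W : Set E3) (e : WithLp 2 (E2 × ℝ) ≃ₗᵢ[ℝ] E3) (g : E2 → ℝ) : Prop where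
  isOpen : IsOpen W
  contDiff : ContDiff ℝ 1 g
  mem_iff : ∀ y s, e (WithLp.toLp 2 (y, s)) ∈ W → (e (WithLp.toLp 2 (y, s)) ∈ Ω ↔ s < g y)
  outerNormal_eq : ∀ y, graphMap e g y ∈ W → outerNormal Ω (graphMap e g y) =
    (√(1 + ‖gradient g y‖ ^ 2))⁻¹ • e (WithLp.toLp 2 (-gradient g y, 1))

/-- Any isometry with the right dimensions can be followed by the reflection that exchanges the
image of the vertical unit vector with n. -/
theorem exists_linearIsometryEquiv_apply_eq {n : E3} (hn : ‖n‖ = 1) :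
    ∃ e : WithLp 2 (E2 × ℝ) ≃ₗᵢ[ℝ] E3, e (WithLp.toLp 2 (0, 1)) = n := by
  have hrank : Module.finrank ℝ (WithLp 2 (E2 × ℝ)) = 3 := by
    rw [(WithLp.linearEquiv 2 ℝ (E2 × ℝ)).finrank_eq]
    simp
  let e₀ : WithLp 2 (E2 × ℝ) ≃ₗᵢ[ℝ] E3 :=
    ((stdOrthonormalBasis ℝ (WithLp 2 (E2 × ℝ))).reindex (finCongr hrank)).repr
  have hnorm : ‖e₀ (WithLp.toLp 2 (0, 1))‖ = ‖n‖ := by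
    rw [e₀.norm_map, hn, WithLp.prod_norm_eq_of_L2]
    simp
  exact ⟨e₀.trans (Submodule.reflection (Submodule.span ℝ {e₀ (WithLp.toLp 2 (0, 1)) - n})ᗮ),
    Submodule.reflection_sub hnorm⟩

/-- Frontiers are local, so inside W only the open subgraph matters. Its frontier lies in the graph
by continuity, and every graph point is approached vertically from below. -/
theorem IsGraphChart.mem_frontier_iff {Ω W : Set E3} {e : WithLp 2 (E2 × ℝ) ≃ₗᵢ[ℝ] E3} {g : E2 → ℝ}
    (hc : IsGraphChart Ω W e g) {x : E3} (hx : x ∈ W) :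
    x ∈ frontier Ω ↔ x ∈ range (graphMap e g) := by
  let S : Set E3 := {x | (e.symm x).ofLp.2 < g (e.symm x).ofLp.1}
  have hgc := hc.contDiff.continuous
  have hcont : Continuous fun x : E3 => (e.symm x).ofLp := by
    have := (WithLp.prodContinuousLinearEquiv 2 ℝ E2 ℝ).continuous.comp e.symm.continuous
    exact this
  have hez : ∀ z, e (WithLp.toLp 2 ((e.symm z).ofLp.1, (e.symm z).ofLp.2)) = z :=
    fun z => e.apply_symm_apply z
  have hset : Ω ∩ W = S ∩ W := by
    ext z
    refine and_congr_left fun hz => ?_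
    have := hc.mem_iff (e.symm z).ofLp.1 (e.symm z).ofLp.2 (by rwa [hez])
    rwa [hez] at this
  have hfr : frontier Ω ∩ W = frontier S ∩ W := by
    rw [← frontier_inter_open_inter hc.isOpen, hset, frontier_inter_open_inter hc.isOpen]
  have hiff : x ∈ frontier Ω ↔ x ∈ frontier S := by
    have := Set.ext_iff.1 hfr x
    simpa [hx] using this
  rw [hiff]
  constructor
  · intro h
    have := frontier_lt_subset_eq (continuous_snd.comp hcont)
      (hgc.comp (continuous_fst.comp hcont)) h
    refine ⟨(e.symm x).ofLp.1, ?_⟩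
    have h' : (e.symm x).ofLp.2 = g (e.symm x).ofLp.1 := this
    rw [graphMap, ← h', hez]
  · rintro ⟨y, rfl⟩
    have hopen : IsOpen S :=
      isOpen_lt (continuous_snd.comp hcont) (hgc.comp (continuous_fst.comp hcont))
    rw [hopen.frontier_eq]
    refine ⟨?_, by simp [S, graphMap]⟩
    have ht : Tendsto (fun t : ℝ => e (WithLp.toLp 2 (y, g y - t))) (𝓝[>] 0)
        (𝓝 (graphMap e g y)) := by
      have : Continuous fun t : ℝ => e (WithLp.toLp 2 (y, g y - t)) :=
        e.continuous.comp ((WithLp.prodContinuousLinearEquiv 2 ℝ E2 ℝ).symm.continuous.comp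
          (by fun_prop : Continuous fun t : ℝ => (y, g y - t)))
      simpa [graphMap] using (this.tendsto 0).mono_left nhdsWithin_le_nhds
    refine mem_closure_of_tendsto ht ?_
    filter_upwards [self_mem_nhdsWithin] with t ht
    simpa [S] using ht

/-- In coordinates whose vertical axis is the normal at x₀, the vertical derivative of ρ is positive
in a box. The implicit function theorem gives the zero set as a graph, and monotonicity along
vertical lines shows that ρ < 0 exactly below it. -/
theorem exists_isGraphChart {Ω : Set E3} {x₀ : E3} {ρ : E3 → ℝ}
    (hρ : IsLocalDefiningFunction Ω x₀ ρ) :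
    ∃ (W : Set E3) (e : WithLp 2 (E2 × ℝ) ≃ₗᵢ[ℝ] E3) (g : E2 → ℝ),
      x₀ ∈ W ∧ IsGraphChart Ω W e g := by
  have hgrad0 : 0 < ‖gradient ρ x₀‖ := norm_pos_iff.2 hρ.2.2.1
  have hunit : ‖‖gradient ρ x₀‖⁻¹ • gradient ρ x₀‖ = 1 := by
    rw [norm_smul, norm_inv, norm_norm, inv_mul_cancel₀ hgrad0.ne']
  obtain ⟨e, he⟩ := exists_linearIsometryEquiv_apply_eq hunit
  let c : (E2 × ℝ) ≃L[ℝ] E3 :=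
    (WithLp.prodContinuousLinearEquiv 2 ℝ E2 ℝ).symm.trans e.toContinuousLinearEquiv
  have hcapp : ∀ y s, c (y, s) = e (WithLp.toLp 2 (y, s)) := fun _ _ => rfl
  set f : E2 × ℝ → ℝ := fun p => ρ (c p) with hf
  have hfsm : ContDiff ℝ ∞ f := hρ.1.comp c.contDiff
  have hgradcont : Continuous (gradient ρ) :=
    (InnerProductSpace.toDual ℝ E3).symm.continuous.comp (hρ.1.continuous_fderiv (by simp))
  have hgradρ : ∀ x v, fderiv ℝ ρ x v = inner ℝ (gradient ρ x) v := fun x v => by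
    rw [gradient, InnerProductSpace.toDual_symm_apply]
  have hfder : ∀ p v, fderiv ℝ f p v = inner ℝ (gradient ρ (c p)) (c v) := by
    intro p v
    have h1 : HasFDerivAt f ((fderiv ℝ ρ (c p)).comp (c : E2 × ℝ →L[ℝ] E3)) p :=
      ((hρ.1.differentiable (by simp)) (c p)).hasFDerivAt.comp p c.hasFDerivAt
    rw [h1.fderiv]
    exact hgradρ _ _
  set n : E3 := c (0, 1) with hn
  have hn' : n = ‖gradient ρ x₀‖⁻¹ • gradient ρ x₀ := he
  set u : E2 × ℝ := c.symm x₀ with hu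
  have hcu : c u = x₀ := c.apply_symm_apply x₀
  have hpos : 0 < inner ℝ (gradient ρ (c u)) n := by
    rw [hcu, hn', inner_smul_right, real_inner_self_eq_norm_sq]
    positivity
  have hinv : (fderiv ℝ f u ∘L .inr ℝ E2 ℝ).IsInvertible := by
    refine ⟨ContinuousLinearEquiv.unitsEquivAut ℝ (Units.mk0 _ hpos.ne'), ?_⟩
    ext
    simp [hfder, hn]
  have cdf : ContDiffAt ℝ 1 f u := (hfsm.of_le (by simp)).contDiffAt
  set g₀ := cdf.implicitFunction (by simp) hinv with hg₀
  have hg₀1 : ContDiffAt ℝ 1 g₀ u.1 := cdf.contDiffAt_implicitFunction (by simp) hinv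
  have hg₀u : g₀ u.1 = u.2 := cdf.implicitFunction_apply_self (by simp) hinv
  have hfu : f u = 0 := by simp only [hf, hcu, hρ.2.1]
  have hg₀0 : ∀ᶠ y in 𝓝 u.1, f (y, g₀ y) = 0 := by
    have := cdf.eventually_apply_implicitFunction (by simp) hinv
    rwa [hfu] at this
  -- extend `g₀` to a globally `C¹` function
  obtain ⟨g, hg, hgg₀⟩ : ∃ g : E2 → ℝ, ContDiff ℝ 1 g ∧ g =ᶠ[𝓝 u.1] g₀ := by
    obtain ⟨v, hv, hvd⟩ := hg₀1.contDiffOn (m := 1) le_rfl (by simp)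
    obtain ⟨r, hr, hball⟩ := Metric.nhds_basis_ball.mem_iff.1 hv
    let χ : ContDiffBump u.1 := ⟨r / 4, r / 2, by positivity, by linarith⟩
    refine ⟨fun y => χ y * g₀ y, ?_, ?_⟩
    · rw [contDiff_iff_contDiffAt]
      intro y
      by_cases hy : y ∈ Metric.ball u.1 r
      · exact χ.contDiff.contDiffAt.mul
          ((hvd.mono hball).contDiffAt (Metric.isOpen_ball.mem_nhds hy))
      · have hy' : y ∉ tsupport χ := by
          rw [χ.tsupport_eq]
          simp only [Metric.mem_ball, Metric.mem_closedBall, not_lt, not_le] at hy ⊢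
          have : χ.rOut = r / 2 := rfl
          rw [this]; linarith
        refine contDiffAt_const (c := (0 : ℝ)) |>.congr_of_eventuallyEq ?_
        filter_upwards [(isClosed_tsupport _).isOpen_compl.mem_nhds hy'] with z hz
        simp [image_eq_zero_of_notMem_tsupport hz]
    · filter_upwards [χ.eventuallyEq_one] with y hy
      simp [hy]
  have hgu : g u.1 = u.2 := hgg₀.self_of_nhds.trans hg₀u
  have hg0 : ∀ᶠ y in 𝓝 u.1, f (y, g y) = 0 := by
    filter_upwards [hgg₀, hg₀0] with y h1 h2
    rw [h1, h2]
  -- a box on which everything holds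
  have hderpos : ∀ᶠ p in 𝓝 u, 0 < inner ℝ (gradient ρ (c p)) n := by
    have : Continuous fun p => inner ℝ (gradient ρ (c p)) n :=
      (hgradcont.comp c.continuous).inner continuous_const
    exact this.continuousAt.eventually (lt_mem_nhds hpos)
  have hΩρ : ∀ᶠ p in 𝓝 u, (c p ∈ Ω ↔ ρ (c p) < 0) ∧
      (ρ (c p) = 0 → IsLocalDefiningFunction Ω (c p) ρ) := by
    have hct : Tendsto c (𝓝 u) (𝓝 x₀) := hcu ▸ c.continuous.tendsto u
    exact hct.eventually (hρ.2.2.2.and hρ.eventually_of_frontier)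
  obtain ⟨r, hr, hbox⟩ := Metric.nhds_basis_ball.eventually_iff.1 (hderpos.and hΩρ)
  have hgt : ∀ᶠ y in 𝓝 u.1, g y ∈ Metric.ball u.2 r := by
    have := hg.continuous.continuousAt (x := u.1)
    rw [ContinuousAt, hgu] at this
    exact this.eventually (Metric.ball_mem_nhds _ hr)
  obtain ⟨r', hr', hball'⟩ := Metric.nhds_basis_ball.eventually_iff.1
    (hgt.and (hg0.eventually_nhds))
  set W : Set E3 := c.symm ⁻¹' ((Metric.ball u.1 (min r r')) ×ˢ Metric.ball u.2 r) with hW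
  have hWmem : ∀ y s, c (y, s) ∈ W ↔ y ∈ Metric.ball u.1 (min r r') ∧ s ∈ Metric.ball u.2 r := by
    intro y s
    simp [hW]
  have hinbox : ∀ y ∈ Metric.ball u.1 (min r r'), ∀ s ∈ Metric.ball u.2 r,
      (y, s) ∈ Metric.ball u r := by
    intro y hy s hs
    rw [← ball_prod_same]
    exact ⟨Metric.ball_subset_ball (min_le_left _ _) hy, hs⟩
  refine ⟨W, e, g, ?_, ?_, hg, ?_, ?_⟩
  · rw [← hcu]
    exact (hWmem u.1 u.2).2 ⟨Metric.mem_ball_self (by positivity), Metric.mem_ball_self hr⟩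
  · exact (Metric.isOpen_ball.prod Metric.isOpen_ball).preimage c.symm.continuous
  · intro y s hys
    obtain ⟨hy, hs⟩ := (hWmem y s).1 hys
    have hy' := hball' (Metric.ball_subset_ball (min_le_right _ _) hy)
    have hmono : StrictMonoOn (fun s => f (y, s)) (Metric.ball u.2 r) := by
      have hder : ∀ s, HasDerivAt (fun s => f (y, s)) (inner ℝ (gradient ρ (c (y, s))) n) s := by
        intro s
        have h1 : HasDerivAt (fun s : ℝ => (y, s)) ((0 : E2), (1 : ℝ)) s :=
          (hasDerivAt_const s y).prodMk (hasDerivAt_id s)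
        have h2 := ((hfsm.differentiable (by simp)) (y, s)).hasFDerivAt.comp_hasDerivAt s h1
        rwa [hfder] at h2
      refine strictMonoOn_of_deriv_pos (convex_ball _ _)
        (fun s _ => (hder s).continuousAt.continuousWithinAt) ?_
      intro s hs
      rw [Metric.isOpen_ball.interior_eq] at hs
      rw [(hder s).deriv]
      exact (hbox (hinbox y hy s hs)).1
    rw [← hcapp, (hbox (hinbox y hy s hs)).2.1]
    have := hmono.lt_iff_lt hs hy'.1
    rw [← this, hy'.2.self_of_nhds]
  · intro y hyW
    obtain ⟨hy, hs⟩ := (hWmem y (g y)).1 hyW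
    have hy' := hball' (Metric.ball_subset_ball (min_le_right _ _) hy)
    have h0 : ρ (c (y, g y)) = 0 := hy'.2.self_of_nhds
    have hdef := (hbox (hinbox y hy _ hs)).2.2 h0
    have hpos' := (hbox (hinbox y hy _ hs)).1
    have hΓ : graphMap e g y = c (y, g y) := rfl
    rw [hΓ, outerNormal_eq_of_isLocalDefiningFunction hdef]
    set G := gradient ρ (c (y, g y)) with hG
    set k := inner ℝ G n with hk
    set m : E3 := e (WithLp.toLp 2 (-gradient g y, 1)) with hm
    -- Differentiating ρ = 0 along the graph: ∇ρ is orthogonal to the tangent vectors, hence a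
    -- positive multiple of (-∇g, 1).
    have hortho : ∀ v : E2, inner ℝ G (c (v, fderiv ℝ g y v)) = 0 := by
      intro v
      have h1 : HasFDerivAt (fun y => f (y, g y))
          ((fderiv ℝ f (y, g y)).comp ((ContinuousLinearMap.id ℝ E2).prod (fderiv ℝ g y))) y :=
        HasFDerivAt.comp (g := f) y ((hfsm.differentiable (by simp)) (y, g y)).hasFDerivAt
          ((hasFDerivAt_id y).prodMk ((hg.differentiable (by simp)) y).hasFDerivAt)
      have h2 : HasFDerivAt (fun y => f (y, g y)) (0 : E2 →L[ℝ] ℝ) y :=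
        (hasFDerivAt_const (0 : ℝ) y).congr_of_eventuallyEq hy'.2
      have h3 : fderiv ℝ f (y, g y) (v, fderiv ℝ g y v) = 0 :=
        DFunLike.congr_fun (h1.unique h2) v
      rwa [hfder] at h3
    have hGm : G = k • m := by
      refine ext_inner_right ℝ fun z => ?_
      obtain ⟨⟨v, s⟩, rfl⟩ := c.surjective z
      have hsplit : c (v, s) = c (v, fderiv ℝ g y v) + (s - fderiv ℝ g y v) • n := by
        rw [hn, ← map_smul, ← map_add]
        simp
      have hmz : inner ℝ m (c (v, s)) = s - fderiv ℝ g y v := by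
        rw [hm, hcapp, e.inner_map_map, WithLp.prod_inner_apply]
        simp only [inner_neg_left]
        rw [gradient, InnerProductSpace.toDual_symm_apply]
        simp
        ring
      rw [inner_smul_left, hmz, hsplit, inner_add_right, hortho, inner_smul_right, ← hk]
      simp
      ring
    have hmn : ‖m‖ = √(1 + ‖gradient g y‖ ^ 2) := by
      rw [hm, e.norm_map, WithLp.prod_norm_eq_of_L2]
      simp [add_comm]
    rw [hGm, norm_smul, Real.norm_eq_abs, abs_of_pos hpos', smul_smul, ← hmn, mul_inv]
    congr 1
    field_simp

end Chart

/-! ### Finite smooth partitions of unity. -/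

section PartitionOfUnity

open Set

/-- A finite smooth partition of unity on a compact set. -/
theorem exists_finite_smoothPartition {K : Set E3} (hK : IsCompact K) (N : E3 → Set E3)
    (hN : ∀ x ∈ K, N x ∈ 𝓝 x) :
    ∃ (ι : Type) (_ : Fintype ι) (c : ι → E3) (χ : ι → E3 → ℝ), (∀ i, c i ∈ K) ∧
      (∀ i, ContDiff ℝ ∞ (χ i)) ∧ (∀ i, HasCompactSupport (χ i)) ∧
      (∀ i, tsupport (χ i) ⊆ N (c i)) ∧ (∀ i x, 0 ≤ χ i x) ∧ ∀ x ∈ K, ∑ i, χ i x = 1 := by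
  -- Intersecting with unit balls makes the supports compact.
  let O : E3 → Set E3 := fun x => interior (N x) ∩ Metric.ball x 1
  have hO : ∀ x ∈ K, O x ∈ 𝓝 x := fun x hx =>
    inter_mem (interior_mem_nhds.2 (hN x hx)) (Metric.ball_mem_nhds x one_pos)
  obtain ⟨t, htK, hcov⟩ := hK.elim_nhds_subcover O hO
  have hcov' : K ⊆ ⋃ i : t, O i := by
    intro x hx
    obtain ⟨i, hi, hxi⟩ := mem_iUnion₂.1 (hcov hx)
    exact mem_iUnion.2 ⟨⟨i, hi⟩, hxi⟩
  obtain ⟨f, hf⟩ := SmoothPartitionOfUnity.exists_isSubordinate (modelWithCornersSelf ℝ E3)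
    hK.isClosed (fun i : t => O i) (fun i => isOpen_interior.inter Metric.isOpen_ball) hcov'
  refine ⟨t, inferInstance, fun i => i, fun i => f i, fun i => htK i i.2,
    fun i => (f i).contMDiff.contDiff, fun i => ?_, fun i => ?_, fun i x => f.nonneg i x,
    fun x hx => ?_⟩
  · refine HasCompactSupport.of_support_subset_isCompact (isCompact_closedBall (i : E3) 1) ?_
    exact ((subset_tsupport _).trans (hf i)).trans
      (inter_subset_right.trans Metric.ball_subset_closedBall)
  · exact (hf i).trans (inter_subset_left.trans interior_subset)
  · rw [← f.sum_eq_one hx, finsum_eq_sum_of_fintype]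

end PartitionOfUnity

/-! ### The divergence theorem, and finiteness of the surface measure. -/

section Divergence

open Set

theorem setIntegral_congr_set_of_support {α : Type*} [MeasurableSpace α] {μ : Measure α}
    {A B W : Set α} (hA : MeasurableSet A) (hB : MeasurableSet B) {F : α → ℝ}
    (hF : ∀ x, x ∉ W → F x = 0) (h : ∀ x ∈ W, x ∈ A ↔ x ∈ B) :
    ∫ x in A, F x ∂μ = ∫ x in B, F x ∂μ := by
  rw [← integral_indicator hA, ← integral_indicator hB]
  congr 1
  ext x
  by_cases hx : x ∈ W
  · by_cases hxA : x ∈ A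
    · rw [indicator_of_mem hxA, indicator_of_mem ((h x hx).1 hxA)]
    · rw [indicator_of_notMem hxA, indicator_of_notMem (fun hb => hxA ((h x hx).2 hb))]
  · simp only [indicator, hF x hx, ite_self]

/-- The divergence theorem for the subgraph of a `C¹` function. -/
theorem setIntegral_fderiv_subgraph {g : E2 → ℝ} (hg : ContDiff ℝ 1 g) {f : E2 × ℝ → ℝ}
    (hf : ContDiff ℝ 1 f) (hsupp : HasCompactSupport f) (a : E2) (b : ℝ) :
    ∫ p in {p : E2 × ℝ | p.2 ≤ g p.1}, fderiv ℝ f p (a, b) =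
      ∫ y, (b - fderiv ℝ g y a) * f (y, g y) := by
  have hgc := hg.continuous
  -- This measure preserving shear flattens the subgraph to a half space. There horizontal
  -- derivatives integrate to zero over each slice, and the vertical derivative is integrated by the
  -- fundamental theorem of calculus.
  let T : E2 × ℝ ≃ₜ E2 × ℝ :=
    { toFun := fun p => (p.1, p.2 + g p.1)
      invFun := fun p => (p.1, p.2 - g p.1)
      left_inv := fun p => by simp
      right_inv := fun p => by simp
      continuous_toFun := by fun_prop
      continuous_invFun := by fun_prop }
  have hTapp : ∀ p, T p = (p.1, p.2 + g p.1) := fun _ => rfl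
  have hTmp : MeasurePreserving T (volume : Measure (E2 × ℝ)) volume := by
    refine MeasurePreserving.skew_product (f := id) (g := fun y s => s + g y)
      (MeasurePreserving.id _) ?_ ?_
    · exact (measurable_snd.add (hgc.measurable.comp measurable_fst))
    · exact Eventually.of_forall fun y => map_add_right_eq_self volume (g y)
  set k : E2 × ℝ → ℝ := fun p => f (T p) with hk
  have hTd : ContDiff ℝ 1 T := by
    change ContDiff ℝ 1 fun p : E2 × ℝ => (p.1, p.2 + g p.1)
    fun_prop
  have hkd : ContDiff ℝ 1 k := hf.comp hTd
  have hks : HasCompactSupport k := hsupp.comp_homeomorph T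
  have hkder : ∀ p, fderiv ℝ f (T p) (a, b) =
      fderiv ℝ k p (a, 0) + (b - fderiv ℝ g p.1 a) * fderiv ℝ k p (0, 1) := by
    intro p
    have h1 : HasFDerivAt k ((fderiv ℝ f (T p)).comp ((ContinuousLinearMap.fst ℝ E2 ℝ).prod
        (ContinuousLinearMap.snd ℝ E2 ℝ + (fderiv ℝ g p.1).comp (ContinuousLinearMap.fst ℝ E2 ℝ))))
        p := by
      refine HasFDerivAt.comp (g := f) p ((hf.differentiable (by simp)) (T p)).hasFDerivAt ?_
      refine hasFDerivAt_fst.prodMk (hasFDerivAt_snd.add ?_)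
      exact HasFDerivAt.comp (g := g) p ((hg.differentiable (by simp)) p.1).hasFDerivAt
        hasFDerivAt_fst
    rw [h1.fderiv, ← smul_eq_mul, ← map_smul, ← map_add]
    simp
  have hfd : Continuous (fderiv ℝ k) := hkd.continuous_fderiv (by simp)
  have hgd : Continuous (fderiv ℝ g) := hg.continuous_fderiv (by simp)
  have hint1 : Integrable (fun p => fderiv ℝ k p (a, 0)) (volume : Measure (E2 × ℝ)) :=
    (hfd.clm_apply continuous_const).integrable_of_hasCompactSupport (hks.fderiv_apply ℝ _)
  have hint2 : Integrable (fun p => (b - fderiv ℝ g p.1 a) * fderiv ℝ k p (0, 1))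
      (volume : Measure (E2 × ℝ)) := by
    refine Continuous.integrable_of_hasCompactSupport ?_ ((hks.fderiv_apply ℝ _).mul_left)
    exact (continuous_const.sub ((hgd.comp continuous_fst).clm_apply continuous_const)).mul
      (hfd.clm_apply continuous_const)
  have hpre : T ⁻¹' {p : E2 × ℝ | p.2 ≤ g p.1} = univ ×ˢ Iic 0 := by
    ext p; simp [hTapp]
  rw [← hTmp.setIntegral_preimage_emb T.measurableEmbedding, hpre]
  simp_rw [hkder]
  have hvol : (volume : Measure (E2 × ℝ)).restrict (univ ×ˢ Iic 0) =
      (volume : Measure E2).prod ((volume : Measure ℝ).restrict (Iic 0)) := by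
    rw [Measure.volume_eq_prod, ← Measure.prod_restrict, Measure.restrict_univ]
  rw [integral_add hint1.integrableOn hint2.integrableOn]
  have hi1 := hint1.integrableOn (s := univ ×ˢ Iic (0 : ℝ))
  have hi2 := hint2.integrableOn (s := univ ×ˢ Iic (0 : ℝ))
  rw [IntegrableOn, hvol] at hi1 hi2
  rw [hvol, integral_prod_symm _ hi1, integral_prod _ hi2]
  have hslice1 : ∀ s : ℝ, ∫ y, fderiv ℝ k (y, s) (a, 0) = 0 := by
    intro s
    have hemb : IsClosedEmbedding fun y : E2 => (y, s) := 
      (Isometry.of_dist_eq fun _ _ => by simp [Prod.dist_eq]).isClosedEmbedding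
    have hd : ContDiff ℝ 1 fun y : E2 => k (y, s) := hkd.comp (contDiff_id.prodMk contDiff_const)
    have hs : HasCompactSupport fun y : E2 => k (y, s) := hks.comp_isClosedEmbedding hemb
    have hder : ∀ y, fderiv ℝ (fun y : E2 => k (y, s)) y a = fderiv ℝ k (y, s) (a, 0) := by
      intro y
      have h2 : HasFDerivAt (fun y : E2 => k (y, s))
          ((fderiv ℝ k (y, s)).comp ((ContinuousLinearMap.id ℝ E2).prod 0)) y :=
        HasFDerivAt.comp (g := k) y ((hkd.differentiable (by simp)) (y, s)).hasFDerivAt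
          ((hasFDerivAt_id y).prodMk (hasFDerivAt_const s y))
      rw [h2.fderiv]
      simp
    simp_rw [← hder]
    have := integral_mul_fderiv_eq_neg_fderiv_mul_of_integrable (μ := (volume : Measure E2))
      (f := fun _ => (1 : ℝ)) (g := fun y : E2 => k (y, s)) (v := a) (by simp)
      (by simpa using ((hd.continuous_fderiv (by simp)).clm_apply
          continuous_const).integrable_of_hasCompactSupport (hs.fderiv_apply ℝ a))
      (by simpa using hd.continuous.integrable_of_hasCompactSupport hs)
      (fun _ _ => differentiableAt_const _) (fun y _ => hd.differentiable (by simp) y)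
    simpa using this
  have hslice2 : ∀ y : E2, ∫ s in Iic (0 : ℝ), (b - fderiv ℝ g y a) * fderiv ℝ k (y, s) (0, 1) =
      (b - fderiv ℝ g y a) * f (y, g y) := by
    intro y
    rw [integral_const_mul]
    congr 1
    have hemb : IsClosedEmbedding fun s : ℝ => (y, s) := 
      (Isometry.of_dist_eq fun _ _ => by simp [Prod.dist_eq]).isClosedEmbedding
    have hd : ContDiff ℝ 1 fun s : ℝ => k (y, s) := hkd.comp (contDiff_const.prodMk contDiff_id)
    have hs : HasCompactSupport fun s : ℝ => k (y, s) := hks.comp_isClosedEmbedding hemb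
    have hder : ∀ s, deriv (fun s : ℝ => k (y, s)) s = fderiv ℝ k (y, s) (0, 1) := by
      intro s
      have h1 : HasDerivAt (fun s : ℝ => (y, s)) ((0 : E2), (1 : ℝ)) s :=
        (hasDerivAt_const s y).prodMk (hasDerivAt_id s)
      exact (((hkd.differentiable (by simp)) (y, s)).hasFDerivAt.comp_hasDerivAt s h1).deriv
    simp_rw [← hder]
    rw [hs.integral_Iic_deriv_eq hd]
    simp [hk, hTapp]
  simp_rw [hslice1, hslice2]
  simp

/-- The divergence theorem for functions supported in a graph chart. -/
theorem IsGraphChart.setIntegral_fderiv {Ω W : Set E3} {e : WithLp 2 (E2 × ℝ) ≃ₗᵢ[ℝ] E3} {g : E2 → ℝ}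
    (hc : IsGraphChart Ω W e g) (hΩ : IsOpen Ω) {F : E3 → ℝ} (hF : ContDiff ℝ 1 F)
    (hsupp : HasCompactSupport F) (hFW : tsupport F ⊆ W) (v : E3) :
    ∫ x in Ω, fderiv ℝ F x v = ∫ x, F x * inner ℝ (outerNormal Ω x) v ∂(surfaceMeasure Ω) := by
  let c : (E2 × ℝ) ≃L[ℝ] E3 :=
    (WithLp.prodContinuousLinearEquiv 2 ℝ E2 ℝ).symm.trans e.toContinuousLinearEquiv
  have hcapp : ∀ y s, c (y, s) = e (WithLp.toLp 2 (y, s)) := fun _ _ => rfl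
  have hcmp : MeasurePreserving c (volume : Measure (E2 × ℝ)) volume :=
    e.measurePreserving.comp (WithLp.volume_preserving_toLp E2 ℝ)
  have hFout : ∀ x, x ∉ W → F x = 0 := fun x hx => by
    by_contra h
    exact hx (hFW (subset_tsupport _ h))
  have hFdout : ∀ x, x ∉ W → fderiv ℝ F x v = 0 := fun x hx => by
    have : fderiv ℝ F x = 0 := by
      by_contra h
      exact hx (hFW (support_fderiv_subset ℝ h))
    simp [this]
  have hgc := hc.contDiff.continuous
  obtain ⟨⟨a, b⟩, rfl⟩ := c.surjective v
  have hmeasS : MeasurableSet {p : E2 × ℝ | p.2 < g p.1} :=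
    (isOpen_lt continuous_snd (hgc.comp continuous_fst)).measurableSet
  -- the volume integral
  have hL : ∫ x in Ω, fderiv ℝ F x (c (a, b)) =
      ∫ y, (b - fderiv ℝ g y a) * F (c (y, g y)) := by
    have hd : ContDiff ℝ 1 fun p => F (c p) := hF.comp c.contDiff
    have hs : HasCompactSupport fun p => F (c p) := hsupp.comp_homeomorph c.toHomeomorph
    rw [← setIntegral_fderiv_subgraph hc.contDiff hd hs a b]
    have hder : ∀ p, fderiv ℝ (fun p => F (c p)) p (a, b) = fderiv ℝ F (c p) (c (a, b)) := by
      intro p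
      have h1 : HasFDerivAt (fun p => F (c p)) ((fderiv ℝ F (c p)).comp (c : E2 × ℝ →L[ℝ] E3)) p :=
        ((hF.differentiable (by simp)) (c p)).hasFDerivAt.comp p c.hasFDerivAt
      rw [h1.fderiv]
      rfl
    -- The graph is a null set, so the closed and the open subgraph give the same volume integral.
    have hnull : ({p : E2 × ℝ | p.2 ≤ g p.1} : Set (E2 × ℝ)) =ᵐ[volume]
        {p : E2 × ℝ | p.2 < g p.1} := by
      have hgr : (volume : Measure (E2 × ℝ)) {p : E2 × ℝ | p.2 = g p.1} = 0 := by
        have hm : MeasurableSet {p : E2 × ℝ | p.2 = g p.1} :=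
          (isClosed_eq continuous_snd (hgc.comp continuous_fst)).measurableSet
        rw [Measure.volume_eq_prod, Measure.prod_apply hm]
        simp [preimage]
      filter_upwards [compl_mem_ae_iff.2 hgr] with p hp
      have hp' : p.2 ≠ g p.1 := hp
      exact propext ⟨fun h => lt_of_le_of_ne h hp', fun h => le_of_lt h⟩
    rw [setIntegral_congr_set hnull, ← hcmp.setIntegral_preimage_emb
      c.toHomeomorph.measurableEmbedding]
    simp_rw [hder]
    refine setIntegral_congr_set_of_support (W := c ⁻¹' W)
      (hΩ.measurableSet.preimage c.continuous.measurable) hmeasS (fun p hp => hFdout _ hp) ?_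
    rintro ⟨y, s⟩ hp
    exact hc.mem_iff y s hp
  have hfr : MeasurableSet (frontier Ω) := isClosed_frontier.measurableSet
  have hemb := measurableEmbedding_graphMap e hgc
  rw [hL, surfaceMeasure, setIntegral_congr_set_of_support (W := W) hfr hemb.measurableSet_range
    (fun x hx => by simp [hFout x hx]) (fun x hx => hc.mem_frontier_iff hx),
    setIntegral_range_graphMap (by simp) e hc.contDiff]
  -- The area element √(1 + |∇g|²) cancels the normalization of the outer normal, leaving the
  -- integrand of the flat computation.
  refine integral_congr_ae (Eventually.of_forall fun y => ?_)
  change _ = √(1 + ‖gradient g y‖ ^ 2) * (F (c (y, g y)) *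
    inner ℝ (outerNormal Ω (graphMap e g y)) (c (a, b)))
  by_cases hy : graphMap e g y ∈ W
  · rw [hc.outerNormal_eq y hy, inner_smul_left, hcapp a b, e.inner_map_map,
      WithLp.prod_inner_apply]
    simp only [inner_neg_left]
    rw [gradient, InnerProductSpace.toDual_symm_apply]
    have hpos : 0 < √(1 + ‖(InnerProductSpace.toDual ℝ E2).symm (fderiv ℝ g y)‖ ^ 2) := by positivity
    simp
    field_simp
    ring
  · have : F (c (y, g y)) = 0 := hFout _ hy
    simp [this]

/-- Near x a frontier point of the open set Ω is a limit of points with ρ < 0 without being one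
itself, which forces ρ = 0 there. One ρ therefore computes the normal on a whole boundary patch. -/
theorem IsLocalDefiningFunction.eventually_mem_frontier {Ω : Set E3} (hΩ : IsOpen Ω) {x : E3}
    {ρ : E3 → ℝ} (h : IsLocalDefiningFunction Ω x ρ) :
    ∀ᶠ y in 𝓝 x, y ∈ frontier Ω → IsLocalDefiningFunction Ω y ρ := by
  filter_upwards [h.eventually_of_frontier, h.2.2.2.eventually_nhds] with y h1 h2 h3
  refine h1 (le_antisymm ?_ ?_)
  · rw [hΩ.frontier_eq] at h3
    have : ∃ᶠ z in 𝓝 y, ρ z ≤ 0 :=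
      ((mem_closure_iff_frequently.1 h3.1).and_eventually h2).mono fun z hz => (hz.2.1 hz.1).le
    exact le_of_tendsto_of_frequently (h.1.continuous.tendsto y) this
  · rw [hΩ.frontier_eq] at h3
    exact not_lt.1 fun hlt => h3.2 (h2.self_of_nhds.2 hlt)

theorem continuousOn_outerNormal {Ω : Set E3} (hΩ : IsOpen Ω) (hs : HasSmoothBoundary Ω) :
    ContinuousOn (outerNormal Ω) (frontier Ω) := by
  intro x hx
  obtain ⟨ρ, hρ⟩ := hs x hx
  have hcont : Continuous (gradient ρ) :=
    (InnerProductSpace.toDual ℝ E3).symm.continuous.comp (hρ.1.continuous_fderiv (by simp))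
  have h1 : ContinuousAt (fun y => ‖gradient ρ y‖⁻¹ • gradient ρ y) x :=
    (hcont.norm.continuousAt.inv₀ (norm_ne_zero_iff.2 hρ.2.2.1)).smul hcont.continuousAt
  refine h1.continuousWithinAt.congr_of_eventuallyEq ?_
    (outerNormal_eq_of_isLocalDefiningFunction hρ)
  filter_upwards [mem_nhdsWithin_of_mem_nhds (hρ.eventually_mem_frontier hΩ),
    self_mem_nhdsWithin] with y h2 h3
  exact outerNormal_eq_of_isLocalDefiningFunction (h2 h3)

theorem norm_outerNormal {Ω : Set E3} (hs : HasSmoothBoundary Ω) {x : E3} (hx : x ∈ frontier Ω) :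
    ‖outerNormal Ω x‖ = 1 := by
  obtain ⟨ρ, hρ⟩ := hs x hx
  rw [outerNormal_eq_of_isLocalDefiningFunction hρ, norm_smul, norm_inv, norm_norm,
    inv_mul_cancel₀ (norm_ne_zero_iff.2 hρ.2.2.1)]

theorem isCompact_frontier_of_isBounded {Ω : Set E3} (hb : Bornology.IsBounded Ω) :
    IsCompact (frontier Ω) :=
  hb.isCompact_closure.of_isClosed_subset isClosed_frontier frontier_subset_closure

/-- The boundary is compact, and within a small ball each chart exhibits it as part of a graph over
a compact set, which has finite area. -/
theorem isFiniteMeasure_surfaceMeasure {Ω : Set E3} (hb : Bornology.IsBounded Ω)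
    (hs : HasSmoothBoundary Ω) : IsFiniteMeasure (surfaceMeasure Ω) := by
  refine ⟨?_⟩
  rw [surfaceMeasure, Measure.restrict_apply_univ]
  refine (isCompact_frontier_of_isBounded hb).measure_lt_top_of_nhdsWithin fun x hx => ?_
  obtain ⟨ρ, hρ⟩ := hs x hx
  obtain ⟨W, e, g, hxW, hc⟩ := exists_isGraphChart hρ
  obtain ⟨r, hr, hball⟩ := Metric.nhds_basis_closedBall.mem_iff.1 (hc.isOpen.mem_nhds hxW)
  refine ⟨frontier Ω ∩ Metric.closedBall x r,
    inter_mem_nhdsWithin _ (Metric.closedBall_mem_nhds x hr), ?_⟩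
  have hcont : Continuous fun x : E3 => (e.symm x).ofLp.1 :=
    continuous_fst.comp
      ((WithLp.prodContinuousLinearEquiv 2 ℝ E2 ℝ).continuous.comp e.symm.continuous)
  refine (measure_mono ?_).trans_lt (euclideanHausdorffMeasure_image_graphMap_lt_top (by simp) e
    hc.contDiff ((isCompact_closedBall x r).image hcont))
  rintro z ⟨hz1, hz2⟩
  obtain ⟨y, rfl⟩ := (hc.mem_frontier_iff (hball hz2)).1 hz1
  exact ⟨y, ⟨_, hz2, by simp [graphMap]⟩, rfl⟩

theorem aestronglyMeasurable_surfaceMeasure_of_continuousOn {Ω : Set E3} {F : Type*}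
    [NormedAddCommGroup F] {f : E3 → F} (hf : ContinuousOn f (frontier Ω)) :
    AEStronglyMeasurable f (surfaceMeasure Ω) :=
  hf.aestronglyMeasurable isClosed_frontier.measurableSet

theorem integrable_surfaceMeasure_of_continuousOn {Ω : Set E3} (hb : Bornology.IsBounded Ω)
    (hs : HasSmoothBoundary Ω) {F : Type*} [NormedAddCommGroup F] {f : E3 → F}
    (hf : ContinuousOn f (frontier Ω)) :
    Integrable f (surfaceMeasure Ω) := by
  have := isFiniteMeasure_surfaceMeasure hb hs
  obtain ⟨C, hC⟩ := (isCompact_frontier_of_isBounded hb).exists_bound_of_continuousOn hf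
  refine Integrable.of_bound (aestronglyMeasurable_surfaceMeasure_of_continuousOn hf) C ?_
  exact (ae_restrict_mem isClosed_frontier.measurableSet).mono hC

/-- The divergence theorem for open sets with smooth boundary. -/
theorem setIntegral_fderiv_eq_integral_surfaceMeasure {Ω : Set E3} (hΩ : IsOpen Ω)
    (hb : Bornology.IsBounded Ω) (hs : HasSmoothBoundary Ω) {F : E3 → ℝ} (hF : ContDiff ℝ 1 F)
    (v : E3) :
    ∫ x in Ω, fderiv ℝ F x v = ∫ x, F x * inner ℝ (outerNormal Ω x) v ∂(surfaceMeasure Ω) := by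
  have hchart : ∀ x ∈ frontier Ω, ∃ W : Set E3, x ∈ W ∧ ∃ e g, IsGraphChart Ω W e g := by
    intro x hx
    obtain ⟨ρ, hρ⟩ := hs x hx
    obtain ⟨W, e, g, hxW, hc⟩ := exists_isGraphChart hρ
    exact ⟨W, hxW, e, g, hc⟩
  choose! W hxW e g hW using hchart
  classical
  -- The partition is subordinate to Ω itself at interior points and to chart domains at boundary
  -- points. Pieces supported in Ω contribute zero to both sides.
  let N : E3 → Set E3 := fun x => if x ∈ Ω then Ω else W x
  have hfr : ∀ x ∈ closure Ω, x ∉ Ω → x ∈ frontier Ω := fun x hx hx' => by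
    rw [hΩ.frontier_eq]; exact ⟨hx, hx'⟩
  have hN : ∀ x ∈ closure Ω, N x ∈ 𝓝 x := by
    intro x hx
    by_cases hxΩ : x ∈ Ω
    · simpa [N, hxΩ] using hΩ.mem_nhds hxΩ
    · simpa [N, hxΩ] using (hW x (hfr x hx hxΩ)).isOpen.mem_nhds (hxW x (hfr x hx hxΩ))
  obtain ⟨ι, _, c, χ, hcK, hχ, hχs, hχN, -, hsum⟩ :=
    exists_finite_smoothPartition hb.isCompact_closure N hN
  have hd : ∀ i, ContDiff ℝ 1 fun x => χ i x * F x := fun i => ((hχ i).of_le (by simp)).mul hF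
  have hsu : ∀ i, HasCompactSupport fun x => χ i x * F x := fun i => (hχs i).mul_right
  have hts : ∀ i, tsupport (fun x => χ i x * F x) ⊆ tsupport (χ i) := fun i =>
    closure_mono (by intro x hx; exact left_ne_zero_of_mul hx)
  have hpiece : ∀ i, ∫ x in Ω, fderiv ℝ (fun x => χ i x * F x) x v =
      ∫ x, (χ i x * F x) * inner ℝ (outerNormal Ω x) v ∂(surfaceMeasure Ω) := by
    intro i
    by_cases hi : c i ∈ Ω
    · have hsub : tsupport (fun x => χ i x * F x) ⊆ Ω := by
        have := hχN i
        simp only [N, hi, if_true] at this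
        exact (hts i).trans this
      have h1 : ∫ x in Ω, fderiv ℝ (fun x => χ i x * F x) x v = 0 := by
        rw [setIntegral_eq_integral_of_forall_compl_eq_zero]
        · have := integral_mul_fderiv_eq_neg_fderiv_mul_of_integrable (μ := (volume : Measure E3))
            (f := fun _ => (1 : ℝ)) (g := fun x => χ i x * F x) (v := v) (by simp)
            (by simpa using (((hd i).continuous_fderiv (by simp)).clm_apply
              continuous_const).integrable_of_hasCompactSupport ((hsu i).fderiv_apply ℝ v))
            (by simpa using (hd i).continuous.integrable_of_hasCompactSupport (hsu i))
            (fun _ _ => differentiableAt_const _) (fun y _ => (hd i).differentiable (by simp) y)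
          simpa using this
        · intro x hx
          have : fderiv ℝ (fun x => χ i x * F x) x = 0 := by
            by_contra h
            exact hx (hsub (support_fderiv_subset ℝ h))
          simp [this]
      rw [h1, surfaceMeasure, eq_comm]
      refine setIntegral_eq_zero_of_forall_eq_zero fun x hx => ?_
      have : χ i x * F x = 0 := by
        by_contra h
        rw [hΩ.frontier_eq] at hx
        exact hx.2 (hsub (subset_tsupport (fun x => χ i x * F x) h))
      simp [this]
    · have hsub : tsupport (fun x => χ i x * F x) ⊆ W (c i) := by
        have := hχN i
        simp only [N, hi, if_false] at this
        exact (hts i).trans this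
      exact (hW _ (hfr _ (hcK i) hi)).setIntegral_fderiv hΩ (hd i) (hsu i) hsub v
  have hfd : ∀ x ∈ Ω, fderiv ℝ F x v = ∑ i, fderiv ℝ (fun x => χ i x * F x) x v := by
    intro x hx
    have heq : F =ᶠ[𝓝 x] fun x => ∑ i, χ i x * F x := by
      filter_upwards [hΩ.mem_nhds hx] with y hy
      rw [← Finset.sum_mul, hsum y (subset_closure hy), one_mul]
    rw [heq.fderiv_eq, fderiv_fun_sum fun i _ => (hd i).differentiable (by simp) x,
      sum_apply]
  rw [setIntegral_congr_fun hΩ.measurableSet hfd, integral_finsetSum]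
  · simp_rw [hpiece]
    rw [← integral_finsetSum]
    · refine integral_congr_ae ?_
      filter_upwards [ae_restrict_mem isClosed_frontier.measurableSet] with x hx
      rw [← Finset.sum_mul, ← Finset.sum_mul, hsum x (frontier_subset_closure hx), one_mul]
    · intro i _
      exact integrable_surfaceMeasure_of_continuousOn hb hs
        ((hd i).continuous.continuousOn.mul
          ((continuousOn_outerNormal hΩ hs).inner continuousOn_const))
  · intro i _
    exact ((((hd i).continuous_fderiv (by simp)).clm_apply
      continuous_const).integrable_of_hasCompactSupport ((hsu i).fderiv_apply ℝ v)).integrableOn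

end Divergence

/-! ### The trace inequality in L². -/

section TraceInequality

open Set

/-- Constant fields 2ν(x_i) are glued by a partition of unity. The factor 2 leaves room for the
variation of ν within each patch. -/
theorem exists_field_one_le_inner_outerNormal {Ω : Set E3} (hΩ : IsOpen Ω)
    (hb : Bornology.IsBounded Ω) (hs : HasSmoothBoundary Ω) :
    ∃ X : E3 → E3, ContDiff ℝ ∞ X ∧ HasCompactSupport X ∧
      ∀ x ∈ frontier Ω, 1 ≤ inner ℝ (outerNormal Ω x) (X x) := by
  let N : E3 → Set E3 := fun x₀ =>
    {x | x ∈ frontier Ω → 1 ≤ inner ℝ (outerNormal Ω x) ((2 : ℝ) • outerNormal Ω x₀)}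
  have hN : ∀ x ∈ frontier Ω, N x ∈ 𝓝 x := by
    intro x hx
    have h1 := ((continuousOn_outerNormal hΩ hs) x hx).inner (𝕜 := ℝ)
      (continuousWithinAt_const (b := (2 : ℝ) • outerNormal Ω x))
    have h2 : 1 < inner ℝ (outerNormal Ω x) ((2 : ℝ) • outerNormal Ω x) := by
      rw [inner_smul_right, real_inner_self_eq_norm_sq, norm_outerNormal hs hx]
      norm_num
    have h3 := h1.eventually (lt_mem_nhds h2)
    rw [eventually_nhdsWithin_iff] at h3
    filter_upwards [h3] with y hy hyf using (hy hyf).le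
  obtain ⟨ι, _, c, χ, -, hχ, hχs, hχN, hχ0, hsum⟩ :=
    exists_finite_smoothPartition (isCompact_frontier_of_isBounded hb) N hN
  refine ⟨fun x => ∑ i, χ i x • ((2 : ℝ) • outerNormal Ω (c i)), ?_, ?_, ?_⟩
  · exact ContDiff.sum fun i _ => (hχ i).smul contDiff_const
  · have : (fun x => ∑ i, χ i x • ((2 : ℝ) • outerNormal Ω (c i))) =
        ∑ i, fun x => χ i x • ((2 : ℝ) • outerNormal Ω (c i)) := by
      ext x; simp
    rw [this]
    exact HasCompactSupport.finset_sum fun i _ => (hχs i).smul_right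
  · intro x hx
    rw [inner_sum, ← hsum x hx]
    refine Finset.sum_le_sum fun i _ => ?_
    rw [inner_smul_right]
    by_cases h0 : χ i x = 0
    · simp [h0]
    · have := hχN i (subset_tsupport _ h0) hx
      nlinarith [hχ0 i x]

theorem inner_eq_sum_E3 (x y : E3) : inner ℝ x y = ∑ j, x j * y j := by
  simp [PiLp.inner_apply, mul_comm]

theorem norm_sq_eq_sum_E3 (x : E3) : ‖x‖ ^ 2 = ∑ j, x j ^ 2 := by
  rw [EuclideanSpace.norm_sq_eq]; simp

/-- The divergence theorem, for partial derivatives. -/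
theorem setIntegral_pderiv3 {Ω : Set E3} (hΩ : IsOpen Ω) (hb : Bornology.IsBounded Ω)
    (hs : HasSmoothBoundary Ω) {F : E3 → ℝ} (hF : ContDiff ℝ 1 F) (j : Fin 3) :
    ∫ x in Ω, pderiv3 j F x = ∫ x, F x * outerNormal Ω x j ∂(surfaceMeasure Ω) := by
  unfold pderiv3
  rw [setIntegral_fderiv_eq_integral_surfaceMeasure hΩ hb hs hF]
  simp [EuclideanSpace.inner_single_right]

theorem continuous_pderiv3 {F : Type*} [NormedAddCommGroup F] [NormedSpace ℝ F] {f : E3 → F}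
    (hf : ContDiff ℝ 1 f) (j : Fin 3) : Continuous (pderiv3 j f) :=
  (hf.continuous_fderiv (by simp)).clm_apply continuous_const

theorem contDiff_pderiv3 {F : Type*} [NormedAddCommGroup F] [NormedSpace ℝ F] {f : E3 → F}
    (hf : ContDiff ℝ ∞ f) (j : Fin 3) : ContDiff ℝ ∞ (pderiv3 j f) :=
  (hf.fderiv_right (m := ∞) (by simp)).clm_apply contDiff_const

theorem integrableOn_of_continuous_of_isBounded {Ω : Set E3} (hb : Bornology.IsBounded Ω)
    {F : Type*} [NormedAddCommGroup F] {f : E3 → F} (hf : Continuous f) :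
    IntegrableOn f Ω volume :=
  (hf.continuousOn.integrableOn_compact hb.isCompact_closure).mono_set subset_closure

/-- The divergence theorem for |u|²X, with X transversal to the boundary, dominates the boundary
integral by the volume integral of |u|² div X + 2X·⟨u, ∇u⟩. -/
theorem integral_norm_sq_surfaceMeasure_le {Ω : Set E3} (hΩ : IsOpen Ω)
    (hb : Bornology.IsBounded Ω) (hs : HasSmoothBoundary Ω) :
    ∃ C : ℝ, 0 ≤ C ∧ ∀ u : E3 → ℂ, ContDiff ℝ 1 u →
      ∫ x, ‖u x‖ ^ 2 ∂(surfaceMeasure Ω) ≤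
        C * (∫ x in Ω, ‖u x‖ ^ 2 + ∑ j, ‖pderiv3 j u x‖ ^ 2) := by
  obtain ⟨X, hX, hXs, hXν⟩ := exists_field_one_le_inner_outerNormal hΩ hb hs
  have hXj : ∀ j, ContDiff ℝ ∞ fun x => X x j := fun j =>
    (EuclideanSpace.proj (𝕜 := ℝ) j).contDiff.comp hX
  have hbd : ∀ j, ∃ M : ℝ, 0 ≤ M ∧ ∀ x ∈ closure Ω, |X x j| ≤ M ∧
      |pderiv3 j (fun x => X x j) x| ≤ M := by
    intro j
    obtain ⟨M1, h1⟩ := hb.isCompact_closure.exists_bound_of_continuousOn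
      (hXj j).continuous.continuousOn
    obtain ⟨M2, h2⟩ := hb.isCompact_closure.exists_bound_of_continuousOn
      (continuous_pderiv3 ((hXj j).of_le (by simp)) j).continuousOn
    exact ⟨max 0 (max M1 M2), le_max_left _ _, fun x hx =>
      ⟨(h1 x hx).trans ((le_max_left _ _).trans (le_max_right _ _)),
        (h2 x hx).trans ((le_max_right _ _).trans (le_max_right _ _))⟩⟩
  choose M hM0 hM using hbd
  refine ⟨2 * ∑ j, M j, by have := Finset.sum_nonneg fun j (_ : j ∈ Finset.univ) => hM0 j; linarith,
    fun u hu => ?_⟩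
  have hnsq : ContDiff ℝ 1 fun x => ‖u x‖ ^ 2 := hu.norm_sq ℝ
  have hnd : ∀ j x, pderiv3 j (fun x => ‖u x‖ ^ 2) x = 2 * inner ℝ (u x) (pderiv3 j u x) := by
    intro j x
    have := ((hu.differentiable (by simp)) x).hasFDerivAt.norm_sq
    unfold pderiv3
    rw [this.fderiv]
    simp
    ring
  have hF : ∀ j, ContDiff ℝ 1 fun x => ‖u x‖ ^ 2 * X x j := fun j =>
    hnsq.mul ((hXj j).of_le (by simp))
  have hFd : ∀ j x, pderiv3 j (fun x => ‖u x‖ ^ 2 * X x j) x =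
      ‖u x‖ ^ 2 * pderiv3 j (fun x => X x j) x +
        X x j * (2 * inner ℝ (u x) (pderiv3 j u x)) := by
    intro j x
    rw [← hnd]
    unfold pderiv3
    rw [fderiv_fun_mul (hnsq.differentiable (by simp) x)
      ((hXj j).differentiable (by simp) x)]
    simp
  have hcu : ContinuousOn (fun x => ‖u x‖ ^ 2) (frontier Ω) := hnsq.continuous.continuousOn
  have hν := continuousOn_outerNormal hΩ hs
  have hνj : ∀ j, ContinuousOn (fun x => outerNormal Ω x j) (frontier Ω) := fun j =>
    (EuclideanSpace.proj (𝕜 := ℝ) j).continuous.comp_continuousOn hν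
  calc ∫ x, ‖u x‖ ^ 2 ∂(surfaceMeasure Ω)
      ≤ ∫ x, ∑ j, ‖u x‖ ^ 2 * X x j * outerNormal Ω x j ∂(surfaceMeasure Ω) := by
        refine integral_mono_ae (integrable_surfaceMeasure_of_continuousOn hb hs hcu)
          (integrable_surfaceMeasure_of_continuousOn hb hs (continuousOn_finsetSum _ fun j _ =>
            (hcu.mul (hXj j).continuous.continuousOn).mul (hνj j))) ?_
        filter_upwards [ae_restrict_mem isClosed_frontier.measurableSet] with x hx
        have h1 := hXν x hx
        rw [inner_eq_sum_E3] at h1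
        have h2 : ∑ j, ‖u x‖ ^ 2 * X x j * outerNormal Ω x j =
            ‖u x‖ ^ 2 * ∑ j, outerNormal Ω x j * X x j := by
          rw [Finset.mul_sum]; exact Finset.sum_congr rfl fun j _ => by ring
        rw [h2]
        nlinarith [sq_nonneg ‖u x‖]
    _ = ∑ j, ∫ x in Ω, pderiv3 j (fun x => ‖u x‖ ^ 2 * X x j) x := by
        rw [integral_finsetSum]
        · exact Finset.sum_congr rfl fun j _ => (setIntegral_pderiv3 hΩ hb hs (hF j) j).symm
        · exact fun j _ => integrable_surfaceMeasure_of_continuousOn hb hs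
            ((hcu.mul (hXj j).continuous.continuousOn).mul (hνj j))
    _ ≤ ∑ j, ∫ x in Ω, (2 * M j) * (‖u x‖ ^ 2 + ∑ j, ‖pderiv3 j u x‖ ^ 2) := by
        refine Finset.sum_le_sum fun j _ => ?_
        refine setIntegral_mono_on (integrableOn_of_continuous_of_isBounded hb
          (continuous_pderiv3 (hF j) j)) (integrableOn_of_continuous_of_isBounded hb ?_)
          hΩ.measurableSet fun x hx => ?_
        · exact continuous_const.mul (hnsq.continuous.add (continuous_finsetSum _ fun j _ =>
            (continuous_pderiv3 hu j).norm.pow 2))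
        · rw [hFd]
          obtain ⟨h1, h2⟩ := hM j x (subset_closure hx)
          have h3 := abs_real_inner_le_norm (u x) (pderiv3 j u x)
          have h4 : ‖pderiv3 j u x‖ ^ 2 ≤ ∑ j, ‖pderiv3 j u x‖ ^ 2 :=
            Finset.single_le_sum (f := fun j => ‖pderiv3 j u x‖ ^ 2)
              (fun _ _ => by positivity) (Finset.mem_univ j)
          have h5 : X x j * (2 * inner ℝ (u x) (pderiv3 j u x)) ≤
              M j * (2 * (‖u x‖ * ‖pderiv3 j u x‖)) := by
            refine (le_abs_self _).trans ?_
            rw [abs_mul, abs_mul, abs_two]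
            have := hM0 j
            gcongr
          have h6 : ‖u x‖ ^ 2 * pderiv3 j (fun x => X x j) x ≤ ‖u x‖ ^ 2 * M j := by
            have := (le_abs_self _).trans h2
            gcongr
          nlinarith [sq_nonneg (‖u x‖ - ‖pderiv3 j u x‖), hM0 j,
            mul_nonneg (hM0 j) (sq_nonneg (‖u x‖ - ‖pderiv3 j u x‖)),
            mul_le_mul_of_nonneg_left h4 (hM0 j), mul_nonneg (hM0 j) (sq_nonneg ‖u x‖),
            mul_nonneg (hM0 j) (sq_nonneg ‖pderiv3 j u x‖)]
    _ = _ := by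
        simp_rw [integral_const_mul]
        rw [← Finset.sum_mul, ← Finset.mul_sum]

end TraceInequality

/-! ### Approximation in L² by averages of translates. -/

section Mollification

open Set
open scoped ENNReal Convolution

/-- Translations are continuous in `L²`. -/
theorem tendsto_eLpNorm_translate_sub {f : E3 → ℂ} (hf : MemLp f 2 volume) :
    Tendsto (fun z => eLpNorm (fun x => f (x - z) - f x) 2 volume) (𝓝 0) (𝓝 0) := by
  let τ : E3 → C(E3, E3) := fun z => ⟨fun x => x - z, by fun_prop⟩
  have hτ : ∀ z, MeasurePreserving (τ z) (volume : Measure E3) volume := fun z =>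
    measurePreserving_sub_right volume z
  have hτc : Continuous τ :=
    (ContinuousMap.mk (fun p : E3 × E3 => p.2 - p.1) (by fun_prop)).curry.continuous
  have h := (continuous_const (y := hf.toLp f)).compMeasurePreservingLp hτc hτ
    (by simp : (2 : ℝ≥0∞) ≠ ⊤)
  have h0 : Lp.compMeasurePreserving (τ 0) (hτ 0) (hf.toLp f) = hf.toLp f := by
    rw [Lp.toLp_compMeasurePreserving]
    congr 1
    ext x
    simp [τ]
  have h1 := h.tendsto 0
  simp only [h0] at h1
  simp_rw [Lp.toLp_compMeasurePreserving] at h1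
  have h2 := (Lp.tendsto_Lp_iff_tendsto_eLpNorm'' _ (fun z => hf.comp_measurePreserving (hτ z))
    f hf).1 h1
  exact h2

theorem eLpNorm_two_sq {α E : Type*} [MeasurableSpace α] [NormedAddCommGroup E] (f : α → E)
    (μ : Measure α) : eLpNorm f 2 μ ^ 2 = ∫⁻ x, ‖f x‖ₑ ^ 2 ∂μ := by
  rw [eLpNorm_eq_lintegral_rpow_enorm_toReal (by simp) (by simp), ← ENNReal.rpow_natCast,
    ← ENNReal.rpow_mul]
  simp

/-- Averages of translates of an `L²` function. -/
theorem eLpNorm_convolution_sub_le {f : E3 → ℂ} (hf : MemLp f 2 volume) {η : E3 → ℝ}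
    (hη : Continuous η) (hηs : HasCompactSupport η) (hη0 : ∀ z, 0 ≤ η z) (hη1 : ∫ z, η z = 1)
    {δ : ℝ≥0∞}
    (hδ : ∀ z, η z ≠ 0 → eLpNorm (fun x => f (x - z) - f x) 2 volume ≤ δ) :
    eLpNorm (fun x => (η ⋆[ContinuousLinearMap.lsmul ℝ ℝ, volume] f) x - f x) 2 volume ≤ δ := by
  -- A strongly measurable representative makes the integrand jointly measurable, as Tonelli
  -- requires. The convolution does not see the change, and translates change only on null sets.
  obtain ⟨f', hf'm, hff'⟩ := hf.1
  have hconv : (η ⋆[ContinuousLinearMap.lsmul ℝ ℝ, volume] f) =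
      (η ⋆[ContinuousLinearMap.lsmul ℝ ℝ, volume] f') :=
    convolution_congr _ EventuallyEq.rfl hff'
  have hf' : MemLp f' 2 volume := (memLp_congr_ae hff').1 hf
  have hδ' : ∀ z, η z ≠ 0 → eLpNorm (fun x => f' (x - z) - f' x) 2 volume ≤ δ := by
    intro z hz
    refine le_trans (le_of_eq (eLpNorm_congr_ae ?_)) (hδ z hz)
    have h1 : (fun x => f (x - z)) =ᵐ[volume] fun x => f' (x - z) :=
      (measurePreserving_sub_right volume z).quasiMeasurePreserving.ae_eq_comp hff'
    exact (h1.sub hff').symm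
  have hgoal : eLpNorm (fun x => (η ⋆[ContinuousLinearMap.lsmul ℝ ℝ, volume] f) x - f x) 2 volume =
      eLpNorm (fun x => (η ⋆[ContinuousLinearMap.lsmul ℝ ℝ, volume] f') x - f' x) 2 volume := by
    rw [hconv]
    refine eLpNorm_congr_ae ?_
    filter_upwards [hff'] with x hx
    rw [hx]
  rw [hgoal]
  have hηi : Integrable η volume := hη.integrable_of_hasCompactSupport hηs
  have hηl : ∫⁻ z, ENNReal.ofReal (η z) = 1 := by
    rw [← ofReal_integral_eq_lintegral_ofReal hηi (Eventually.of_forall hη0), hη1]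
    simp
  -- Under the probability measure η dz the L¹ norm is at most the L² norm. This bounds the
  -- convolution error pointwise, and Tonelli then integrates the squared translation errors.
  set P : Measure E3 := volume.withDensity fun z => ENNReal.ofReal (η z) with hP
  have hPm : Measurable fun z => ENNReal.ofReal (η z) := hη.measurable.ennreal_ofReal
  have hprob : IsProbabilityMeasure P := ⟨by
    rw [hP, withDensity_apply _ MeasurableSet.univ, Measure.restrict_univ, hηl]⟩
  have hfm : Measurable f' := hf'm.measurable
  have hloc : LocallyIntegrable f' volume := hf'.locallyIntegrable (by norm_num)
  have hpt : ∀ x, ‖(η ⋆[ContinuousLinearMap.lsmul ℝ ℝ, volume] f') x - f' x‖ₑ ^ 2 ≤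
      ∫⁻ z, ENNReal.ofReal (η z) * ‖f' (x - z) - f' x‖ₑ ^ 2 := by
    intro x
    have hex : ConvolutionExistsAt η f' x (ContinuousLinearMap.lsmul ℝ ℝ) volume :=
      (hηs.convolutionExists_left _ hη hloc) x
    have h1 : (η ⋆[ContinuousLinearMap.lsmul ℝ ℝ, volume] f') x - f' x =
        ∫ z, η z • (f' (x - z) - f' x) := by
      have h2 : f' x = ∫ z, η z • f' x := by rw [integral_smul_const, hη1, one_smul]
      conv_lhs => rw [h2]
      rw [convolution_def, ← integral_sub hex (hηi.smul_const _)]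
      simp [smul_sub]
    have h3 : ‖(η ⋆[ContinuousLinearMap.lsmul ℝ ℝ, volume] f') x - f' x‖ₑ ≤
        eLpNorm (fun z => f' (x - z) - f' x) 1 P := by
      rw [h1, eLpNorm_one_eq_lintegral_enorm, hP, lintegral_withDensity_eq_lintegral_mul _ hPm
        (by fun_prop)]
      refine (enorm_integral_le_lintegral_enorm _).trans (le_of_eq (lintegral_congr fun z => ?_))
      rw [enorm_smul, Real.enorm_eq_ofReal (hη0 z)]
      rfl
    have h4 : eLpNorm (fun z => f' (x - z) - f' x) 1 P ≤
        eLpNorm (fun z => f' (x - z) - f' x) 2 P :=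
      eLpNorm_le_eLpNorm_of_exponent_le (by norm_num)
        (by fun_prop : Measurable fun z => f' (x - z) - f' x).aestronglyMeasurable
    calc _ ≤ eLpNorm (fun z => f' (x - z) - f' x) 2 P ^ 2 := by gcongr; exact h3.trans h4
      _ = _ := by
        rw [eLpNorm_two_sq, hP, lintegral_withDensity_eq_lintegral_mul _ hPm (by fun_prop)]
        rfl
  have hsq : eLpNorm (fun x => (η ⋆[ContinuousLinearMap.lsmul ℝ ℝ, volume] f') x - f' x) 2
      volume ^ 2 ≤ δ ^ 2 := by
    rw [eLpNorm_two_sq]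
    calc _ ≤ ∫⁻ x, ∫⁻ z, ENNReal.ofReal (η z) * ‖f' (x - z) - f' x‖ₑ ^ 2 :=
          lintegral_mono hpt
      _ = ∫⁻ z, ∫⁻ x, ENNReal.ofReal (η z) * ‖f' (x - z) - f' x‖ₑ ^ 2 := by
          refine lintegral_lintegral_swap (Measurable.aemeasurable ?_)
          simp only [Function.uncurry_def]
          fun_prop
      _ ≤ ∫⁻ z, ENNReal.ofReal (η z) * δ ^ 2 := by
          refine lintegral_mono fun z => ?_
          rw [lintegral_const_mul _ (by fun_prop), ← eLpNorm_two_sq]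
          by_cases hz : η z = 0
          · simp [hz]
          · gcongr
            exact hδ' z hz
      _ = δ ^ 2 := by rw [lintegral_mul_const _ hPm, hηl, one_mul]
  exact (ENNReal.pow_le_pow_left_iff two_ne_zero).1 hsq

end Mollification

/-! ### Multiplication of L² functions by continuous functions. -/

section Multipliers

open Set
open scoped ENNReal

theorem ae_mem_closure_restrict {Ω : Set E3} (hΩ : IsOpen Ω) :
    ∀ᵐ x ∂(volume.restrict Ω), x ∈ closure Ω :=
  (ae_restrict_mem hΩ.measurableSet).mono fun _ hx => subset_closure hx

theorem ae_mem_frontier_surfaceMeasure (Ω : Set E3) :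
    ∀ᵐ x ∂(surfaceMeasure Ω), x ∈ frontier Ω :=
  ae_restrict_mem isClosed_frontier.measurableSet

theorem isFiniteMeasure_restrict_of_isBounded {Ω : Set E3} (hb : Bornology.IsBounded Ω) :
    IsFiniteMeasure (volume.restrict Ω) :=
  ⟨by rw [Measure.restrict_apply_univ]; exact hb.measure_lt_top⟩

theorem exists_eLpNorm_smul_le {α E : Type*} [MeasurableSpace α] [TopologicalSpace α]
    [NormedAddCommGroup E] [NormedSpace ℝ E] {μ : Measure α} {K : Set α} (hK : IsCompact K)
    (hμ : ∀ᵐ x ∂μ, x ∈ K) {a : α → ℝ} (ha : ContinuousOn a K) :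
    ∃ C : ℝ, 0 ≤ C ∧ ∀ w : α → E, eLpNorm (fun x => a x • w x) 2 μ ≤
      ENNReal.ofReal C * eLpNorm w 2 μ := by
  obtain ⟨C, hC⟩ := hK.exists_bound_of_continuousOn ha
  refine ⟨max C 0, le_max_right _ _, fun w => eLpNorm_le_mul_eLpNorm_of_ae_le_mul ?_ 2⟩
  filter_upwards [hμ] with x hx
  rw [norm_smul]
  gcongr
  exact (hC x hx).trans (le_max_left _ _)

theorem memLp_smul_of_continuousOn {α E : Type*} [MeasurableSpace α] [TopologicalSpace α]
    [NormedAddCommGroup E] [NormedSpace ℝ E] {μ : Measure α} {K : Set α} (hK : IsCompact K)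
    (hμ : ∀ᵐ x ∂μ, x ∈ K) {a : α → ℝ} (ha : ContinuousOn a K) (ham : AEStronglyMeasurable a μ)
    {w : α → E} (hw : MemLp w 2 μ) : MemLp (fun x => a x • w x) 2 μ := by
  obtain ⟨C, -, hC⟩ := exists_eLpNorm_smul_le (E := E) hK hμ ha
  exact ⟨ham.smul hw.1, (hC w).trans_lt (ENNReal.mul_lt_top (by simp) hw.2)⟩

theorem memLp_smul_of_continuous {Ω : Set E3} (hΩ : IsOpen Ω) (hb : Bornology.IsBounded Ω)
    {E : Type*} [NormedAddCommGroup E] [NormedSpace ℝ E] {a : E3 → ℝ} (ha : Continuous a)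
    {w : E3 → E} (hw : MemLp w 2 (volume.restrict Ω)) :
    MemLp (fun x => a x • w x) 2 (volume.restrict Ω) :=
  memLp_smul_of_continuousOn hb.isCompact_closure (ae_mem_closure_restrict hΩ) ha.continuousOn
    ha.aestronglyMeasurable hw

theorem memLp_of_continuous {Ω : Set E3} (hΩ : IsOpen Ω) (hb : Bornology.IsBounded Ω)
    {E : Type*} [NormedAddCommGroup E] {a : E3 → E} (ha : Continuous a) :
    MemLp a 2 (volume.restrict Ω) := by
  have := isFiniteMeasure_restrict_of_isBounded hb
  obtain ⟨C, hC⟩ := hb.isCompact_closure.exists_bound_of_continuousOn ha.continuousOn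
  exact MemLp.of_bound ha.aestronglyMeasurable C ((ae_mem_closure_restrict hΩ).mono hC)

theorem memLp_surfaceMeasure_of_continuousOn {Ω : Set E3} (hb : Bornology.IsBounded Ω)
    (hs : HasSmoothBoundary Ω) {E : Type*} [NormedAddCommGroup E] {a : E3 → E}
    (ha : ContinuousOn a (frontier Ω)) : MemLp a 2 (surfaceMeasure Ω) := by
  have := isFiniteMeasure_surfaceMeasure hb hs
  obtain ⟨C, hC⟩ := (isCompact_frontier_of_isBounded hb).exists_bound_of_continuousOn ha
  exact MemLp.of_bound (aestronglyMeasurable_surfaceMeasure_of_continuousOn ha) C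
    ((ae_mem_frontier_surfaceMeasure Ω).mono hC)

theorem integrable_smul_of_continuous {Ω : Set E3} (hΩ : IsOpen Ω) (hb : Bornology.IsBounded Ω)
    {E : Type*} [NormedAddCommGroup E] [NormedSpace ℝ E] {a : E3 → ℝ} (ha : Continuous a)
    {w : E3 → E} (hw : MemLp w 2 (volume.restrict Ω)) :
    Integrable (fun x => a x • w x) (volume.restrict Ω) := by
  have := isFiniteMeasure_restrict_of_isBounded hb
  exact (memLp_smul_of_continuous hΩ hb ha hw).integrable (by norm_num)

theorem pderiv3_mul {f g : E3 → ℝ} {x : E3} (hf : DifferentiableAt ℝ f x)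
    (hg : DifferentiableAt ℝ g x) (j : Fin 3) :
    pderiv3 j (fun y => f y * g y) x = f x * pderiv3 j g x + g x * pderiv3 j f x := by
  unfold pderiv3
  rw [fderiv_fun_mul hf hg]
  simp

theorem pderiv3_comp_sub_left {f : E3 → ℝ} (x y : E3) (hf : DifferentiableAt ℝ f (x - y))
    (j : Fin 3) : pderiv3 j (fun y => f (x - y)) y = -pderiv3 j f (x - y) := by
  unfold pderiv3
  have h1 : HasFDerivAt (fun y : E3 => x - y) (-ContinuousLinearMap.id ℝ E3) y :=
    (hasFDerivAt_id y).const_sub x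
  have h2 : HasFDerivAt (fun y => f (x - y)) _ y := HasFDerivAt.comp (g := f) y hf.hasFDerivAt h1
  rw [h2.fderiv]
  simp

end Multipliers

/-! ### Density in H¹(Ω) of functions smooth up to the boundary. -/

section Density

open Set
open scoped ENNReal Convolution

/-- Near every point of the closure, `Ω` can be shifted into itself. -/
theorem exists_shift_mem {Ω : Set E3} (hΩ : IsOpen Ω) (hs : HasSmoothBoundary Ω) {x₀ : E3}
    (hx₀ : x₀ ∈ closure Ω) :
    ∃ N ∈ 𝓝 x₀, ∃ n : E3, ∃ c > (0 : ℝ), ∃ t₀ > (0 : ℝ), ∀ t, 0 < t → t < t₀ → ∀ x ∈ Ω,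
      ∀ z ∈ Metric.closedBall (t • n) (c * t), x - z ∈ N → x - z ∈ Ω := by
  by_cases hx : x₀ ∈ Ω
  · exact ⟨Ω, hΩ.mem_nhds hx, 0, 1, one_pos, 1, one_pos, fun _ _ _ _ _ _ _ h => h⟩
  obtain ⟨ρ, hρ⟩ := hs x₀ (by rw [hΩ.frontier_eq]; exact ⟨hx₀, hx⟩)
  set n := gradient ρ x₀ with hn
  have hn0 : 0 < ‖n‖ := norm_pos_iff.2 hρ.2.2.1
  have hstrict : HasStrictFDerivAt ρ (fderiv ℝ ρ x₀) x₀ :=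
    hρ.1.contDiffAt.hasStrictFDerivAt (by simp)
  -- With this tolerance the linearization error is at most (‖n‖/4)‖z‖ ≤ (3/8)t‖n‖², while the
  -- linear term lowers ρ by at least (1/2)t‖n‖².
  have hev := hstrict.isLittleO.def (c := ‖n‖ / 4) (by positivity)
  rw [nhds_prod_eq] at hev
  obtain ⟨V, hV, hV'⟩ := Filter.eventually_prod_self_iff'.1 hev
  obtain ⟨R, hR, hball⟩ := Metric.nhds_basis_ball.mem_iff.1 (inter_mem hV hρ.2.2.2)
  refine ⟨Metric.ball x₀ (R / 2), Metric.ball_mem_nhds _ (by positivity), n, ‖n‖ / 2,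
    by positivity, R / 2 / (2 * ‖n‖), by positivity, ?_⟩
  intro t ht htt x hxΩ z hz hxz
  rw [mem_closedBall_iff_norm] at hz
  have hzn : ‖z‖ ≤ 3 / 2 * t * ‖n‖ := by
    have := norm_add_le (z - t • n) (t • n)
    rw [sub_add_cancel, norm_smul, Real.norm_eq_abs, abs_of_pos ht] at this
    linarith
  have hzR : ‖z‖ < R / 2 := by
    rw [lt_div_iff₀ (by positivity)] at htt
    nlinarith
  have hxR : x ∈ Metric.ball x₀ R := by
    rw [Metric.mem_ball, dist_eq_norm] at hxz ⊢
    have := norm_add_le (x - z - x₀) z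
    have h2 : x - z - x₀ + z = x - x₀ := by abel
    rw [h2] at this
    linarith
  have hxzR : x - z ∈ Metric.ball x₀ R := Metric.ball_subset_ball (by linarith) hxz
  have hest := hV' (x - z) (hball hxzR).1 x (hball hxR).1
  have hρx : ρ x < 0 := (hball hxR).2.1 hxΩ
  refine (hball hxzR).2.2 ?_
  have hder : fderiv ℝ ρ x₀ z = inner ℝ n z := by
    rw [hn, gradient, InnerProductSpace.toDual_symm_apply]
  simp only [sub_sub_cancel_left, map_neg, norm_neg, hder] at hest
  have h1 := (abs_le.1 ((Real.norm_eq_abs _).symm.le.trans hest)).2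
  have h2 : t * ‖n‖ ^ 2 - ‖n‖ * (‖n‖ / 2 * t) ≤ inner ℝ n z := by
    have h3 := (abs_le.1 (abs_real_inner_le_norm n (z - t • n))).1
    rw [inner_sub_right, inner_smul_right, real_inner_self_eq_norm_sq] at h3
    have : ‖n‖ * ‖z - t • n‖ ≤ ‖n‖ * (‖n‖ / 2 * t) := by gcongr
    linarith
  have h4 : ‖n‖ / 4 * ‖z‖ ≤ ‖n‖ / 4 * (3 / 2 * t * ‖n‖) := by gcongr
  nlinarith [mul_pos ht (sq_pos_of_pos hn0)]

/-- Differentiating a mollification of a cut-off Sobolev function. -/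
theorem pderiv3_convolution_indicator {Ω : Set E3} (hΩ : IsOpen Ω) (hb : Bornology.IsBounded Ω)
    {w w' : E3 → ℂ} {j : Fin 3} (hw : MemL2 Ω w) (hw' : MemL2 Ω w') (hww' : HasWeakPartial Ω j w w')
    {χ : E3 → ℝ} (hχ : ContDiff ℝ ∞ χ) (hχs : HasCompactSupport χ) {η : E3 → ℝ}
    (hη : ContDiff ℝ ∞ η) (hηs : HasCompactSupport η) {x : E3}
    (hx : ∀ z ∈ tsupport η, x - z ∈ tsupport χ → x - z ∈ Ω) :
    pderiv3 j (η ⋆[ContinuousLinearMap.lsmul ℝ ℝ, volume] Ω.indicator fun y => χ y • w y) x =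
      (η ⋆[ContinuousLinearMap.lsmul ℝ ℝ, volume]
        Ω.indicator fun y => χ y • w' y + pderiv3 j χ y • w y) x := by
  have hfin := isFiniteMeasure_restrict_of_isBounded hb
  have hχc := hχ.continuous
  have hηc := hη.continuous
  have hloc : LocallyIntegrable (Ω.indicator fun y => χ y • w y) volume :=
    ((integrable_indicator_iff hΩ.measurableSet).2
      (integrable_smul_of_continuous hΩ hb hχc hw)).locallyIntegrable
  have hd := hηs.hasFDerivAt_convolution_left (ContinuousLinearMap.lsmul ℝ ℝ)
    (hη.of_le (by simp)) hloc x
  have hηd : Continuous (fderiv ℝ η) := hη.continuous_fderiv (by simp)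
  have hexists := ((hηs.fderiv (𝕜 := ℝ)).convolutionExists_left
    ((ContinuousLinearMap.lsmul ℝ ℝ : ℝ →L[ℝ] ℂ →L[ℝ] ℂ).precompL E3) hηd hloc) x
  have hsupp : ∀ y, η (x - y) ≠ 0 → x - y ∈ tsupport η := fun y h => subset_tsupport _ h
  -- the test function
  set ψ : E3 → ℝ := fun y => η (x - y) * χ y with hψ
  have hηx : ContDiff ℝ ∞ fun y => η (x - y) := hη.comp (contDiff_const.sub contDiff_id)
  have hψd : ContDiff ℝ ∞ ψ := hηx.mul hχ
  have hψs : HasCompactSupport ψ := hχs.mul_left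
  -- This is what the shift is for: the test function y ↦ η(x - y)χ(y) lives inside Ω, so extending
  -- w by zero creates no boundary contribution.
  have hψΩ : tsupport ψ ⊆ Ω := by
    intro y hy
    have h1 : y ∈ tsupport χ := closure_mono (fun z hz => right_ne_zero_of_mul hz) hy
    have h2 : x - y ∈ tsupport η := by
      have hcl : IsClosed {y | x - y ∈ tsupport η} :=
        (isClosed_tsupport η).preimage (continuous_const.sub continuous_id)
      refine (closure_minimal (fun z hz => ?_) hcl) hy
      exact subset_tsupport _ (left_ne_zero_of_mul hz)
    have := hx (x - y) h2 (by rwa [sub_sub_cancel])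
    rwa [sub_sub_cancel] at this
  have hψj : ∀ y, pderiv3 j ψ y = η (x - y) * pderiv3 j χ y - χ y * pderiv3 j η (x - y) := by
    intro y
    rw [hψ, pderiv3_mul (hηx.differentiable (by simp) y) (hχ.differentiable (by simp) y),
      pderiv3_comp_sub_left x y (hη.differentiable (by simp) _)]
    ring
  have hweak := hww' ψ hψd hψs hψΩ
  have hχj := continuous_pderiv3 (hχ.of_le (by simp)) j
  have hηj := continuous_pderiv3 (hη.of_le (by simp)) j
  have hηxc : Continuous fun y => η (x - y) := hηx.continuous
  have hηjx : Continuous fun y => pderiv3 j η (x - y) :=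
    hηj.comp (continuous_const.sub continuous_id)
  have i1 : Integrable (fun y => (η (x - y) * pderiv3 j χ y) • w y) (volume.restrict Ω) :=
    integrable_smul_of_continuous hΩ hb (hηxc.mul hχj) hw
  have i2 : Integrable (fun y => (χ y * pderiv3 j η (x - y)) • w y) (volume.restrict Ω) :=
    integrable_smul_of_continuous hΩ hb (hχc.mul hηjx) hw
  have i3 : Integrable (fun y => ψ y • w' y) (volume.restrict Ω) :=
    integrable_smul_of_continuous hΩ hb hψd.continuous hw'
  have hL : pderiv3 j (η ⋆[ContinuousLinearMap.lsmul ℝ ℝ, volume]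
      Ω.indicator fun y => χ y • w y) x =
      ∫ y in Ω, (χ y * pderiv3 j η (x - y)) • w y := by
    unfold pderiv3
    rw [hd.fderiv, convolution_def, ContinuousLinearMap.integral_apply hexists,
      ← integral_indicator hΩ.measurableSet, ← integral_sub_left_eq_self _ volume x]
    refine integral_congr_ae (Eventually.of_forall fun y => ?_)
    simp only [sub_sub_cancel, ContinuousLinearMap.precompL_apply, ContinuousLinearMap.lsmul_apply]
    by_cases hy : y ∈ Ω
    · rw [indicator_of_mem hy, indicator_of_mem hy, smul_smul, mul_comm]
    · rw [indicator_of_notMem hy, indicator_of_notMem hy, smul_zero]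
  have hRt : (η ⋆[ContinuousLinearMap.lsmul ℝ ℝ, volume]
        Ω.indicator fun y => χ y • w' y + pderiv3 j χ y • w y) x =
      ∫ y in Ω, (ψ y • w' y + (η (x - y) * pderiv3 j χ y) • w y) := by
    rw [convolution_def, ← integral_indicator hΩ.measurableSet,
      ← integral_sub_left_eq_self _ volume x]
    refine integral_congr_ae (Eventually.of_forall fun y => ?_)
    simp only [sub_sub_cancel, ContinuousLinearMap.lsmul_apply]
    by_cases hy : y ∈ Ω
    · rw [indicator_of_mem hy, indicator_of_mem hy, smul_add, smul_smul, smul_smul]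
    · rw [indicator_of_notMem hy, indicator_of_notMem hy, smul_zero]
  rw [hL, hRt, integral_add i3 i1]
  simp_rw [hψj, sub_smul] at hweak
  rw [integral_sub i1 i2] at hweak
  have h := eq_neg_iff_add_eq_zero.1 hweak
  rw [← sub_eq_zero, ← neg_eq_zero, ← h]
  abel

/-- The mollifiers are centred at t·n rather than at the origin, with radius c·t. For x in Ω they
sample the cut-off function only at points shifted into Ω, so differentiation passes to the weak
derivatives up to the boundary. -/
theorem exists_smooth_approx_cutoff {Ω : Set E3} (hΩ : IsOpen Ω) (hb : Bornology.IsBounded Ω)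
    {w : E3 → ℂ} {w' : Fin 3 → E3 → ℂ} (hw : MemL2 Ω w) (hw' : ∀ j, MemL2 Ω (w' j))
    (hww' : ∀ j, HasWeakPartial Ω j w (w' j))
    {χ : E3 → ℝ} (hχ : ContDiff ℝ ∞ χ) (hχs : HasCompactSupport χ) {n : E3} {c t₀ : ℝ} (hc : 0 < c)
    (ht₀ : 0 < t₀) (hshift : ∀ t, 0 < t → t < t₀ → ∀ x ∈ Ω,
      ∀ z ∈ Metric.closedBall (t • n) (c * t), x - z ∈ tsupport χ → x - z ∈ Ω) :
    ∃ u : ℕ → E3 → ℂ, (∀ k, ContDiff ℝ ∞ (u k)) ∧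
      Tendsto (fun k => eLpNorm (u k - fun x => χ x • w x) 2 (volume.restrict Ω)) atTop (𝓝 0) ∧
      ∀ j, Tendsto (fun k => eLpNorm (pderiv3 j (u k) -
        fun x => χ x • w' j x + pderiv3 j χ x • w x) 2 (volume.restrict Ω)) atTop (𝓝 0) := by
  -- A null sequence that stays strictly between 0 and t₀, as the shift property demands.
  let t : ℕ → ℝ := fun k => t₀ / 2 * (1 / ((k : ℝ) + 1))
  have htpos : ∀ k, 0 < t k := fun k => by positivity
  have htlt : ∀ k, t k < t₀ := fun k => by
    have : 1 / ((k : ℝ) + 1) ≤ 1 := by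
      rw [div_le_one (by positivity)]
      linarith [(Nat.cast_nonneg k : (0 : ℝ) ≤ k)]
    calc t k ≤ t₀ / 2 * 1 := mul_le_mul_of_nonneg_left this (by positivity)
      _ < t₀ := by linarith
  have httend : Tendsto t atTop (𝓝 0) := by
    simpa [t] using tendsto_one_div_add_atTop_nhds_zero_nat.const_mul (t₀ / 2)
  let B : ∀ k, ContDiffBump (t k • n) := fun k =>
    ⟨c * t k / 2, c * t k, by have := htpos k; positivity, by have := htpos k; nlinarith⟩
  let η : ℕ → E3 → ℝ := fun k => (B k).normed volume
  have hηd : ∀ k, ContDiff ℝ ∞ (η k) := fun k => (B k).contDiff_normed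
  have hηs : ∀ k, HasCompactSupport (η k) := fun k => (B k).hasCompactSupport_normed
  have hηt : ∀ k, tsupport (η k) = Metric.closedBall (t k • n) (c * t k) := fun k =>
    (B k).tsupport_normed_eq
  have hconv : ∀ f : E3 → ℂ, MemLp f 2 volume → Tendsto (fun k => eLpNorm (fun x =>
      (η k ⋆[ContinuousLinearMap.lsmul ℝ ℝ, volume] f) x - f x) 2 volume) atTop (𝓝 0) := by
    intro f hf
    rw [ENNReal.tendsto_nhds_zero]
    intro δ hδ
    have h1 := (ENNReal.tendsto_nhds_zero.1 (tendsto_eLpNorm_translate_sub hf)) δ hδ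
    obtain ⟨r, hr, hball⟩ := Metric.nhds_basis_ball.eventually_iff.1 h1
    have h2 : ∀ᶠ k in atTop, t k * (‖n‖ + c) < r := by
      have : Tendsto (fun k => t k * (‖n‖ + c)) atTop (𝓝 0) := by
        simpa using httend.mul_const (‖n‖ + c)
      exact this.eventually (gt_mem_nhds hr)
    filter_upwards [h2] with k hk
    refine eLpNorm_convolution_sub_le hf (hηd k).continuous (hηs k)
      (fun z => (B k).nonneg_normed z) (B k).integral_normed fun z hz => hball ?_
    have hz' : z ∈ Metric.closedBall (t k • n) (c * t k) := by
      rw [← hηt]; exact subset_tsupport _ hz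
    rw [mem_closedBall_iff_norm] at hz'
    rw [mem_ball_zero_iff]
    have := norm_add_le (z - t k • n) (t k • n)
    rw [sub_add_cancel, norm_smul, Real.norm_eq_abs, abs_of_pos (htpos k)] at this
    linarith
  have hind : ∀ f : E3 → ℂ, MemLp f 2 (volume.restrict Ω) → MemLp (Ω.indicator f) 2 volume :=
    fun f hf => (memLp_indicator_iff_restrict hΩ.measurableSet).2 hf
  have hm0 : MemLp (fun y => χ y • w y) 2 (volume.restrict Ω) :=
    memLp_smul_of_continuous hΩ hb hχ.continuous hw
  have hmj : ∀ j, MemLp (fun y => χ y • w' j y + pderiv3 j χ y • w y) 2 (volume.restrict Ω) :=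
    fun j => (memLp_smul_of_continuous hΩ hb hχ.continuous (hw' j)).add
      (memLp_smul_of_continuous hΩ hb (continuous_pderiv3 (hχ.of_le (by simp)) j) hw)
  refine ⟨fun k => η k ⋆[ContinuousLinearMap.lsmul ℝ ℝ, volume] Ω.indicator fun y => χ y • w y,
    fun k => ?_, ?_, fun j => ?_⟩
  · exact (hηs k).contDiff_convolution_left (n := ⊤) _ (hηd k)
      ((hind _ hm0).locallyIntegrable (by norm_num))
  · refine tendsto_of_tendsto_of_tendsto_of_le_of_le tendsto_const_nhds (hconv _ (hind _ hm0))
      (fun _ => zero_le) fun k => ?_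
    refine le_trans (le_of_eq (eLpNorm_congr_ae ?_)) (eLpNorm_mono_measure _ Measure.restrict_le_self)
    filter_upwards [ae_restrict_mem hΩ.measurableSet] with x hx
    simp [indicator_of_mem hx]
  · refine tendsto_of_tendsto_of_tendsto_of_le_of_le tendsto_const_nhds (hconv _ (hind _ (hmj j)))
      (fun _ => zero_le) fun k => ?_
    refine le_trans (le_of_eq (eLpNorm_congr_ae ?_)) (eLpNorm_mono_measure _ Measure.restrict_le_self)
    filter_upwards [ae_restrict_mem hΩ.measurableSet] with x hx
    rw [Pi.sub_apply, pderiv3_convolution_indicator hΩ hb hw (hw' j) (hww' j) hχ hχs (hηd k) (hηs k)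
      fun z hz => hshift (t k) (htpos k) (htlt k) x hx z (by rwa [← hηt]), indicator_of_mem hx]

/-- Functions that are smooth up to the boundary are dense in `H¹(Ω)`. -/
theorem exists_smooth_approx {Ω : Set E3} (hΩ : IsOpen Ω) (hb : Bornology.IsBounded Ω)
    (hs : HasSmoothBoundary Ω) {w : E3 → ℂ} {w' : Fin 3 → E3 → ℂ} (hw : MemL2 Ω w)
    (hw' : ∀ j, MemL2 Ω (w' j)) (hww' : ∀ j, HasWeakPartial Ω j w (w' j)) :
    ∃ u : ℕ → E3 → ℂ, (∀ k, ContDiff ℝ ∞ (u k)) ∧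
      Tendsto (fun k => eLpNorm (u k - w) 2 (volume.restrict Ω)) atTop (𝓝 0) ∧
      ∀ j, Tendsto (fun k => eLpNorm (pderiv3 j (u k) - w' j) 2 (volume.restrict Ω))
        atTop (𝓝 0) := by
  have hsh : ∀ x ∈ closure Ω, ∃ N : Set E3, N ∈ 𝓝 x ∧ ∃ n : E3, ∃ c > (0 : ℝ), ∃ t₀ > (0 : ℝ),
      ∀ t, 0 < t → t < t₀ → ∀ x ∈ Ω,
        ∀ z ∈ Metric.closedBall (t • n) (c * t), x - z ∈ N → x - z ∈ Ω := fun x hx => by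
    obtain ⟨N, hN, h⟩ := exists_shift_mem hΩ hs hx
    exact ⟨N, hN, h⟩
  choose! N hN n c hc t₀ ht₀ hshift using hsh
  obtain ⟨ι, _, p, χ, hp, hχ, hχs, hχN, -, hsum⟩ :=
    exists_finite_smoothPartition hb.isCompact_closure N hN
  have hex := fun i => exists_smooth_approx_cutoff hΩ hb hw hw' hww' (hχ i) (hχs i)
    (hc (p i) (hp i)) (ht₀ (p i) (hp i))
    (fun t h1 h2 x hx z hz h3 => hshift (p i) (hp i) t h1 h2 x hx z hz (hχN i h3))
  choose u hu hu0 huj using hex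
  have hlim : ∀ (f : ℕ → ι → E3 → ℂ) (g : ι → E3 → ℂ),
      (∀ k i, AEStronglyMeasurable (f k i - g i) (volume.restrict Ω)) →
      (∀ i, Tendsto (fun k => eLpNorm (f k i - g i) 2 (volume.restrict Ω)) atTop (𝓝 0)) →
      Tendsto (fun k => eLpNorm (∑ i, (f k i - g i)) 2 (volume.restrict Ω)) atTop (𝓝 0) := by
    intro f g hm h
    have h1 : Tendsto (fun k => ∑ i, eLpNorm (f k i - g i) 2 (volume.restrict Ω)) atTop
        (𝓝 (∑ i : ι, 0)) := tendsto_finsetSum _ fun i _ => h i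
    rw [Finset.sum_const_zero] at h1
    exact tendsto_of_tendsto_of_tendsto_of_le_of_le tendsto_const_nhds h1 (fun _ => zero_le)
      fun k => eLpNorm_sum_le (fun i _ => hm k i) (by norm_num)
  have hdiff : ∀ k i, Differentiable ℝ (u i k) := fun k i => (hu i k).differentiable (by simp)
  refine ⟨fun k => ∑ i, u i k, fun k => ?_, ?_, fun j => ?_⟩
  · have : (∑ i, u i k) = fun x => ∑ i, u i k x := by ext x; simp
    simp only [this]
    exact ContDiff.sum fun i _ => hu i k
  · refine (hlim (fun k i => u i k) (fun i x => χ i x • w x) (fun k i => ?_) hu0).congr fun k => ?_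
    · exact (hu i k).continuous.aestronglyMeasurable.sub
        (memLp_smul_of_continuous hΩ hb (hχ i).continuous hw).1
    · refine eLpNorm_congr_ae ?_
      filter_upwards [ae_restrict_mem hΩ.measurableSet] with x hx
      simp [Finset.sum_apply, Finset.sum_sub_distrib,
        hsum x (subset_closure hx), ← Finset.sum_mul, ← Complex.ofReal_sum]
  · refine (hlim (fun k i => pderiv3 j (u i k)) (fun i x => χ i x • w' j x + pderiv3 j (χ i) x • w x)
      (fun k i => ?_) fun i => huj i j).congr fun k => ?_
    · exact (continuous_pderiv3 ((hu i k).of_le (by simp)) j).aestronglyMeasurable.sub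
        ((memLp_smul_of_continuous hΩ hb (hχ i).continuous (hw' j)).add
          (memLp_smul_of_continuous hΩ hb (continuous_pderiv3 ((hχ i).of_le (by simp)) j) hw)).1
    · refine eLpNorm_congr_ae ?_
      filter_upwards [ae_restrict_mem hΩ.measurableSet] with x hx
      have h1 : pderiv3 j (∑ i, u i k) x = ∑ i, pderiv3 j (u i k) x := by
        unfold pderiv3
        rw [fderiv_sum fun i _ => hdiff k i x, sum_apply]
      -- The partition sums to 1 in a neighbourhood of x, so the terms in which the derivative falls
      -- on the cut-offs cancel.
      have h2 : ∑ i, pderiv3 j (χ i) x = 0 := by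
        have h3 : (fun y => ∑ i, χ i y) =ᶠ[𝓝 x] fun _ => (1 : ℝ) := by
          filter_upwards [hΩ.mem_nhds hx] with y hy using hsum y (subset_closure hy)
        have h4 := h3.fderiv_eq (𝕜 := ℝ)
        rw [fderiv_fun_sum fun i _ => (hχ i).differentiable (by simp) x] at h4
        have h5 := DFunLike.congr_fun h4 (EuclideanSpace.single j (1 : ℝ))
        rw [sum_apply] at h5
        simpa [pderiv3] using h5
      rw [Finset.sum_apply]
      simp only [Pi.sub_apply, Finset.sum_sub_distrib, Finset.sum_add_distrib, ← Finset.sum_smul,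
        h1, h2, hsum x (subset_closure hx), one_smul, zero_smul, add_zero]

end Density

/-! ### Existence of traces, and symmetry of weak second derivatives. -/

section Trace

open Set
open scoped ENNReal

theorem toReal_eLpNorm_two_sq {α E : Type*} [MeasurableSpace α] [NormedAddCommGroup E] {f : α → E}
    {μ : Measure α} (hf : MemLp f 2 μ) : (eLpNorm f 2 μ).toReal ^ 2 = ∫ x, ‖f x‖ ^ 2 ∂μ := by
  rw [← ENNReal.toReal_pow, eLpNorm_two_sq,
    integral_eq_lintegral_of_nonneg_ae (f := fun x => ‖f x‖ ^ 2)
      (Eventually.of_forall fun _ => by positivity) (hf.1.norm.pow 2)]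
  congr 1
  refine lintegral_congr fun x => ?_
  rw [← ofReal_norm, ENNReal.ofReal_pow (norm_nonneg _)]

theorem add_sum_sq_le_sq_add_sum {a : ℝ} {d : Fin 3 → ℝ} (ha : 0 ≤ a) (hd : ∀ j, 0 ≤ d j) :
    a ^ 2 + ∑ j, d j ^ 2 ≤ (a + ∑ j, d j) ^ 2 := by
  simp only [Fin.sum_univ_three]
  nlinarith [mul_nonneg (hd 0) (hd 1), mul_nonneg (hd 0) (hd 2), mul_nonneg (hd 1) (hd 2),
    mul_nonneg ha (hd 0), mul_nonneg ha (hd 1), mul_nonneg ha (hd 2)]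

/-- The trace inequality for functions that are smooth up to the boundary. -/
theorem exists_eLpNorm_surfaceMeasure_le {Ω : Set E3} (hΩ : IsOpen Ω) (hb : Bornology.IsBounded Ω)
    (hs : HasSmoothBoundary Ω) :
    ∃ C : ℝ≥0∞, C ≠ ⊤ ∧ ∀ u : E3 → ℂ, ContDiff ℝ 1 u →
      eLpNorm u 2 (surfaceMeasure Ω) ≤ C * (eLpNorm u 2 (volume.restrict Ω) +
        ∑ j, eLpNorm (pderiv3 j u) 2 (volume.restrict Ω)) := by
  obtain ⟨C, hC0, hC⟩ := integral_norm_sq_surfaceMeasure_le hΩ hb hs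
  refine ⟨ENNReal.ofReal √C, by simp, fun u hu => ?_⟩
  have hm0 : MemLp u 2 (volume.restrict Ω) := memLp_of_continuous hΩ hb hu.continuous
  have hmj : ∀ j, MemLp (pderiv3 j u) 2 (volume.restrict Ω) := fun j =>
    memLp_of_continuous hΩ hb (continuous_pderiv3 hu j)
  have hms : MemLp u 2 (surfaceMeasure Ω) :=
    memLp_surfaceMeasure_of_continuousOn hb hs hu.continuous.continuousOn
  have h := hC u hu
  rw [integral_add (hm0.integrable_norm_pow (p := 2) (by norm_num)) (integrable_finsetSum _ fun j _ =>
      (hmj j).integrable_norm_pow (p := 2) (by norm_num)),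
    integral_finsetSum _ fun j _ => (hmj j).integrable_norm_pow (p := 2) (by norm_num),
    ← toReal_eLpNorm_two_sq hms, ← toReal_eLpNorm_two_sq hm0] at h
  simp_rw [← toReal_eLpNorm_two_sq (hmj _)] at h
  let a := (eLpNorm u 2 (volume.restrict Ω)).toReal
  let d := fun j => (eLpNorm (pderiv3 j u) 2 (volume.restrict Ω)).toReal
  have hd0 : ∀ j, 0 ≤ d j := fun j => ENNReal.toReal_nonneg
  have ha0 : 0 ≤ a := ENNReal.toReal_nonneg
  have hfin : eLpNorm u 2 (volume.restrict Ω) +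
      ∑ j, eLpNorm (pderiv3 j u) 2 (volume.restrict Ω) ≠ ⊤ := by
    refine ENNReal.add_ne_top.2 ⟨hm0.2.ne, ?_⟩
    exact (ENNReal.sum_lt_top.2 fun j _ => (hmj j).2).ne
  rw [← ENNReal.ofReal_toReal hms.2.ne, ← ENNReal.ofReal_toReal hfin,
    ← ENNReal.ofReal_mul (Real.sqrt_nonneg _)]
  refine ENNReal.ofReal_le_ofReal ?_
  rw [ENNReal.toReal_add hm0.2.ne (ENNReal.sum_lt_top.2 fun j _ => (hmj j).2).ne,
    ENNReal.toReal_sum fun j _ => (hmj j).2.ne]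
  change _ ≤ √C * (a + ∑ j, d j)
  have hsum := add_sum_sq_le_sq_add_sum ha0 hd0
  refine le_of_sq_le_sq ?_ (mul_nonneg (Real.sqrt_nonneg _)
    (add_nonneg ha0 (Finset.sum_nonneg fun j _ => hd0 j)))
  rw [mul_pow, Real.sq_sqrt hC0]
  exact h.trans (mul_le_mul_of_nonneg_left hsum hC0)

theorem MemH1.hasWeakPartial {Ω : Set E3} {w : E3 → ℂ} (hw : MemH1 Ω w) (j : Fin 3) :
    MemL2 Ω (weakPartial Ω j w) ∧ HasWeakPartial Ω j w (weakPartial Ω j w) := by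
  have h := hw.2 j
  rw [weakPartial, dif_pos h]
  exact h.choose_spec

theorem pderiv3_sub {F : Type*} [NormedAddCommGroup F] [NormedSpace ℝ F] {f g : E3 → F}
    (hf : Differentiable ℝ f) (hg : Differentiable ℝ g) (j : Fin 3) :
    pderiv3 j (f - g) = pderiv3 j f - pderiv3 j g := by
  ext x
  simp only [pderiv3, Pi.sub_apply]
  rw [fderiv_sub (hf x) (hg x)]
  rfl

/-- Every function in `H¹(Ω)` has a trace. -/
theorem exists_isTrace {Ω : Set E3} (hΩ : IsOpen Ω) (hb : Bornology.IsBounded Ω)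
    (hs : HasSmoothBoundary Ω) {w : E3 → ℂ} (hw : MemH1 Ω w) : ∃ g, IsTrace Ω w g := by
  obtain ⟨u, hu, hu0, huj⟩ := exists_smooth_approx hΩ hb hs hw.1 (fun j => (hw.hasWeakPartial j).1)
    (fun j => (hw.hasWeakPartial j).2)
  obtain ⟨C, hCtop, hC⟩ := exists_eLpNorm_surfaceMeasure_le hΩ hb hs
  have hms : ∀ k, MemLp (u k) 2 (surfaceMeasure Ω) := fun k =>
    memLp_surfaceMeasure_of_continuousOn hb hs (hu k).continuous.continuousOn
  have hdiff : ∀ k, Differentiable ℝ (u k) := fun k => (hu k).differentiable (by simp)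
  have hcauchy : ∀ (f : ℕ → E3 → ℂ) (g : E3 → ℂ), (∀ k, MemLp (f k) 2 (volume.restrict Ω)) →
      MemLp g 2 (volume.restrict Ω) →
      Tendsto (fun k => eLpNorm (f k - g) 2 (volume.restrict Ω)) atTop (𝓝 0) →
      Tendsto (fun p : ℕ × ℕ => eLpNorm (f p.1 - f p.2) 2 (volume.restrict Ω)) atTop (𝓝 0) := by
    intro f g hf hg h
    have h1 : Tendsto (fun p : ℕ × ℕ => eLpNorm (f p.1 - g) 2 (volume.restrict Ω) +
        eLpNorm (f p.2 - g) 2 (volume.restrict Ω)) atTop (𝓝 (0 + 0)) :=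
      by
        rw [← prod_atTop_atTop_eq]
        exact (h.comp tendsto_fst).add (h.comp tendsto_snd)
    rw [add_zero] at h1
    refine tendsto_of_tendsto_of_tendsto_of_le_of_le tendsto_const_nhds h1 (fun _ => zero_le)
      fun p => ?_
    have : f p.1 - f p.2 = (f p.1 - g) - (f p.2 - g) := by abel
    rw [this]
    exact eLpNorm_sub_le ((hf _).sub hg).1 ((hf _).sub hg).1 (by norm_num)
  -- The trace inequality applied to differences of approximants makes their boundary values Cauchy
  -- in L²(∂Ω); the limit is the trace.
  have hlim : Tendsto (fun p : ℕ × ℕ => eLpNorm (u p.1 - u p.2) 2 (surfaceMeasure Ω)) atTop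
      (𝓝 0) := by
    have h0 := hcauchy u w (fun k => memLp_of_continuous hΩ hb (hu k).continuous) hw.1 hu0
    have hj := fun j => hcauchy (fun k => pderiv3 j (u k)) (weakPartial Ω j w)
      (fun k => memLp_of_continuous hΩ hb (continuous_pderiv3 ((hu k).of_le (by simp)) j))
      (hw.hasWeakPartial j).1 (huj j)
    have h1 := ENNReal.Tendsto.const_mul (a := C) (h0.add (tendsto_finsetSum Finset.univ
      fun j _ => hj j)) (Or.inr hCtop)
    simp only [Finset.sum_const_zero, add_zero, mul_zero] at h1
    refine tendsto_of_tendsto_of_tendsto_of_le_of_le tendsto_const_nhds h1 (fun _ => zero_le)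
      fun p => ?_
    refine (hC (u p.1 - u p.2) (((hu p.1).sub (hu p.2)).of_le (by simp))).trans (le_of_eq ?_)
    simp_rw [pderiv3_sub (hdiff _) (hdiff _)]
  have hcs : CauchySeq fun k => (hms k).toLp (u k) := by
    rw [Lp.cauchySeq_Lp_iff_cauchySeq_eLpNorm]
    refine hlim.congr fun p => eLpNorm_congr_ae ?_
    exact ((hms p.1).coeFn_toLp.sub (hms p.2).coeFn_toLp).symm
  obtain ⟨g, hg⟩ := cauchySeq_tendsto_of_complete hcs
  refine ⟨g, hw, Lp.memLp g, u, hu, hu0, huj, ?_⟩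
  have := (Lp.tendsto_Lp_iff_tendsto_eLpNorm'' _ hms g (Lp.memLp g)).1
    (by rwa [Lp.toLp_coeFn])
  exact this

theorem isTrace_boundaryTrace {Ω : Set E3} (hΩ : IsOpen Ω) (hb : Bornology.IsBounded Ω)
    (hs : HasSmoothBoundary Ω) {w : E3 → ℂ} (hw : MemH1 Ω w) :
    IsTrace Ω w (boundaryTrace Ω w) := by
  have h := exists_isTrace hΩ hb hs hw
  rw [boundaryTrace, dif_pos h]
  exact h.choose_spec

theorem pderiv3_comm {ψ : E3 → ℝ} (hψ : ContDiff ℝ ∞ ψ) (i j : Fin 3) :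
    pderiv3 i (pderiv3 j ψ) = pderiv3 j (pderiv3 i ψ) := by
  ext x
  have hsy : IsSymmSndFDerivAt ℝ ψ x := (hψ.contDiffAt (x := x)).isSymmSndFDerivAt
    (by rw [minSmoothness_of_isRCLikeNormedField]; exact WithTop.coe_le_coe.2 (le_top : (2 : ℕ∞) ≤ ⊤))
  have hd : DifferentiableAt ℝ (fderiv ℝ ψ) x :=
    (hψ.fderiv_right (m := ∞) (by simp)).differentiable (by simp) x
  have hc : ∀ a b : E3, fderiv ℝ (fun y => fderiv ℝ ψ y a) x b = fderiv ℝ (fderiv ℝ ψ) x b a := by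
    intro a b
    rw [(hd.hasFDerivAt.clm_apply (hasFDerivAt_const a x)).fderiv]
    simp
  change fderiv ℝ (fun y => fderiv ℝ ψ y _) x _ = fderiv ℝ (fun y => fderiv ℝ ψ y _) x _
  rw [hc, hc]
  exact hsy _ _

/-- Mixed weak second derivatives agree. -/
theorem weakPartial_comm_ae {Ω : Set E3} (hΩ : IsOpen Ω) (hb : Bornology.IsBounded Ω) {w : E3 → ℂ}
    (hw : MemH2 Ω w) (i j : Fin 3) :
    ∀ᵐ x ∂(volume.restrict Ω), weakPartial Ω i (weakPartial Ω j w) x =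
      weakPartial Ω j (weakPartial Ω i w) x := by
  have hfin := isFiniteMeasure_restrict_of_isBounded hb
  -- Both derivatives are moved to the test function, where they commute.
  have hkey : ∀ (i j : Fin 3) (ψ : E3 → ℝ), ContDiff ℝ ∞ ψ → HasCompactSupport ψ →
      tsupport ψ ⊆ Ω → ∫ x in Ω, ψ x • weakPartial Ω i (weakPartial Ω j w) x =
        ∫ x in Ω, pderiv3 j (pderiv3 i ψ) x • w x := by
    intro i j ψ h1 h2 h3
    have hs : tsupport (pderiv3 i ψ) ⊆ tsupport ψ := tsupport_fderiv_apply_subset ℝ _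
    have e1 := ((hw.2 j).hasWeakPartial i).2 ψ h1 h2 h3
    have e2 := (hw.1.hasWeakPartial j).2 (pderiv3 i ψ) (contDiff_pderiv3 h1 i)
      (h2.fderiv_apply ℝ _) (hs.trans h3)
    rw [e2, e1, neg_neg]
  have hi1 := ((hw.2 j).hasWeakPartial i).1.integrable (by norm_num)
  have hi2 := ((hw.2 i).hasWeakPartial j).1.integrable (by norm_num)
  rw [ae_restrict_iff' hΩ.measurableSet]
  have := hΩ.ae_eq_zero_of_integral_contDiff_smul_eq_zero (μ := volume)
    (f := fun x => weakPartial Ω i (weakPartial Ω j w) x - weakPartial Ω j (weakPartial Ω i w) x)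
    (IntegrableOn.locallyIntegrableOn (hi1.sub hi2)) ?_
  · filter_upwards [this] with x hx hxΩ using sub_eq_zero.1 (hx hxΩ)
  · intro ψ h1 h2 h3
    rw [← setIntegral_eq_integral_of_forall_compl_eq_zero (s := Ω)]
    · simp_rw [smul_sub]
      rw [integral_sub (integrable_smul_of_continuous hΩ hb h1.continuous
          ((hw.2 j).hasWeakPartial i).1) (integrable_smul_of_continuous hΩ hb h1.continuous
          ((hw.2 i).hasWeakPartial j).1), hkey i j ψ h1 h2 h3, hkey j i ψ h1 h2 h3, pderiv3_comm h1 j i,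
        sub_self]
    · intro x hx
      have : ψ x = 0 := by
        by_contra h
        exact hx (h3 (subset_tsupport _ h))
      simp [this]

end Trace

/-! ### Integration by parts for real Sobolev functions with traces. -/

section H1Calculus

open Set
open scoped ENNReal

/-- `u ∈ H¹(Ω)` is real valued, with weak partial derivatives `du` and trace `g`. -/
structure IsH1Trace (Ω : Set E3) (u : E3 → ℝ) (du : Fin 3 → E3 → ℝ) (g : E3 → ℝ) : Prop where
  memLp : MemLp u 2 (volume.restrict Ω)
  memLp_partial : ∀ j, MemLp (du j) 2 (volume.restrict Ω)
  memLp_trace : MemLp g 2 (surfaceMeasure Ω)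
  exists_approx : ∃ a : ℕ → E3 → ℝ, (∀ k, ContDiff ℝ ∞ (a k)) ∧
    Tendsto (fun k => eLpNorm (a k - u) 2 (volume.restrict Ω)) atTop (𝓝 0) ∧
    (∀ j, Tendsto (fun k => eLpNorm (pderiv3 j (a k) - du j) 2 (volume.restrict Ω)) atTop (𝓝 0)) ∧
    Tendsto (fun k => eLpNorm (a k - g) 2 (surfaceMeasure Ω)) atTop (𝓝 0)

/-- A real linear functional can be applied to the approximating sequence itself. It will be the
real or the imaginary part, which reduces complex functions to real ones. -/
theorem IsTrace.isH1Trace_comp {Ω : Set E3} {w g : E3 → ℂ} (h : IsTrace Ω w g) (L : ℂ →L[ℝ] ℝ) :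
    IsH1Trace Ω (fun x => L (w x)) (fun j x => L (weakPartial Ω j w x)) (fun x => L (g x)) := by
  obtain ⟨hw, hg, u, hu, hu0, huj, hug⟩ := h
  have hL : ∀ (μ : Measure E3) (f : ℕ → E3 → ℂ) (f₀ : E3 → ℂ),
      Tendsto (fun k => eLpNorm (f k - f₀) 2 μ) atTop (𝓝 0) →
      Tendsto (fun k => eLpNorm ((fun x => L (f k x)) - fun x => L (f₀ x)) 2 μ) atTop (𝓝 0) := by
    intro μ f f₀ hf
    have h1 := ENNReal.Tendsto.const_mul (a := ENNReal.ofReal ‖L‖) hf (Or.inr (by simp))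
    rw [mul_zero] at h1
    refine tendsto_of_tendsto_of_tendsto_of_le_of_le tendsto_const_nhds h1 (fun _ => zero_le)
      fun k => eLpNorm_le_mul_eLpNorm_of_ae_le_mul (Eventually.of_forall fun x => ?_) 2
    simp only [Pi.sub_apply, ← map_sub]
    exact L.le_opNorm _
  refine ⟨L.comp_memLp' hw.1, fun j => L.comp_memLp' (hw.hasWeakPartial j).1, L.comp_memLp' hg,
    fun k x => L (u k x), fun k => L.contDiff.comp (hu k), hL _ _ _ hu0, fun j => ?_, hL _ _ _ hug⟩
  refine (hL _ _ _ (huj j)).congr fun k => ?_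
  congr 2
  ext x
  have h2 : HasFDerivAt (fun x => L (u k x)) (L.comp (fderiv ℝ (u k) x)) x :=
    L.hasFDerivAt.comp x (((hu k).differentiable (by simp)) x).hasFDerivAt
  simp [pderiv3, h2.fderiv]

theorem isH1Trace_of_contDiff {Ω : Set E3} (hΩ : IsOpen Ω) (hb : Bornology.IsBounded Ω)
    (hs : HasSmoothBoundary Ω) {ψ : E3 → ℝ} (hψ : ContDiff ℝ ∞ ψ) :
    IsH1Trace Ω ψ (fun j => pderiv3 j ψ) ψ :=
  ⟨memLp_of_continuous hΩ hb hψ.continuous,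
    fun j => memLp_of_continuous hΩ hb (contDiff_pderiv3 hψ j).continuous,
    memLp_surfaceMeasure_of_continuousOn hb hs hψ.continuous.continuousOn,
    fun _ => ψ, fun _ => hψ, by simp, by simp, by simp⟩

theorem tendsto_eLpNorm_add_sub {α : Type*} [MeasurableSpace α] {μ : Measure α}
    {f g : ℕ → α → ℝ} {f₀ g₀ : α → ℝ} (hfm : ∀ k, AEStronglyMeasurable (f k - f₀) μ)
    (hgm : ∀ k, AEStronglyMeasurable (g k - g₀) μ)
    (hf : Tendsto (fun k => eLpNorm (f k - f₀) 2 μ) atTop (𝓝 0))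
    (hg : Tendsto (fun k => eLpNorm (g k - g₀) 2 μ) atTop (𝓝 0)) :
    Tendsto (fun k => eLpNorm ((fun x => f k x + g k x) - fun x => f₀ x + g₀ x) 2 μ)
      atTop (𝓝 0) := by
  have h := hf.add hg
  rw [add_zero] at h
  refine tendsto_of_tendsto_of_tendsto_of_le_of_le tendsto_const_nhds h (fun _ => zero_le) fun k => ?_
  refine le_trans (le_of_eq ?_) (eLpNorm_add_le (hfm k) (hgm k) (by norm_num))
  congr 1
  ext x
  simp
  ring

theorem tendsto_eLpNorm_mul_sub {α : Type*} [MeasurableSpace α] [TopologicalSpace α]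
    {μ : Measure α} {K : Set α} (hK : IsCompact K) (hμ : ∀ᵐ x ∂μ, x ∈ K) {m : α → ℝ}
    (hm : ContinuousOn m K) {f : ℕ → α → ℝ} {f₀ : α → ℝ}
    (hf : Tendsto (fun k => eLpNorm (f k - f₀) 2 μ) atTop (𝓝 0)) :
    Tendsto (fun k => eLpNorm ((fun x => m x * f k x) - fun x => m x * f₀ x) 2 μ) atTop (𝓝 0) := by
  obtain ⟨C, -, hC⟩ := exists_eLpNorm_smul_le (E := ℝ) hK hμ hm
  have h := ENNReal.Tendsto.const_mul (a := ENNReal.ofReal C) hf (Or.inr (by simp))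
  rw [mul_zero] at h
  refine tendsto_of_tendsto_of_tendsto_of_le_of_le tendsto_const_nhds h (fun _ => zero_le) fun k => ?_
  refine le_trans (le_of_eq ?_) (hC (f k - f₀))
  congr 1
  ext x
  simp
  ring

theorem IsH1Trace.add {Ω : Set E3} {u v : E3 → ℝ} {du dv : Fin 3 → E3 → ℝ} {g k : E3 → ℝ}
    (hu : IsH1Trace Ω u du g) (hv : IsH1Trace Ω v dv k) :
    IsH1Trace Ω (fun x => u x + v x) (fun j x => du j x + dv j x) (fun x => g x + k x) := by
  obtain ⟨a, ha, ha0, haj, hag⟩ := hu.exists_approx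
  obtain ⟨b, hb, hb0, hbj, hbg⟩ := hv.exists_approx
  refine ⟨hu.memLp.add hv.memLp, fun j => (hu.memLp_partial j).add (hv.memLp_partial j),
    hu.memLp_trace.add hv.memLp_trace, fun n x => a n x + b n x, fun n => (ha n).add (hb n),
    tendsto_eLpNorm_add_sub (fun n => (ha n).continuous.aestronglyMeasurable.sub hu.memLp.1)
      (fun n => (hb n).continuous.aestronglyMeasurable.sub hv.memLp.1) ha0 hb0, fun j => ?_,
    tendsto_eLpNorm_add_sub (fun n => (ha n).continuous.aestronglyMeasurable.sub hu.memLp_trace.1)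
      (fun n => (hb n).continuous.aestronglyMeasurable.sub hv.memLp_trace.1) hag hbg⟩
  refine (tendsto_eLpNorm_add_sub (fun n => ?_) (fun n => ?_) (haj j) (hbj j)).congr fun n => ?_
  · exact (contDiff_pderiv3 (ha n) j).continuous.aestronglyMeasurable.sub (hu.memLp_partial j).1
  · exact (contDiff_pderiv3 (hb n) j).continuous.aestronglyMeasurable.sub (hv.memLp_partial j).1
  · congr 2
    ext x
    simp only [pderiv3]
    rw [fderiv_fun_add ((ha n).differentiable (by simp) x) ((hb n).differentiable (by simp) x)]
    rfl

theorem IsH1Trace.mul {Ω : Set E3} (hΩ : IsOpen Ω) (hb : Bornology.IsBounded Ω)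
    {u : E3 → ℝ} {du : Fin 3 → E3 → ℝ} {g : E3 → ℝ} (hu : IsH1Trace Ω u du g) {m : E3 → ℝ}
    (hm : ContDiff ℝ ∞ m) :
    IsH1Trace Ω (fun x => m x * u x) (fun j x => m x * du j x + pderiv3 j m x * u x)
      (fun x => m x * g x) := by
  obtain ⟨a, ha, ha0, haj, hag⟩ := hu.exists_approx
  have hmj := fun j => (contDiff_pderiv3 hm j).continuous
  have h1 : ∀ {c f : E3 → ℝ}, Continuous c → MemLp f 2 (volume.restrict Ω) →
      MemLp (fun x => c x * f x) 2 (volume.restrict Ω) := fun hc hf =>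
    memLp_smul_of_continuous hΩ hb hc hf
  have hK := hb.isCompact_closure
  have hμ := ae_mem_closure_restrict hΩ
  have hF := isCompact_frontier_of_isBounded hb
  have hσ := ae_mem_frontier_surfaceMeasure Ω
  have hcm : ∀ n, Continuous (a n) := fun n => (ha n).continuous
  refine ⟨h1 hm.continuous hu.memLp,
    fun j => (h1 hm.continuous (hu.memLp_partial j)).add (h1 (hmj j) hu.memLp),
    memLp_smul_of_continuousOn hF hσ hm.continuous.continuousOn hm.continuous.aestronglyMeasurable
      hu.memLp_trace, fun n x => m x * a n x, fun n => hm.mul (ha n),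
    tendsto_eLpNorm_mul_sub hK hμ hm.continuous.continuousOn ha0, fun j => ?_,
    tendsto_eLpNorm_mul_sub hF hσ hm.continuous.continuousOn hag⟩
  refine (tendsto_eLpNorm_add_sub (fun n => ?_) (fun n => ?_)
    (tendsto_eLpNorm_mul_sub hK hμ hm.continuous.continuousOn (haj j))
    (tendsto_eLpNorm_mul_sub hK hμ (hmj j).continuousOn ha0)).congr fun n => ?_
  · exact (hm.continuous.mul (contDiff_pderiv3 (ha n) j).continuous).aestronglyMeasurable.sub
      (h1 hm.continuous (hu.memLp_partial j)).1
  · exact ((hmj j).mul (hcm n)).aestronglyMeasurable.sub (h1 (hmj j) hu.memLp).1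
  · congr 2
    ext x
    rw [pderiv3_mul (hm.differentiable (by simp) x) ((ha n).differentiable (by simp) x)]
    ring

/-- The integral is the L² inner product, which is jointly continuous. -/
theorem tendsto_integral_mul_of_eLpNorm {α : Type*} [MeasurableSpace α] {μ : Measure α}
    {f g : ℕ → α → ℝ} {f₀ g₀ : α → ℝ} (hf : ∀ k, MemLp (f k) 2 μ) (hg : ∀ k, MemLp (g k) 2 μ)
    (hf₀ : MemLp f₀ 2 μ) (hg₀ : MemLp g₀ 2 μ)
    (hft : Tendsto (fun k => eLpNorm (f k - f₀) 2 μ) atTop (𝓝 0))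
    (hgt : Tendsto (fun k => eLpNorm (g k - g₀) 2 μ) atTop (𝓝 0)) :
    Tendsto (fun k => ∫ x, f k x * g k x ∂μ) atTop (𝓝 (∫ x, f₀ x * g₀ x ∂μ)) := by
  have h1 := (Lp.tendsto_Lp_iff_tendsto_eLpNorm'' f hf f₀ hf₀).2 hft
  have h2 := (Lp.tendsto_Lp_iff_tendsto_eLpNorm'' g hg g₀ hg₀).2 hgt
  have hin : ∀ {a b : α → ℝ} (ha : MemLp a 2 μ) (hb : MemLp b 2 μ),
      inner ℝ (ha.toLp a) (hb.toLp b) = ∫ x, a x * b x ∂μ := by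
    intro a b ha hb
    rw [L2.inner_def]
    refine integral_congr_ae ?_
    filter_upwards [ha.coeFn_toLp, hb.coeFn_toLp] with x h3 h4
    rw [h3, h4]
    simp [mul_comm]
  have h3 := h1.inner (𝕜 := ℝ) h2
  rw [hin] at h3
  exact h3.congr fun k => hin (hf k) (hg k)

/-- Integration by parts for Sobolev functions. -/
theorem IsH1Trace.setIntegral_mul {Ω : Set E3} (hΩ : IsOpen Ω) (hb : Bornology.IsBounded Ω)
    (hs : HasSmoothBoundary Ω) {u v : E3 → ℝ} {du dv : Fin 3 → E3 → ℝ} {g k : E3 → ℝ}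
    (hu : IsH1Trace Ω u du g) (hv : IsH1Trace Ω v dv k) (j : Fin 3) :
    ∫ x in Ω, (du j x * v x + u x * dv j x) =
      ∫ x, g x * k x * outerNormal Ω x j ∂(surfaceMeasure Ω) := by
  obtain ⟨a, ha, ha0, haj, hag⟩ := hu.exists_approx
  obtain ⟨b, hb', hb0, hbj, hbg⟩ := hv.exists_approx
  have hcont : ∀ {f : E3 → ℝ}, ContDiff ℝ ∞ f → MemLp f 2 (volume.restrict Ω) := fun hf =>
    memLp_of_continuous hΩ hb hf.continuous
  have hνj : ContinuousOn (fun x => outerNormal Ω x j) (frontier Ω) :=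
    (EuclideanSpace.proj (𝕜 := ℝ) j).continuous.comp_continuousOn (continuousOn_outerNormal hΩ hs)
  have hF := isCompact_frontier_of_isBounded hb
  have hσ := ae_mem_frontier_surfaceMeasure Ω
  have hνm := aestronglyMeasurable_surfaceMeasure_of_continuousOn hνj
  have hbs : ∀ {f : E3 → ℝ}, ContDiff ℝ ∞ f → MemLp f 2 (surfaceMeasure Ω) := fun hf =>
    memLp_surfaceMeasure_of_continuousOn hb hs hf.continuous.continuousOn
  have hνL : ∀ {f : E3 → ℝ}, MemLp f 2 (surfaceMeasure Ω) →
      MemLp (fun x => outerNormal Ω x j * f x) 2 (surfaceMeasure Ω) := fun hf =>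
    memLp_smul_of_continuousOn hF hσ hνj hνm hf
  have t1 := tendsto_integral_mul_of_eLpNorm (fun n => hcont (contDiff_pderiv3 (ha n) j))
    (fun n => hcont (hb' n)) (hu.memLp_partial j) hv.memLp (haj j) hb0
  have t2 := tendsto_integral_mul_of_eLpNorm (fun n => hcont (ha n))
    (fun n => hcont (contDiff_pderiv3 (hb' n) j)) hu.memLp (hv.memLp_partial j) ha0 (hbj j)
  have t3 := tendsto_integral_mul_of_eLpNorm (fun n => hbs (ha n)) (fun n => hνL (hbs (hb' n)))
    hu.memLp_trace (hνL hv.memLp_trace) hag (tendsto_eLpNorm_mul_sub hF hσ hνj hbg)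
  have hi : ∀ {f g : E3 → ℝ}, MemLp f 2 (volume.restrict Ω) → MemLp g 2 (volume.restrict Ω) →
      Integrable (fun x => f x * g x) (volume.restrict Ω) := fun hf hg => hf.integrable_mul hg
  rw [integral_add (hi (hu.memLp_partial j) hv.memLp) (hi hu.memLp (hv.memLp_partial j))]
  have hR : ∫ x, g x * k x * outerNormal Ω x j ∂(surfaceMeasure Ω) =
      ∫ x, g x * (outerNormal Ω x j * k x) ∂(surfaceMeasure Ω) :=
    integral_congr_ae (Eventually.of_forall fun x => by simp only; ring)
  rw [hR]
  -- The divergence theorem holds for the products of smooth approximants, and both sides converge.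
  refine tendsto_nhds_unique (t1.add t2) (t3.congr fun n => ?_)
  rw [← integral_add (hi (hcont (contDiff_pderiv3 (ha n) j)) (hcont (hb' n)))
    (hi (hcont (ha n)) (hcont (contDiff_pderiv3 (hb' n) j)))]
  have hdiv := setIntegral_pderiv3 hΩ hb hs (((ha n).mul (hb' n)).of_le (by simp)) j
  have hL : ∀ x, pderiv3 j (fun x => a n x * b n x) x =
      pderiv3 j (a n) x * b n x + a n x * pderiv3 j (b n) x := fun x => by
    rw [pderiv3_mul ((ha n).differentiable (by simp) x) ((hb' n).differentiable (by simp) x)]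
    ring
  simp_rw [hL] at hdiv
  rw [hdiv]
  exact integral_congr_ae (Eventually.of_forall fun x => by simp only; ring)

theorem IsH1Trace.setIntegral_mul_of_trace_zero {Ω : Set E3} (hΩ : IsOpen Ω)
    (hb : Bornology.IsBounded Ω)
    (hs : HasSmoothBoundary Ω) {u v : E3 → ℝ} {du dv : Fin 3 → E3 → ℝ} {k : E3 → ℝ}
    (hu : IsH1Trace Ω u du 0) (hv : IsH1Trace Ω v dv k) (j : Fin 3) :
    ∫ x in Ω, (du j x * v x + u x * dv j x) = 0 := by
  rw [hu.setIntegral_mul hΩ hb hs hv j]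
  simp

theorem IsH1Trace.mul_trace_zero {Ω : Set E3} (hΩ : IsOpen Ω) (hb : Bornology.IsBounded Ω)
    {u : E3 → ℝ} {du : Fin 3 → E3 → ℝ} (hu : IsH1Trace Ω u du 0) {m : E3 → ℝ}
    (hm : ContDiff ℝ ∞ m) :
    IsH1Trace Ω (fun x => m x * u x) (fun j x => m x * du j x + pderiv3 j m x * u x) 0 := by
  have h := hu.mul hΩ hb hm
  simp only [Pi.zero_apply, mul_zero] at h
  exact h

/-- The gradient of a function with zero trace is normal to the boundary. -/
theorem trace_partial_eq_normal_mul {Ω : Set E3} (hΩ : IsOpen Ω) (hb : Bornology.IsBounded Ω)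
    (hs : HasSmoothBoundary Ω) {u : E3 → ℝ} {du : Fin 3 → E3 → ℝ} {ddu : Fin 3 → Fin 3 → E3 → ℝ}
    {T : Fin 3 → E3 → ℝ} (hu : IsH1Trace Ω u du 0) (hdu : ∀ j, IsH1Trace Ω (du j) (ddu j) (T j))
    (hsymm : ∀ i j, ∀ᵐ x ∂(volume.restrict Ω), ddu i j x = ddu j i x) :
    ∀ᵐ x ∂(surfaceMeasure Ω), ∀ j, T j x = outerNormal Ω x j * ∑ i, outerNormal Ω x i * T i x := by
  have hfin := isFiniteMeasure_surfaceMeasure hb hs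
  have hνj : ∀ j, ContinuousOn (fun x => outerNormal Ω x j) (frontier Ω) := fun j =>
    (EuclideanSpace.proj (𝕜 := ℝ) j).continuous.comp_continuousOn (continuousOn_outerNormal hΩ hs)
  have hF := isCompact_frontier_of_isBounded hb
  have hσ := ae_mem_frontier_surfaceMeasure Ω
  have hνT : ∀ i j, MemLp (fun x => outerNormal Ω x i * T j x) 2 (surfaceMeasure Ω) := fun i j =>
    memLp_smul_of_continuousOn hF hσ (hνj i)
      (aestronglyMeasurable_surfaceMeasure_of_continuousOn (hνj i)) (hdu j).memLp_trace
  have hint : ∀ {f g : E3 → ℝ}, MemLp f 2 (volume.restrict Ω) → MemLp g 2 (volume.restrict Ω) →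
      Integrable (fun x => f x * g x) (volume.restrict Ω) := fun hf hg => hf.integrable_mul hg
  -- Tested against a smooth ψ, the boundary expression equals ∫ (∂_iψ ∂_ju - ∂_jψ ∂_iu) over Ω,
  -- since the second derivatives of u cancel. As u has zero trace, another integration by parts
  -- leaves the antisymmetrized second derivatives of ψ, which vanish.
  have hcross : ∀ i j, ∀ᵐ x ∂(surfaceMeasure Ω),
      outerNormal Ω x i * T j x - outerNormal Ω x j * T i x = 0 := by
    intro i j
    refine ae_eq_zero_of_integral_contDiff_smul_eq_zero
      (((hνT i j).sub (hνT j i)).integrable (by norm_num)).locallyIntegrable fun ψ hψ _ => ?_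
    have hψH := isH1Trace_of_contDiff hΩ hb hs hψ
    have hcL : ∀ {f : E3 → ℝ}, ContDiff ℝ ∞ f → MemLp f 2 (volume.restrict Ω) := fun hf =>
      memLp_of_continuous hΩ hb hf.continuous
    have e1 := hψH.setIntegral_mul hΩ hb hs (hdu j) i
    have e2 := hψH.setIntegral_mul hΩ hb hs (hdu i) j
    have e3 := hu.setIntegral_mul_of_trace_zero hΩ hb hs
      (isH1Trace_of_contDiff hΩ hb hs (contDiff_pderiv3 hψ i)) j
    have e4 := hu.setIntegral_mul_of_trace_zero hΩ hb hs
      (isH1Trace_of_contDiff hΩ hb hs (contDiff_pderiv3 hψ j)) i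
    have hψL : MemLp ψ 2 (surfaceMeasure Ω) := hψH.memLp_trace
    have hpd := fun l => hcL (contDiff_pderiv3 hψ l)
    have hpdd := fun l l' => hcL (contDiff_pderiv3 (contDiff_pderiv3 hψ l) l')
    rw [integral_add (hint (hpd i) (hdu j).memLp) (hint hψH.memLp ((hdu j).memLp_partial i))] at e1
    rw [integral_add (hint (hpd j) (hdu i).memLp) (hint hψH.memLp ((hdu i).memLp_partial j))] at e2
    rw [integral_add (hint (hu.memLp_partial j) (hpd i)) (hint hu.memLp (hpdd i j))] at e3
    rw [integral_add (hint (hu.memLp_partial i) (hpd j)) (hint hu.memLp (hpdd j i)),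
      pderiv3_comm hψ i j] at e4
    have e5 : ∫ x in Ω, ψ x * ddu j i x = ∫ x in Ω, ψ x * ddu i j x := by
      refine integral_congr_ae ?_
      filter_upwards [hsymm i j] with x hx
      rw [hx]
    have c1 : ∫ x in Ω, du j x * pderiv3 i ψ x = ∫ x in Ω, pderiv3 i ψ x * du j x :=
      integral_congr_ae (Eventually.of_forall fun x => mul_comm _ _)
    have c2 : ∫ x in Ω, du i x * pderiv3 j ψ x = ∫ x in Ω, pderiv3 j ψ x * du i x :=
      integral_congr_ae (Eventually.of_forall fun x => mul_comm _ _)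
    have hsplit : ∫ x, ψ x • (outerNormal Ω x i * T j x - outerNormal Ω x j * T i x)
        ∂(surfaceMeasure Ω) = ∫ x, ψ x * T j x * outerNormal Ω x i ∂(surfaceMeasure Ω) -
          ∫ x, ψ x * T i x * outerNormal Ω x j ∂(surfaceMeasure Ω) := by
      rw [← integral_sub]
      · exact integral_congr_ae (Eventually.of_forall fun x => by simp only [smul_eq_mul]; ring)
      · refine (hψL.integrable_mul (hνT i j)).congr (Eventually.of_forall fun x => ?_)
        simp only [Pi.mul_apply]
        ring
      · refine (hψL.integrable_mul (hνT j i)).congr (Eventually.of_forall fun x => ?_)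
        simp only [Pi.mul_apply]
        ring
    rw [hsplit]
    linarith
  have hall : ∀ᵐ x ∂(surfaceMeasure Ω), ∀ i j,
      outerNormal Ω x i * T j x - outerNormal Ω x j * T i x = 0 :=
    ae_all_iff.2 fun i => ae_all_iff.2 fun j => hcross i j
  filter_upwards [hall, hσ] with x hx hxf j
  have hn : ∑ i, outerNormal Ω x i ^ 2 = 1 := by
    rw [← norm_sq_eq_sum_E3, norm_outerNormal hs hxf, one_pow]
  rw [Finset.mul_sum]
  -- Since |ν| = 1, T_j = ∑ ν_i ν_i T_j, and ν_i T_j = ν_j T_i moves the index.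
  calc T j x = (∑ i, outerNormal Ω x i ^ 2) * T j x := by rw [hn, one_mul]
    _ = _ := by
      rw [Finset.sum_mul]
      refine Finset.sum_congr rfl fun i _ => ?_
      linear_combination outerNormal Ω x i * hx i j

end H1Calculus

/-! ### Energy identities for H² functions with zero trace. -/

section EnergyIdentities

open Set

/-- `w ∈ H²(Ω)` is real valued with zero trace; `w1` and `w2` are its first and second weak partial
derivatives, `w2 j i = ∂_i ∂_j w`, and `T j` is the trace of `∂_j w`. -/
structure IsH2Zero (Ω : Set E3) (w : E3 → ℝ) (w1 : Fin 3 → E3 → ℝ) (w2 : Fin 3 → Fin 3 → E3 → ℝ)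
    (T : Fin 3 → E3 → ℝ) : Prop where
  isH1Trace : IsH1Trace Ω w w1 0
  isH1Trace_partial : ∀ j, IsH1Trace Ω (w1 j) (w2 j) (T j)
  symm : ∀ i j, ∀ᵐ x ∂(volume.restrict Ω), w2 i j x = w2 j i x

variable {Ω : Set E3} {w : E3 → ℝ} {w1 : Fin 3 → E3 → ℝ} {w2 : Fin 3 → Fin 3 → E3 → ℝ}
  {T : Fin 3 → E3 → ℝ}

/-- This serves for w = e^{ψ/h}v. The term of ∂_j(m w) in which m is differentiated has zero trace,
so on the boundary only m·T_j survives. -/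
theorem IsH2Zero.mul (hΩ : IsOpen Ω) (hb : Bornology.IsBounded Ω) (h : IsH2Zero Ω w w1 w2 T)
    {m : E3 → ℝ} (hm : ContDiff ℝ ∞ m) :
    IsH2Zero Ω (fun x => m x * w x) (fun j x => m x * w1 j x + pderiv3 j m x * w x)
      (fun j i x => (m x * w2 j i x + pderiv3 i m x * w1 j x) +
        (pderiv3 j m x * w1 i x + pderiv3 i (pderiv3 j m) x * w x))
      (fun j x => m x * T j x) := by
  refine ⟨h.isH1Trace.mul_trace_zero hΩ hb hm, fun j => ?_, fun i j => ?_⟩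
  · have := ((h.isH1Trace_partial j).mul hΩ hb hm).add
      (h.isH1Trace.mul_trace_zero hΩ hb (contDiff_pderiv3 hm j))
    simpa using this
  · filter_upwards [h.symm i j] with x hx
    rw [hx, pderiv3_comm hm]
    ring

/-- Integrability is carried along with each identity because the identities are later added under a
single integral. -/
theorem IsH1Trace.integrable_and_setIntegral_mul (hΩ : IsOpen Ω) (hb : Bornology.IsBounded Ω)
    (hs : HasSmoothBoundary Ω) {u v : E3 → ℝ} {du dv : Fin 3 → E3 → ℝ} {g k : E3 → ℝ}
    (hu : IsH1Trace Ω u du g) (hv : IsH1Trace Ω v dv k) (j : Fin 3) :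
    IntegrableOn (fun x => du j x * v x + u x * dv j x) Ω ∧
      ∫ x in Ω, (du j x * v x + u x * dv j x) =
        ∫ x, g x * k x * outerNormal Ω x j ∂(surfaceMeasure Ω) :=
  ⟨((hu.memLp_partial j).integrable_mul hv.memLp).add
    (hu.memLp.integrable_mul (hv.memLp_partial j)), hu.setIntegral_mul hΩ hb hs hv j⟩

/-- The integrand is the divergence of m w ∇w, which has zero normal component on the boundary. -/
theorem IsH2Zero.setIntegral_mul_laplacian (hΩ : IsOpen Ω) (hb : Bornology.IsBounded Ω)
    (hs : HasSmoothBoundary Ω) (h : IsH2Zero Ω w w1 w2 T) {m : E3 → ℝ} (hm : ContDiff ℝ ∞ m) :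
    IntegrableOn (fun x => m x * w x * ∑ j, w2 j j x + m x * ∑ j, w1 j x ^ 2 +
        w x * ∑ j, pderiv3 j m x * w1 j x) Ω ∧
      ∫ x in Ω, (m x * w x * ∑ j, w2 j j x + m x * ∑ j, w1 j x ^ 2 +
        w x * ∑ j, pderiv3 j m x * w1 j x) = 0 := by
  have h1 := fun j => (h.isH1Trace.mul_trace_zero hΩ hb hm).integrable_and_setIntegral_mul hΩ hb hs
    (h.isH1Trace_partial j) j
  have h2 : (fun x => m x * w x * ∑ j, w2 j j x + m x * ∑ j, w1 j x ^ 2 +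
        w x * ∑ j, pderiv3 j m x * w1 j x) = fun x => ∑ j,
        ((m x * w1 j x + pderiv3 j m x * w x) * w1 j x + m x * w x * w2 j j x) := by
    ext x
    simp only [Fin.sum_univ_three]
    ring
  rw [h2]
  refine ⟨integrable_finsetSum _ fun j _ => (h1 j).1, ?_⟩
  rw [integral_finsetSum _ fun j _ => (h1 j).1]
  exact Finset.sum_eq_zero fun j _ => by rw [(h1 j).2]; simp

/-- The integrand is the divergence of w²X, and w vanishes on the boundary. -/
theorem IsH2Zero.setIntegral_mul_vectorField (hΩ : IsOpen Ω) (hb : Bornology.IsBounded Ω)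
    (hs : HasSmoothBoundary Ω) (h : IsH2Zero Ω w w1 w2 T) {X : Fin 3 → E3 → ℝ}
    (hX : ∀ j, ContDiff ℝ ∞ (X j)) :
    IntegrableOn (fun x => 2 * w x * ∑ j, X j x * w1 j x +
        (∑ j, pderiv3 j (X j) x) * w x ^ 2) Ω ∧
      ∫ x in Ω, (2 * w x * ∑ j, X j x * w1 j x + (∑ j, pderiv3 j (X j) x) * w x ^ 2) = 0 := by
  have h1 := fun j => (h.isH1Trace.mul_trace_zero hΩ hb (hX j)).integrable_and_setIntegral_mul
    hΩ hb hs h.isH1Trace j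
  have h2 : (fun x => 2 * w x * ∑ j, X j x * w1 j x + (∑ j, pderiv3 j (X j) x) * w x ^ 2) =
      fun x => ∑ j, ((X j x * w1 j x + pderiv3 j (X j) x * w x) * w x + X j x * w x * w1 j x) := by
    ext x
    simp only [Fin.sum_univ_three]
    ring
  rw [h2]
  refine ⟨integrable_finsetSum _ fun j _ => (h1 j).1, ?_⟩
  rw [integral_finsetSum _ fun j _ => (h1 j).1]
  exact Finset.sum_eq_zero fun j _ => by rw [(h1 j).2]; simp

/-- The Rellich identity for functions vanishing on the boundary. -/
theorem IsH2Zero.rellich (hΩ : IsOpen Ω) (hb : Bornology.IsBounded Ω)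
    (hs : HasSmoothBoundary Ω) (h : IsH2Zero Ω w w1 w2 T) {ψ : E3 → ℝ} (hψ : ContDiff ℝ ∞ ψ) :
    IntegrableOn (fun x => 2 * (∑ i, w2 i i x) * (∑ j, pderiv3 j ψ x * w1 j x) +
        2 * (∑ i, ∑ j, pderiv3 i (pderiv3 j ψ) x * w1 i x * w1 j x) -
        (∑ j, pderiv3 j (pderiv3 j ψ) x) * ∑ i, w1 i x ^ 2) Ω ∧
      ∫ x in Ω, (2 * (∑ i, w2 i i x) * (∑ j, pderiv3 j ψ x * w1 j x) +
        2 * (∑ i, ∑ j, pderiv3 i (pderiv3 j ψ) x * w1 i x * w1 j x) -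
        (∑ j, pderiv3 j (pderiv3 j ψ) x) * ∑ i, w1 i x ^ 2) =
      ∫ x, (∑ j, pderiv3 j ψ x * outerNormal Ω x j) *
        (∑ j, outerNormal Ω x j * T j x) ^ 2 ∂(surfaceMeasure Ω) := by
  have hψj := fun j => contDiff_pderiv3 hψ j
  have h1 := fun i j => ((h.isH1Trace_partial j).mul hΩ hb (hψj j)).integrable_and_setIntegral_mul
    hΩ hb hs (h.isH1Trace_partial i) i
  have h2 := fun i j => ((h.isH1Trace_partial i).mul hΩ hb (hψj j)).integrable_and_setIntegral_mul
    hΩ hb hs (h.isH1Trace_partial i) j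
  -- The integrand is the divergence of 2(∇ψ·∇w)∇w - |∇w|²∇ψ. The terms ∂_jψ ∂_iw ∂_i∂_jw from the
  -- two fields cancel by symmetry of the second derivatives.
  have hae : (fun x => ∑ i, ∑ j, (2 * ((pderiv3 j ψ x * w2 j i x + pderiv3 i (pderiv3 j ψ) x * w1 j x)
        * w1 i x + pderiv3 j ψ x * w1 j x * w2 i i x) -
        ((pderiv3 j ψ x * w2 i j x + pderiv3 j (pderiv3 j ψ) x * w1 i x) * w1 i x +
          pderiv3 j ψ x * w1 i x * w2 i j x))) =ᵐ[volume.restrict Ω]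
      (fun x => 2 * (∑ i, w2 i i x) * (∑ j, pderiv3 j ψ x * w1 j x) +
        2 * (∑ i, ∑ j, pderiv3 i (pderiv3 j ψ) x * w1 i x * w1 j x) -
        (∑ j, pderiv3 j (pderiv3 j ψ) x) * ∑ i, w1 i x ^ 2) := by
    filter_upwards [h.symm 0 1, h.symm 0 2, h.symm 1 2] with x h01 h02 h12
    simp only [Fin.sum_univ_three, h01, h02, h12]
    ring
  have hint : ∀ i j, IntegrableOn (fun x =>
      2 * ((pderiv3 j ψ x * w2 j i x + pderiv3 i (pderiv3 j ψ) x * w1 j x)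
        * w1 i x + pderiv3 j ψ x * w1 j x * w2 i i x) -
        ((pderiv3 j ψ x * w2 i j x + pderiv3 j (pderiv3 j ψ) x * w1 i x) * w1 i x +
          pderiv3 j ψ x * w1 i x * w2 i j x)) Ω := fun i j =>
    ((h1 i j).1.const_mul 2).sub (h2 i j).1
  have hsm := ae_mem_frontier_surfaceMeasure Ω
  have hbd : ∀ {f g : E3 → ℝ} (j k : Fin 3), MemLp f 2 (surfaceMeasure Ω) →
      MemLp g 2 (surfaceMeasure Ω) →
      Integrable (fun x => pderiv3 j ψ x * f x * g x * outerNormal Ω x k) (surfaceMeasure Ω) := by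
    intro f g j k hf hg
    have hc := continuousOn_outerNormal hΩ hs
    have hck : ContinuousOn (fun x => outerNormal Ω x k * pderiv3 j ψ x) (frontier Ω) :=
      ((EuclideanSpace.proj (𝕜 := ℝ) k).continuous.comp_continuousOn hc).mul
        (hψj j).continuous.continuousOn
    have := (memLp_smul_of_continuousOn (isCompact_frontier_of_isBounded hb) hsm hck
      (aestronglyMeasurable_surfaceMeasure_of_continuousOn hck) hf).integrable_mul hg
    refine this.congr (Eventually.of_forall fun x => ?_)
    simp only [Pi.mul_apply, smul_eq_mul]
    ring
  refine ⟨(integrable_finsetSum _ fun i _ => integrable_finsetSum _ fun j _ => hint i j).congr hae,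
    ?_⟩
  rw [← integral_congr_ae hae, integral_finsetSum _ fun i _ => integrable_finsetSum _ fun j _ => hint i j]
  have hT := fun j => (h.isH1Trace_partial j).memLp_trace
  have hbint : ∀ i j, Integrable (fun x => 2 * (pderiv3 j ψ x * T j x * T i x * outerNormal Ω x i) -
        pderiv3 j ψ x * T i x * T i x * outerNormal Ω x j) (surfaceMeasure Ω) := fun i j =>
    ((hbd j i (hT j) (hT i)).const_mul 2).sub (hbd j j (hT i) (hT i))
  have h3 : ∀ i, ∫ x in Ω, ∑ j, (2 * ((pderiv3 j ψ x * w2 j i x + pderiv3 i (pderiv3 j ψ) x * w1 j x)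
        * w1 i x + pderiv3 j ψ x * w1 j x * w2 i i x) -
        ((pderiv3 j ψ x * w2 i j x + pderiv3 j (pderiv3 j ψ) x * w1 i x) * w1 i x +
          pderiv3 j ψ x * w1 i x * w2 i j x)) =
      ∫ x, ∑ j, (2 * (pderiv3 j ψ x * T j x * T i x * outerNormal Ω x i) -
        pderiv3 j ψ x * T i x * T i x * outerNormal Ω x j) ∂(surfaceMeasure Ω) := by
    intro i
    rw [integral_finsetSum _ fun j _ => hint i j, integral_finsetSum _ fun j _ => hbint i j]
    refine Finset.sum_congr rfl fun j _ => ?_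
    rw [integral_sub ((h1 i j).1.const_mul 2) (h2 i j).1, integral_const_mul, (h1 i j).2,
      (h2 i j).2, integral_sub ((hbd j i (hT j) (hT i)).const_mul 2) (hbd j j (hT i) (hT i)),
      integral_const_mul]
  rw [Finset.sum_congr rfl fun i _ => h3 i, ← integral_finsetSum _ fun i _ =>
    integrable_finsetSum _ fun j _ => hbint i j]
  refine integral_congr_ae ?_
  -- On the boundary ∇w = (∂_νw)ν, so the two fluxes are 2∂_νψ(∂_νw)² and ∂_νψ(∂_νw)², with
  -- difference ∂_νψ(∂_νw)².
  filter_upwards [trace_partial_eq_normal_mul hΩ hb hs h.isH1Trace h.isH1Trace_partial h.symm, hsm]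
    with x hx hxf
  have hn := norm_sq_eq_sum_E3 (outerNormal Ω x)
  rw [norm_outerNormal hs hxf] at hn
  generalize ht : ∑ i, outerNormal Ω x i * T i x = t at hx ⊢
  simp only [hx]
  simp only [Fin.sum_univ_three] at hn ⊢
  linear_combination (-(t ^ 2 * (pderiv3 0 ψ x * outerNormal Ω x 0 +
    pderiv3 1 ψ x * outerNormal Ω x 1 + pderiv3 2 ψ x * outerNormal Ω x 2))) * hn

end EnergyIdentities

/-! ### The Hessian of a limiting Carleman weight. -/

section Weight

open Set

/-- A function that is smooth near a compact set agrees near that set with a smooth function on the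
whole space. -/
theorem exists_contDiff_eventuallyEq {K U : Set E3} (hK : IsCompact K) (hU : IsOpen U) (hKU : K ⊆ U)
    {f : E3 → ℝ} (hf : ContDiffOn ℝ ∞ f U) :
    ∃ F : E3 → ℝ, ContDiff ℝ ∞ F ∧ ∀ x ∈ K, F =ᶠ[𝓝 x] f := by
  obtain ⟨K', hK', hKK', hK'U⟩ := exists_compact_between hK hU hKU
  obtain ⟨ι, _, c, χ, -, hχ, -, hχU, -, hχ1⟩ := exists_finite_smoothPartition hK' (fun _ => U)
    fun x hx => hU.mem_nhds (hK'U hx)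
  refine ⟨fun x => ∑ i, χ i x * f x, ?_, fun x hx => ?_⟩
  · refine ContDiff.sum fun i _ => contDiff_iff_contDiffAt.2 fun x => ?_
    by_cases hx : x ∈ U
    · exact (hχ i).contDiffAt.mul (hf.contDiffAt (hU.mem_nhds hx))
    · have hx' : x ∉ tsupport (χ i) := fun h => hx (hχU i h)
      refine contDiffAt_const (c := (0 : ℝ)) |>.congr_of_eventuallyEq ?_
      filter_upwards [notMem_tsupport_iff_eventuallyEq.1 hx'] with y hy
      simp [hy]
  · filter_upwards [mem_interior_iff_mem_nhds.1 (hKK' hx)] with y hy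
    rw [← Finset.sum_mul, hχ1 y hy, one_mul]

theorem gradient_apply_E3 (f : E3 → ℝ) (x : E3) (j : Fin 3) : gradient f x j = pderiv3 j f x := by
  have h : inner ℝ (gradient f x) (EuclideanSpace.single j (1 : ℝ)) = pderiv3 j f x := by
    rw [gradient, InnerProductSpace.toDual_symm_apply]
    rfl
  rw [← h, EuclideanSpace.inner_single_right]
  simp

theorem fderiv_eq_sum_pderiv3 (f : E3 → ℝ) (x v : E3) :
    fderiv ℝ f x v = ∑ j, v j * pderiv3 j f x := by
  have h : inner ℝ (gradient f x) v = fderiv ℝ f x v := by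
    rw [gradient, InnerProductSpace.toDual_symm_apply]
  rw [← h, inner_eq_sum_E3]
  simp only [gradient_apply_E3, mul_comm]

theorem pderiv3_sum_const_mul {n : ℕ} (f : Fin n → E3 → ℝ) (c : Fin n → ℝ) {x : E3}
    (hf : ∀ i, DifferentiableAt ℝ (f i) x) (j : Fin 3) :
    pderiv3 j (fun y => ∑ i, c i * f i y) x = ∑ i, c i * pderiv3 j (f i) x := by
  have h : HasFDerivAt (fun y => ∑ i, c i * f i y) (∑ i, c i • fderiv ℝ (f i) x) x :=
    HasFDerivAt.fun_sum fun i _ => (hf i).hasFDerivAt.const_mul (c i)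
  simp [pderiv3, h.fderiv, sum_apply]

theorem pderiv3_congr {F : Type*} [NormedAddCommGroup F] [NormedSpace ℝ F] {f g : E3 → F} {x : E3}
    (h : f =ᶠ[𝓝 x] g) (j : Fin 3) : pderiv3 j f x = pderiv3 j g x := by
  rw [pderiv3, pderiv3, h.fderiv_eq]

theorem pderiv3_sum_sq {n : ℕ} (f : Fin n → E3 → ℝ) {x : E3}
    (hf : ∀ i, DifferentiableAt ℝ (f i) x) (j : Fin 3) :
    pderiv3 j (fun y => ∑ i, f i y ^ 2) x = ∑ i, 2 * f i x * pderiv3 j (f i) x := by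
  have h : HasFDerivAt (fun y => ∑ i, f i y ^ 2) (∑ i, (2 * f i x) • fderiv ℝ (f i) x) x :=
    HasFDerivAt.fun_sum fun i _ => by simpa using (hf i).hasFDerivAt.pow 2
  simp [pderiv3, h.fderiv, sum_apply]

/-- The Poisson bracket of the two parts of the symbol is `4 φ''(ξ, ξ) + 4 φ''(∇φ, ∇φ)`. -/
theorem poissonBracket_symbol {φ Φ : E3 → ℝ} (hΦ : ContDiff ℝ ∞ Φ) {x : E3} (h : Φ =ᶠ[𝓝 x] φ)
    (ξ : E3) :
    poissonBracket (symbolRe φ) (symbolIm φ) x ξ =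
      4 * (∑ i, ∑ j, pderiv3 i (pderiv3 j Φ) x * ξ i * ξ j) +
      4 * ∑ i, ∑ j, pderiv3 i (pderiv3 j Φ) x * pderiv3 i Φ x * pderiv3 j Φ x := by
  have hd : ∀ j, DifferentiableAt ℝ (pderiv3 j Φ) x := fun j =>
    (contDiff_pderiv3 hΦ j).differentiable (by simp) x
  have hg : ∀ᶠ y in 𝓝 x, ∀ j, gradient φ y j = pderiv3 j Φ y := by
    filter_upwards [h.eventually_nhds] with y hy j
    rw [gradient_apply_E3, pderiv3_congr hy]
  have hgx := hg.self_of_nhds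
  have e1 : (fun y => symbolIm φ y ξ) =ᶠ[𝓝 x] fun y => ∑ i, (2 * ξ i) * pderiv3 i Φ y := by
    filter_upwards [hg] with y hy
    rw [symbolIm, inner_eq_sum_E3, Finset.mul_sum]
    refine Finset.sum_congr rfl fun i _ => ?_
    rw [hy]
    ring
  have e2 : (fun y => symbolRe φ y ξ) =ᶠ[𝓝 x] fun y => ‖ξ‖ ^ 2 - ∑ i, pderiv3 i Φ y ^ 2 := by
    filter_upwards [hg] with y hy
    rw [symbolRe, norm_sq_eq_sum_E3 (gradient φ y)]
    simp only [hy]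
  have e2' : ∀ j, pderiv3 j (fun y => ‖ξ‖ ^ 2 - ∑ i, pderiv3 i Φ y ^ 2) x =
      -∑ i, 2 * pderiv3 i Φ x * pderiv3 j (pderiv3 i Φ) x := by
    intro j
    rw [← pderiv3_sum_sq _ hd]
    simp [pderiv3, fderiv_const_sub]
  have f1 : ∀ v : E3, fderiv ℝ (fun η => symbolRe φ x η) ξ v = 2 * inner ℝ v ξ := by
    intro v
    have : HasFDerivAt (fun η => symbolRe φ x η) (2 • innerSL ℝ ξ) ξ := by
      unfold symbolRe
      exact ((hasStrictFDerivAt_norm_sq ξ).hasFDerivAt).sub_const _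
    rw [this.fderiv]
    simp [real_inner_comm]
  have f2 : ∀ v : E3, fderiv ℝ (fun η => symbolIm φ x η) ξ v = 2 * inner ℝ v (gradient φ x) := by
    intro v
    have : HasFDerivAt (fun η => symbolIm φ x η) ((2 : ℝ) • innerSL ℝ (gradient φ x)) ξ := by
      unfold symbolIm
      exact ((innerSL ℝ (gradient φ x)).hasFDerivAt).const_mul 2
    rw [this.fderiv]
    simp
  have hin : ∀ (f : E3 → ℝ) (y v : E3), inner ℝ (gradient f y) v = fderiv ℝ f y v := fun f y v => by
    rw [gradient, InnerProductSpace.toDual_symm_apply]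
  unfold poissonBracket
  rw [hin, f1, hin, real_inner_comm, hin, f2, hin, fderiv_eq_sum_pderiv3, fderiv_eq_sum_pderiv3]
  simp only [pderiv3_congr e1, pderiv3_congr e2, e2', pderiv3_sum_const_mul _ _ hd, hgx]
  simp only [Fin.sum_univ_three, pderiv3_comm hΦ 1 0, pderiv3_comm hΦ 2 0, pderiv3_comm hΦ 2 1]
  ring

/-- A quadratic form that is conformal to minus its value at `p` on the orthogonal complement of
`p` is determined by its values `H(p, ·)`. -/
theorem quadraticForm_eq_of_orthogonal {H : Fin 3 → Fin 3 → ℝ} {p : Fin 3 → ℝ}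
    (hH : ∀ i j, H i j = H j i) (hp : 0 < ∑ j, p j ^ 2)
    (h : ∀ ξ : Fin 3 → ℝ, ∑ j, ξ j ^ 2 = ∑ j, p j ^ 2 → ∑ j, p j * ξ j = 0 →
      (∑ i, ∑ j, H i j * ξ i * ξ j) + ∑ i, ∑ j, H i j * p i * p j = 0) (ξ : Fin 3 → ℝ) :
    (∑ j, p j ^ 2) * (∑ i, ∑ j, H i j * ξ i * ξ j) =
      -(∑ i, ∑ j, H i j * p i * p j) * (∑ j, ξ j ^ 2) +
        2 * (∑ j, p j * ξ j) * ∑ i, ∑ j, H i j * p i * ξ j := by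
  generalize hN : ∑ j, p j ^ 2 = N at *
  -- Homogeneity: a nonzero vector orthogonal to p is rescaled to the length of p, where the
  -- hypothesis applies.
  have key : ∀ ζ : Fin 3 → ℝ, ∑ j, p j * ζ j = 0 →
      N * (∑ i, ∑ j, H i j * ζ i * ζ j) = -(∑ i, ∑ j, H i j * p i * p j) * ∑ j, ζ j ^ 2 := by
    intro ζ hζ
    by_cases h0 : ∑ j, ζ j ^ 2 = 0
    · have : ∀ j, ζ j = 0 := fun j => by
        have := (Finset.sum_eq_zero_iff_of_nonneg fun j _ => sq_nonneg (ζ j)).1 h0 j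
          (Finset.mem_univ j)
        exact pow_eq_zero_iff (two_ne_zero) |>.1 this
      simp [this]
    · have hpos : 0 < ∑ j, ζ j ^ 2 :=
        lt_of_le_of_ne (Finset.sum_nonneg fun j _ => sq_nonneg _) (Ne.symm h0)
      generalize hZ : ∑ j, ζ j ^ 2 = Z at *
      have hr : √(N / Z) ^ 2 = N / Z := Real.sq_sqrt (by positivity)
      generalize √(N / Z) = r at hr
      have h1 := h (fun j => r * ζ j) (by
        simp only [mul_pow, ← Finset.mul_sum, hZ, hr]
        field_simp) (by
        rw [show ∑ j, p j * (r * ζ j) = r * ∑ j, p j * ζ j by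
          rw [Finset.mul_sum]; exact Finset.sum_congr rfl fun _ _ => by ring, hζ, mul_zero])
      have h2 : ∑ i, ∑ j, H i j * (r * ζ i) * (r * ζ j) = N / Z * ∑ i, ∑ j, H i j * ζ i * ζ j := by
        rw [← hr]
        simp only [Finset.mul_sum]
        exact Finset.sum_congr rfl fun _ _ => Finset.sum_congr rfl fun _ _ => by ring
      rw [h2] at h1
      field_simp at h1
      linarith
  set d := ∑ j, p j * ξ j with hd
  -- The vector Nξ - (p·ξ)p is N times the projection of ξ orthogonal to p; expanding the quadratic
  -- form gives the claim after division by N².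
  have h1 := key (fun j => N * ξ j - d * p j) (by
    rw [show ∑ j, p j * (N * ξ j - d * p j) = N * (∑ j, p j * ξ j) - d * ∑ j, p j ^ 2 by
      simp only [Fin.sum_univ_three]; ring, hN, ← hd]
    ring)
  have h2 : ∑ j, (N * ξ j - d * p j) ^ 2 = N ^ 2 * ∑ j, ξ j ^ 2 - N * d ^ 2 := by
    have : ∑ j, (N * ξ j - d * p j) ^ 2 = N ^ 2 * ∑ j, ξ j ^ 2 - 2 * N * d * (∑ j, p j * ξ j) +
        d ^ 2 * ∑ j, p j ^ 2 := by
      simp only [Fin.sum_univ_three]; ring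
    rw [this, hN, ← hd]
    ring
  have h3 : ∑ i, ∑ j, H i j * (N * ξ i - d * p i) * (N * ξ j - d * p j) =
      N ^ 2 * (∑ i, ∑ j, H i j * ξ i * ξ j) - 2 * N * d * (∑ i, ∑ j, H i j * p i * ξ j) +
        d ^ 2 * ∑ i, ∑ j, H i j * p i * p j := by
    simp only [Fin.sum_univ_three, hH 1 0, hH 2 0, hH 2 1]
    ring
  rw [h2, h3] at h1
  have h4 : N ^ 2 ≠ 0 := by positivity
  refine mul_left_cancel₀ h4 ?_
  linear_combination h1

/-- A limiting Carleman weight near `closure Ω` extends to a smooth function `Φ`, and its Hessian is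
given by `φ''(ξ, ξ) = -λ |ξ|² + 2 (∇φ · ξ) φ''(∇φ, ξ) / |∇φ|²` with a smooth `λ`. -/
theorem IsLimitingCarlemanWeight.exists_extension {φ : E3 → ℝ} {U K : Set E3}
    (hφ : IsLimitingCarlemanWeight φ U) (hU : IsOpen U) (hK : IsCompact K) (hKU : K ⊆ U) :
    ∃ Φ l : E3 → ℝ, ContDiff ℝ ∞ Φ ∧ ContDiff ℝ ∞ l ∧ ∀ x ∈ K, Φ x = φ x ∧
      (∀ j, gradient φ x j = pderiv3 j Φ x) ∧ 0 < ∑ j, pderiv3 j Φ x ^ 2 ∧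
      l x * (∑ j, pderiv3 j Φ x ^ 2) =
        ∑ i, ∑ j, pderiv3 i (pderiv3 j Φ) x * pderiv3 i Φ x * pderiv3 j Φ x ∧
      ∀ ξ : Fin 3 → ℝ, ∑ i, ∑ j, pderiv3 i (pderiv3 j Φ) x * ξ i * ξ j =
        -(l x) * (∑ j, ξ j ^ 2) + 2 * (∑ j, pderiv3 j Φ x * ξ j) *
          ((∑ i, ∑ j, pderiv3 i (pderiv3 j Φ) x * pderiv3 i Φ x * ξ j) /
            ∑ j, pderiv3 j Φ x ^ 2) := by
  obtain ⟨hs, hne, hbr⟩ := hφ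
  obtain ⟨Φ, hΦ, hΦφ⟩ := exists_contDiff_eventuallyEq hK hU hKU hs
  have hpj := fun j => contDiff_pderiv3 hΦ j
  have hgr : ∀ x ∈ K, ∀ j, gradient φ x j = pderiv3 j Φ x := fun x hx j => by
    rw [gradient_apply_E3, pderiv3_congr (hΦφ x hx)]
  have hpos : ∀ x ∈ K, 0 < ∑ j, pderiv3 j Φ x ^ 2 := fun x hx => by
    have h1 : ‖gradient φ x‖ ^ 2 = ∑ j, pderiv3 j Φ x ^ 2 := by
      rw [norm_sq_eq_sum_E3]
      simp only [hgr x hx]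
    rw [← h1]
    have := norm_pos_iff.2 (hne x (hKU hx))
    positivity
  have hNs : ContDiff ℝ ∞ fun x => ∑ j, pderiv3 j Φ x ^ 2 :=
    ContDiff.sum fun j _ => (hpj j).pow 2
  have hl : ContDiffOn ℝ ∞ (fun x =>
      (∑ i, ∑ j, pderiv3 i (pderiv3 j Φ) x * pderiv3 i Φ x * pderiv3 j Φ x) /
        ∑ j, pderiv3 j Φ x ^ 2) {x | 0 < ∑ j, pderiv3 j Φ x ^ 2} := by
    refine ContDiffOn.div (ContDiff.contDiffOn ?_) hNs.contDiffOn fun x hx => (ne_of_gt hx)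
    exact ContDiff.sum fun i _ => ContDiff.sum fun j _ =>
      ((contDiff_pderiv3 (hpj j) i).mul (hpj i)).mul (hpj j)
  -- The quotient Φ''(∇Φ,∇Φ)/|∇Φ|² is smooth only where ∇Φ ≠ 0, an open set containing K, so it too
  -- is replaced by a global function that agrees with it near K.
  obtain ⟨l, hlc, hle⟩ := exists_contDiff_eventuallyEq hK
    (isOpen_lt continuous_const hNs.continuous) hpos hl
  refine ⟨Φ, l, hΦ, hlc, fun x hx => ?_⟩
  have hlx := (hle x hx).self_of_nhds
  simp only at hlx
  have hp := hpos x hx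
  refine ⟨(hΦφ x hx).self_of_nhds, hgr x hx, hp, by rw [hlx]; field_simp, fun ξ => ?_⟩
  have h1 := quadraticForm_eq_of_orthogonal (H := fun i j => pderiv3 i (pderiv3 j Φ) x)
    (p := fun j => pderiv3 j Φ x) (fun i j => by rw [pderiv3_comm hΦ]) hp (fun ξ h2 h3 => by
      have h4 := hbr x (hKU hx) (WithLp.toLp 2 ξ) (by
        rw [symbolRe, norm_sq_eq_sum_E3, norm_sq_eq_sum_E3]
        simp only [hgr x hx]
        rw [h2, sub_self]) (by
        rw [symbolIm, inner_eq_sum_E3]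
        simp only [hgr x hx]
        rw [h3, mul_zero])
      rw [poissonBracket_symbol hΦ (hΦφ x hx)] at h4
      simp only at h4
      linarith) ξ
  rw [hlx]
  field_simp
  linarith [h1]

end Weight

/-! ### The pointwise Carleman inequality, and derivatives of the convexified weight. -/

section CarlemanEstimate

open Set

-- Here s = ∇Φ·∇w, X = |∇w|², N = |∇Φ|², y = Φ''(∇Φ,∇w)/N, l is the factor λ, DL = Δψ, and D is the
-- derivative along ∇w of the multiplier in the Laplacian identity. The two halves of a² pay for the
-- terms with w·a, and b² pays for y·b. The convexification term is worth at least hκc₀²w², of which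
-- one half pays for the negative δ term, one quarter for the O(h²) errors, and one quarter remains.
-- Half of δκh·h²X pays for the gradient errors and half remains.
set_option maxHeartbeats 600000 in
theorem carleman_absorb {h ε κ δ c₀ M w s y X D N η l DL c a b : ℝ} (hh : 0 < h) (hκ : 0 < κ)
    (hκε : κ * ε = h) (hκ1 : κ ≤ 1) (hδ0 : 0 ≤ δ) (hδ1 : δ ≤ 1) (hc₀ : 0 < c₀)
    (hX : 0 ≤ X) (hη : 1 / 2 ≤ η) (hη' : η ≤ 3 / 2) (hN : c₀ ≤ N) (hNM : N ≤ M)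
    (hy : y ^ 2 ≤ M ^ 2 * X) (hD : D ^ 2 ≤ M ^ 2 * X) (hl : |l| ≤ M) (hDL : |DL| ≤ M)
    (hδM : 9 / 4 * δ * M ≤ c₀ ^ 2 / 2) (hε1 : ε * (20 * M ^ 2 + 1) ≤ c₀ ^ 2 / 4)
    (hε2 : ε * (6 * M ^ 2 + M ^ 2 / 2) ≤ δ / 2) (hc1 : c ≤ c₀ ^ 2 / 4) (hc2 : c ≤ δ / 2) :
    c * (h * κ) * (w ^ 2 + h ^ 2 * X) ≤
      a ^ 2 + b ^ 2 - 4 * h * η * l * w * a + h ^ 3 * w * D + 4 * h ^ 2 * y * (b - h * DL * w) +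
        4 * h * κ * (h ^ 2 * s ^ 2 + η ^ 2 * N ^ 2 * w ^ 2) +
        δ * κ * h * (h ^ 2 * X - w * a - η ^ 2 * N * w ^ 2) := by
  have hw0 := sq_nonneg w
  have hl2 : l ^ 2 ≤ M ^ 2 := sq_le_sq' (abs_le.1 hl).1 (abs_le.1 hl).2
  have hDL2 : DL ^ 2 ≤ M ^ 2 := sq_le_sq' (abs_le.1 hDL).1 (abs_le.1 hDL).2
  have hη2 : η ^ 2 ≤ 9 / 4 := by nlinarith
  have hη2' : 1 / 4 ≤ η ^ 2 := by nlinarith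
  have hhk : 0 < h * κ := mul_pos hh hκ
  have t1 : 4 * h * η * l * w * a ≤ a ^ 2 / 2 + 18 * M ^ 2 * (h ^ 2 * w ^ 2) := by
    have e1 : η ^ 2 * l ^ 2 ≤ 9 / 4 * M ^ 2 := mul_le_mul hη2 hl2 (sq_nonneg _) (by norm_num)
    have e2 := mul_le_mul_of_nonneg_right e1 (by positivity : 0 ≤ h ^ 2 * w ^ 2)
    linarith [sq_nonneg (a - 4 * h * η * l * w)]
  have t2 : -(h ^ 2 * w ^ 2 / 2 + h ^ 2 * (M ^ 2 * (h ^ 2 * X)) / 2) ≤ h ^ 3 * w * D := by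
    have e1 := mul_le_mul_of_nonneg_left hD (by positivity : 0 ≤ h ^ 4)
    linarith [sq_nonneg (h * w + h ^ 2 * D)]
  have t3 : -(b ^ 2 + 4 * M ^ 2 * (h ^ 4 * X)) ≤ 4 * h ^ 2 * y * b := by
    have e1 := mul_le_mul_of_nonneg_left hy (by positivity : 0 ≤ h ^ 4)
    linarith [sq_nonneg (b + 2 * h ^ 2 * y)]
  have t4 : 4 * h ^ 2 * y * (h * DL * w) ≤ 2 * M ^ 2 * (h ^ 4 * X) + 2 * M ^ 2 * (h ^ 2 * w ^ 2) := by
    have e1 := mul_le_mul_of_nonneg_left hy (by positivity : 0 ≤ h ^ 4)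
    have e2 := mul_le_mul_of_nonneg_right hDL2 (by positivity : 0 ≤ h ^ 2 * w ^ 2)
    linarith [sq_nonneg (h ^ 2 * y - h * DL * w)]
  have t5 : δ * κ * h * (w * a) ≤ a ^ 2 / 2 + h ^ 2 * w ^ 2 / 2 := by
    have e1 : δ * κ ≤ 1 := mul_le_one₀ hδ1 hκ.le hκ1
    have e2 : (δ * κ) ^ 2 ≤ 1 := pow_le_one₀ (by positivity) e1
    have e3 := mul_le_mul_of_nonneg_right e2 (by positivity : 0 ≤ h ^ 2 * w ^ 2)
    linarith [sq_nonneg (a - δ * κ * h * w)]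
  have t6 : δ * κ * h * (η ^ 2 * N * w ^ 2) ≤ h * κ * (c₀ ^ 2 / 2 * w ^ 2) := by
    have e1 : η ^ 2 * N ≤ 9 / 4 * M := mul_le_mul hη2 hNM (by linarith) (by norm_num)
    have e2 : δ * (η ^ 2 * N) ≤ c₀ ^ 2 / 2 := by
      have := mul_le_mul_of_nonneg_left e1 hδ0
      linarith
    have e3 := mul_le_mul_of_nonneg_left (mul_le_mul_of_nonneg_right e2 hw0) hhk.le
    linarith
  have t7 : h * κ * (c₀ ^ 2 * w ^ 2) ≤ 4 * h * κ * (h ^ 2 * s ^ 2 + η ^ 2 * N ^ 2 * w ^ 2) := by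
    have e1 : c₀ ^ 2 ≤ N ^ 2 := pow_le_pow_left₀ hc₀.le hN 2
    have e2 : 1 / 4 * c₀ ^ 2 ≤ η ^ 2 * N ^ 2 := mul_le_mul hη2' e1 (sq_nonneg _) (sq_nonneg _)
    have e3 := mul_le_mul_of_nonneg_left (mul_le_mul_of_nonneg_right e2 hw0) hhk.le
    have e4 : 0 ≤ h * κ * (h ^ 2 * s ^ 2) := by positivity
    linarith
  -- The gain of the convexification has size hκ = h²/ε, so every error of size h² is smaller by the
  -- factor ε. The errors collected above add up to (20M² + 1)h²w² and (13/2)M²h⁴X.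
  have hh2 : h ^ 2 = ε * (h * κ) := by rw [← hκε]; ring
  have t8 : h ^ 2 * ((20 * M ^ 2 + 1) * w ^ 2) ≤ h * κ * (c₀ ^ 2 / 4 * w ^ 2) := by
    have e3 := mul_le_mul_of_nonneg_left (mul_le_mul_of_nonneg_right hε1 hw0) hhk.le
    rw [hh2]
    linarith
  have t9 : h ^ 2 * ((6 * M ^ 2 + M ^ 2 / 2) * (h ^ 2 * X)) ≤ h * κ * (δ / 2 * (h ^ 2 * X)) := by
    have e3 := mul_le_mul_of_nonneg_left
      (mul_le_mul_of_nonneg_right hε2 (by positivity : 0 ≤ h ^ 2 * X)) hhk.le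
    calc h ^ 2 * ((6 * M ^ 2 + M ^ 2 / 2) * (h ^ 2 * X)) =
        h * κ * (ε * (6 * M ^ 2 + M ^ 2 / 2) * (h ^ 2 * X)) := by
          conv_lhs => rw [show ∀ z, h ^ 2 * z = ε * (h * κ) * z from fun z => by rw [hh2]]
          ring
      _ ≤ _ := e3
  have t10 : h * κ * (c * w ^ 2) ≤ h * κ * (c₀ ^ 2 / 4 * w ^ 2) :=
    mul_le_mul_of_nonneg_left (mul_le_mul_of_nonneg_right hc1 hw0) hhk.le
  have t11 : h * κ * (c * (h ^ 2 * X)) ≤ h * κ * (δ / 2 * (h ^ 2 * X)) :=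
    mul_le_mul_of_nonneg_left (mul_le_mul_of_nonneg_right hc2 (by positivity)) hhk.le
  linarith

/-- The pointwise inequality behind the Carleman estimate. The terms with factors `2 h³`, `h³` and
`2 h` have known integrals. -/
theorem carleman_pointwise {h ε κ δ c₀ M w Lw s y X D N η l DL c : ℝ} (hh : 0 < h) (hκ : 0 < κ)
    (hκε : κ * ε = h) (hκ1 : κ ≤ 1) (hδ0 : 0 ≤ δ) (hδ1 : δ ≤ 1) (hc₀ : 0 < c₀)
    (hX : 0 ≤ X) (hη : 1 / 2 ≤ η) (hη' : η ≤ 3 / 2) (hN : c₀ ≤ N) (hNM : N ≤ M)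
    (hy : y ^ 2 ≤ M ^ 2 * X) (hD : D ^ 2 ≤ M ^ 2 * X) (hl : |l| ≤ M) (hDL : |DL| ≤ M)
    (hδM : 9 / 4 * δ * M ≤ c₀ ^ 2 / 2) (hε1 : ε * (20 * M ^ 2 + 1) ≤ c₀ ^ 2 / 4)
    (hε2 : ε * (6 * M ^ 2 + M ^ 2 / 2) ≤ δ / 2) (hc1 : c ≤ c₀ ^ 2 / 4) (hc2 : c ≤ δ / 2) :
    c * (h * κ) * (w ^ 2 + h ^ 2 * X) ≤
      (-h ^ 2 * Lw - η ^ 2 * N * w + h * (2 * η * s + DL * w)) ^ 2 +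
        2 * h ^ 3 * (2 * Lw * (η * s) + 2 * (η * (-l * X + 2 * s * y) + κ * s ^ 2) - DL * X) +
        h ^ 3 * ((2 * DL + 4 * (η * l) + δ * κ) * w * Lw + (2 * DL + 4 * (η * l) + δ * κ) * X +
          w * D) +
        2 * h * (2 * w * (η ^ 3 * N * s) +
          (2 * (η ^ 3 * (l * N) + κ * η ^ 2 * N ^ 2) + η ^ 2 * N * DL) * w ^ 2) := by
  -- With a and b the symmetric and antisymmetric parts of the conjugated operator, the two right
  -- hand sides are equal as polynomials.
  refine (carleman_absorb (s := s) (a := -h ^ 2 * Lw - η ^ 2 * N * w) (b := h * (2 * η * s + DL * w))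
    hh hκ hκε hκ1 hδ0 hδ1 hc₀ hX hη hη' hN hNM hy hD hl hDL hδM hε1 hε2 hc1 hc2).trans (le_of_eq ?_)
  ring

theorem pderiv3_add {f g : E3 → ℝ} {x : E3} (hf : DifferentiableAt ℝ f x)
    (hg : DifferentiableAt ℝ g x) (j : Fin 3) :
    pderiv3 j (fun y => f y + g y) x = pderiv3 j f x + pderiv3 j g x := by
  simp only [pderiv3]
  rw [fderiv_fun_add hf hg]
  rfl

theorem pderiv3_const_mul {f : E3 → ℝ} {x : E3} (hf : DifferentiableAt ℝ f x) (c : ℝ) (j : Fin 3) :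
    pderiv3 j (fun y => c * f y) x = c * pderiv3 j f x := by
  simp only [pderiv3]
  rw [fderiv_const_mul hf]
  rfl

theorem pderiv3_const (c : ℝ) (x : E3) (j : Fin 3) : pderiv3 j (fun _ => c) x = 0 := by
  simp [pderiv3]

/-- The convexification `Φ + κ Φ² / 2` of a weight. -/
def convexify (κ : ℝ) (Φ : E3 → ℝ) (x : E3) : ℝ := Φ x + κ * (Φ x ^ 2 / 2)

theorem contDiff_convexify {κ : ℝ} {Φ : E3 → ℝ} (hΦ : ContDiff ℝ ∞ Φ) :
    ContDiff ℝ ∞ (convexify κ Φ) :=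
  hΦ.add (contDiff_const.mul ((hΦ.pow 2).div_const 2))

theorem pderiv3_convexify {κ : ℝ} {Φ : E3 → ℝ} (hΦ : ContDiff ℝ ∞ Φ) (j : Fin 3) :
    pderiv3 j (convexify κ Φ) = fun x => (1 + κ * Φ x) * pderiv3 j Φ x := by
  ext x
  have hd := (hΦ.differentiable (by simp) x).hasFDerivAt
  have h : HasFDerivAt (convexify κ Φ) ((1 + κ * Φ x) • fderiv ℝ Φ x) x := by
    have h1 := hd.add (((hd.pow 2).mul_const (2⁻¹ : ℝ)).const_mul κ)
    refine (h1.congr_fderiv ?_)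
    ext v
    simp
    ring
  simp [pderiv3, h.fderiv]

theorem pderiv3_one_add {κ : ℝ} {Φ : E3 → ℝ} (hΦ : ContDiff ℝ ∞ Φ) (j : Fin 3) (x : E3) :
    pderiv3 j (fun x => 1 + κ * Φ x) x = κ * pderiv3 j Φ x := by
  have hd := (hΦ.differentiable (by simp) x)
  rw [pderiv3_add (by fun_prop) (hd.const_mul κ), pderiv3_const, zero_add, pderiv3_const_mul hd]

theorem pderiv3_pderiv3_convexify {κ : ℝ} {Φ : E3 → ℝ} (hΦ : ContDiff ℝ ∞ Φ) (i j : Fin 3) :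
    pderiv3 i (pderiv3 j (convexify κ Φ)) = fun x =>
      (1 + κ * Φ x) * pderiv3 i (pderiv3 j Φ) x + κ * pderiv3 i Φ x * pderiv3 j Φ x := by
  ext x
  have hd := (hΦ.differentiable (by simp) x)
  rw [pderiv3_convexify hΦ, pderiv3_mul (by fun_prop)
    ((contDiff_pderiv3 hΦ j).differentiable (by simp) x), pderiv3_one_add hΦ]
  ring

end CarlemanEstimate

/-! ### Integrated Carleman estimate for the conjugated operator. -/

section ConjugatedEstimate

open Set

/-- The gradient of the multiplier used in the Carleman estimate. -/
theorem pderiv3_multiplier {Φ L N l : E3 → ℝ} (hΦ : ContDiff ℝ ∞ Φ) (hL : ContDiff ℝ ∞ L)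
    (hN : ContDiff ℝ ∞ N) (hl : ContDiff ℝ ∞ l) (κ c : ℝ) (k : Fin 3) (x : E3) :
    pderiv3 k (fun x => 2 * ((1 + κ * Φ x) * L x + κ * N x) + 4 * ((1 + κ * Φ x) * l x) + c) x =
      2 * ((1 + κ * Φ x) * pderiv3 k L x + κ * pderiv3 k Φ x * L x + κ * pderiv3 k N x) +
        4 * ((1 + κ * Φ x) * pderiv3 k l x + κ * pderiv3 k Φ x * l x) := by
  have dΦ : DifferentiableAt ℝ Φ x := hΦ.differentiable (by simp) x
  have dL : DifferentiableAt ℝ L x := hL.differentiable (by simp) x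
  have dN : DifferentiableAt ℝ N x := hN.differentiable (by simp) x
  have dl : DifferentiableAt ℝ l x := hl.differentiable (by simp) x
  rw [pderiv3_add (by fun_prop) (by fun_prop), pderiv3_add (by fun_prop) (by fun_prop),
    pderiv3_const_mul (by fun_prop), pderiv3_const_mul (by fun_prop), pderiv3_const,
    pderiv3_add (by fun_prop) (by fun_prop), pderiv3_mul (by fun_prop) dL,
    pderiv3_mul (by fun_prop) dl, pderiv3_const_mul dN, pderiv3_one_add hΦ]
  ring

/-- The parameter κ is treated as one more variable in the compact interval [0, 1], so the bounds,
and with them all later constants, do not depend on κ. -/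
theorem exists_uniform_bound {K : Set E3} (hK : IsCompact K) {n : ℕ} {f : Fin n → E3 → ℝ → ℝ}
    (hf : ∀ i, ContinuousOn (fun z : E3 × ℝ => f i z.1 z.2) (K ×ˢ Icc 0 1)) :
    ∃ M, 1 ≤ M ∧ ∀ x ∈ K, ∀ κ ∈ Icc (0 : ℝ) 1, ∀ i, |f i x κ| ≤ M := by
  choose C hC using fun i => (hK.prod isCompact_Icc).exists_bound_of_continuousOn (hf i)
  have h0 := Finset.sum_nonneg fun i (_ : i ∈ Finset.univ) => abs_nonneg (C i)
  refine ⟨1 + ∑ i, |C i|, by linarith, fun x hx κ hκ i => ?_⟩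
  have h1 := hC i (x, κ) ⟨hx, hκ⟩
  have h2 := Finset.single_le_sum (fun i _ => abs_nonneg (C i)) (Finset.mem_univ i)
  have h3 := le_abs_self (C i)
  rw [Real.norm_eq_abs] at h1
  simp only at h1
  linarith

theorem sq_sum_mul_le {a b : Fin 3 → ℝ} {M : ℝ} (ha : ∀ j, |a j| ≤ M) :
    (∑ j, a j * b j) ^ 2 ≤ (3 * M) ^ 2 * ∑ j, b j ^ 2 := by
  have h1 := Finset.sum_mul_sq_le_sq_mul_sq Finset.univ a b
  have h2 : ∑ j, a j ^ 2 ≤ (3 * M) ^ 2 := by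
    have h3 : ∀ j, a j ^ 2 ≤ M ^ 2 := fun j => by
      have := ha j
      exact sq_le_sq' (abs_le.1 this).1 (abs_le.1 this).2
    simp only [Fin.sum_univ_three]
    nlinarith [h3 0, h3 1, h3 2, sq_nonneg M]
  exact h1.trans (mul_le_mul_of_nonneg_right h2 (Finset.sum_nonneg fun j _ => sq_nonneg _))

/-- The Carleman estimate for the conjugated Laplacian, with the boundary term. -/
theorem exists_carleman_conjugated {Ω : Set E3} (hΩ : IsOpen Ω) (hb : Bornology.IsBounded Ω)
    (hs : HasSmoothBoundary Ω) {Φ l : E3 → ℝ} (hΦ : ContDiff ℝ ∞ Φ) (hl : ContDiff ℝ ∞ l)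
    (hpos : ∀ x ∈ closure Ω, 0 < ∑ j, pderiv3 j Φ x ^ 2)
    (hlN : ∀ x ∈ closure Ω, l x * (∑ j, pderiv3 j Φ x ^ 2) =
        ∑ i, ∑ j, pderiv3 i (pderiv3 j Φ) x * pderiv3 i Φ x * pderiv3 j Φ x)
    (hH : ∀ x ∈ closure Ω, ∀ ξ : Fin 3 → ℝ, ∑ i, ∑ j, pderiv3 i (pderiv3 j Φ) x * ξ i * ξ j =
        -(l x) * (∑ j, ξ j ^ 2) + 2 * (∑ j, pderiv3 j Φ x * ξ j) *
          ((∑ i, ∑ j, pderiv3 i (pderiv3 j Φ) x * pderiv3 i Φ x * ξ j) /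
            ∑ j, pderiv3 j Φ x ^ 2)) :
    ∃ c > (0 : ℝ), ∃ ε₁ > (0 : ℝ), ∃ κ₁ > (0 : ℝ), κ₁ ≤ 1 ∧
      (∀ κ, 0 < κ → κ ≤ κ₁ → ∀ x ∈ closure Ω, 1 / 2 ≤ 1 + κ * Φ x ∧ 1 + κ * Φ x ≤ 3 / 2) ∧
      ∀ h ε κ : ℝ, 0 < h → 0 < ε → ε ≤ ε₁ → 0 < κ → κ ≤ κ₁ → κ * ε = h →
      ∀ (w : E3 → ℝ) (w1 : Fin 3 → E3 → ℝ) (w2 : Fin 3 → Fin 3 → E3 → ℝ) (T : Fin 3 → E3 → ℝ),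
        IsH2Zero Ω w w1 w2 T →
        c * (h * κ) * (∫ x in Ω, (w x ^ 2 + h ^ 2 * ∑ j, w1 j x ^ 2)) ≤
          (∫ x in Ω, (-h ^ 2 * (∑ j, w2 j j x) - (∑ j, pderiv3 j (convexify κ Φ) x ^ 2) * w x +
            h * (2 * (∑ j, pderiv3 j (convexify κ Φ) x * w1 j x) +
              (∑ j, pderiv3 j (pderiv3 j (convexify κ Φ)) x) * w x)) ^ 2) +
          2 * h ^ 3 * ∫ x, (∑ j, pderiv3 j (convexify κ Φ) x * outerNormal Ω x j) *
            (∑ j, outerNormal Ω x j * T j x) ^ 2 ∂(surfaceMeasure Ω) := by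
  have hK := hb.isCompact_closure
  have hpj := fun j => contDiff_pderiv3 hΦ j
  have hHij := fun i j => contDiff_pderiv3 (hpj j) i
  let L : E3 → ℝ := fun x => ∑ j, pderiv3 j (pderiv3 j Φ) x
  let N : E3 → ℝ := fun x => ∑ j, pderiv3 j Φ x ^ 2
  have hLs : ContDiff ℝ ∞ L := ContDiff.sum fun j _ => hHij j j
  have hNs : ContDiff ℝ ∞ N := ContDiff.sum fun j _ => (hpj j).pow 2
  -- The field with Y·∇w = Φ''(∇Φ,∇w)/|∇Φ|². Below, `dm` is the gradient of the multiplier 2Δψ + 4ηl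
  -- + δκ, whose constant last term drops out.
  let Y : Fin 3 → E3 → ℝ := fun j x => (∑ i, pderiv3 i (pderiv3 j Φ) x * pderiv3 i Φ x) / N x
  let dm : Fin 3 → E3 → ℝ → ℝ := fun k x κ =>
    2 * ((1 + κ * Φ x) * pderiv3 k L x + κ * pderiv3 k Φ x * L x + κ * pderiv3 k N x) +
        4 * ((1 + κ * Φ x) * pderiv3 k l x + κ * pderiv3 k Φ x * l x)
  have cΦ := hΦ.continuous
  have cp := fun j => (hpj j).continuous
  have cH := fun i j => (hHij i j).continuous
  have cL := hLs.continuous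
  have cN := hNs.continuous
  have cl := hl.continuous
  have cdL := fun k => (contDiff_pderiv3 hLs k).continuous
  have cdN := fun k => (contDiff_pderiv3 hNs k).continuous
  have cdl := fun k => (contDiff_pderiv3 hl k).continuous
  obtain ⟨M₁, hM₁, hB₁⟩ := exists_uniform_bound hK (f := fun k x κ => dm k x κ) fun k => by
    have := cp k
    have := cdL k
    have := cdN k
    have := cdl k
    exact Continuous.continuousOn (by fun_prop)
  obtain ⟨M₂, hM₂, hB₂⟩ := exists_uniform_bound hK (f := fun j x _ => Y j x) fun j => by
    refine ContinuousOn.div (Continuous.continuousOn ?_)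
      (cN.comp continuous_fst).continuousOn fun z hz => (hpos z.1 hz.1).ne'
    exact continuous_finsetSum _ fun i _ => ((cH i j).mul (cp i)).comp continuous_fst
  obtain ⟨M₃, hM₃, hB₃⟩ := exists_uniform_bound hK
    (f := ![fun x _ => l x, fun x κ => (1 + κ * Φ x) * L x + κ * N x, fun x _ => N x,
      fun x _ => Φ x]) fun j => by
    refine Continuous.continuousOn ?_
    fin_cases j <;> simp <;> fun_prop
  obtain ⟨c₀, hc₀, hc₀N⟩ := hK.exists_forall_le' cN.continuousOn hpos
  set M : ℝ := 3 * (M₁ + M₂ + M₃) with hM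
  have hM1 : 1 ≤ M := by linarith
  -- Small enough that -δκhη²Nw² costs at most half of the bound hκc₀²w² from the convexification.
  set δ : ℝ := min 1 (2 * c₀ ^ 2 / (9 * M)) with hδ
  have hδ0 : 0 < δ := lt_min one_pos (by positivity)
  have hδM : 9 / 4 * δ * M ≤ c₀ ^ 2 / 2 := by
    have : δ * (9 * M) ≤ 2 * c₀ ^ 2 := (le_div_iff₀ (by positivity)).1 (min_le_right _ _)
    linarith
  refine ⟨min (c₀ ^ 2 / 4) (δ / 2), lt_min (by positivity) (by positivity),
    min (c₀ ^ 2 / 4 / (20 * M ^ 2 + 1)) (δ / 2 / (6 * M ^ 2 + M ^ 2 / 2)),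
    lt_min (by positivity) (by positivity), 1 / (2 * M₃), by positivity,
    (div_le_one (by positivity)).2 (by linarith), ?_, ?_⟩
  · intro κ hκ hκ1 x hx
    have h1 : |Φ x| ≤ M₃ := hB₃ x hx 0 ⟨le_rfl, zero_le_one⟩ 3
    have h2 : κ * M₃ ≤ 1 / 2 := by
      have := (le_div_iff₀ (by positivity)).1 hκ1
      linarith
    have h3 := mul_le_mul_of_nonneg_left (abs_le.1 h1).1 hκ.le
    have h4 := mul_le_mul_of_nonneg_left (abs_le.1 h1).2 hκ.le
    constructor <;> linarith
  intro h ε κ hh hε hεε hκ hκκ hκε w w1 w2 T hw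
  have hκ1 : κ ≤ 1 := hκκ.trans ((div_le_one (by positivity)).2 (by linarith))
  have hψ : ContDiff ℝ ∞ (convexify κ Φ) := contDiff_convexify hΦ
  have hψj := fun j => contDiff_pderiv3 hψ j
  -- In this multiplier 2Δψ compensates the product of h²Δw with hΔψ w in the cross term, 4ηl trades
  -- l|∇w|² for a multiple of w·a, and δκ recovers the full gradient.
  have hms : ContDiff ℝ ∞ fun x =>
      2 * ((1 + κ * Φ x) * L x + κ * N x) + 4 * ((1 + κ * Φ x) * l x) + δ * κ := by fun_prop
  have hXs : ∀ j, ContDiff ℝ ∞ fun x =>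
      (∑ k, pderiv3 k (convexify κ Φ) x ^ 2) * pderiv3 j (convexify κ Φ) x := fun j =>
    (ContDiff.sum fun k _ => (hψj k).pow 2).mul (hψj j)
  obtain ⟨iR, eR⟩ := hw.rellich hΩ hb hs hψ
  obtain ⟨iM, eM⟩ := hw.setIntegral_mul_laplacian hΩ hb hs hms
  obtain ⟨iX, eX⟩ := hw.setIntegral_mul_vectorField hΩ hb hs hXs
  have hmul : ∀ {c f : E3 → ℝ}, Continuous c → MemLp f 2 (volume.restrict Ω) →
      MemLp (fun x => c x * f x) 2 (volume.restrict Ω) := fun hc hf =>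
    memLp_smul_of_continuous hΩ hb hc hf
  have m0 := hw.isH1Trace.memLp
  have m1 := hw.isH1Trace.memLp_partial
  have m2 : MemLp (fun x => ∑ j, w2 j j x) 2 (volume.restrict Ω) :=
    memLp_finsetSum _ fun j _ => (hw.isH1Trace_partial j).memLp_partial j
  have m3 : MemLp (fun x => ∑ j, pderiv3 j (convexify κ Φ) x * w1 j x) 2 (volume.restrict Ω) :=
    memLp_finsetSum _ fun j _ => hmul (hψj j).continuous (m1 j)
  have iP : IntegrableOn (fun x =>
      (-h ^ 2 * (∑ j, w2 j j x) - (∑ j, pderiv3 j (convexify κ Φ) x ^ 2) * w x +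
            h * (2 * (∑ j, pderiv3 j (convexify κ Φ) x * w1 j x) +
              (∑ j, pderiv3 j (pderiv3 j (convexify κ Φ)) x) * w x)) ^ 2) Ω := by
    refine MemLp.integrable_sq (((m2.const_mul _).sub (hmul ?_ m0)).add
      (((m3.const_mul 2).add (hmul ?_ m0)).const_mul h))
    · exact continuous_finsetSum _ fun j _ => (hψj j).continuous.pow 2
    · exact continuous_finsetSum _ fun j _ => (contDiff_pderiv3 (hψj j) j).continuous
  have iL : IntegrableOn (fun x => w x ^ 2 + h ^ 2 * ∑ j, w1 j x ^ 2) Ω :=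
    m0.integrable_sq.add ((integrable_finsetSum _ fun j _ => (m1 j).integrable_sq).const_mul _)
  rw [← integral_const_mul]
  have hdX : ∀ j x, pderiv3 j (fun x => (∑ k, pderiv3 k (convexify κ Φ) x ^ 2) *
      pderiv3 j (convexify κ Φ) x) x = (∑ k, pderiv3 k (convexify κ Φ) x ^ 2) *
        pderiv3 j (pderiv3 j (convexify κ Φ)) x + pderiv3 j (convexify κ Φ) x *
        ∑ k, 2 * pderiv3 k (convexify κ Φ) x * pderiv3 j (pderiv3 k (convexify κ Φ)) x := by
    intro j x
    have hd := fun k => (hψj k).differentiable (by simp) x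
    rw [pderiv3_mul ((ContDiff.sum fun k _ => (hψj k).pow 2).differentiable (by simp) x) (hd j),
      pderiv3_sum_sq _ hd]
  -- The Laplacian and vector field identities integrate to zero, and Rellich contributes exactly
  -- the boundary term. Adding them reduces the claim to comparing integrands pointwise.
  have hsum := integral_add ((iP.add (iR.const_mul (2 * h ^ 3))).add (iM.const_mul (h ^ 3)))
    (iX.const_mul (2 * h))
  simp only [Pi.add_apply] at hsum
  rw [integral_const_mul, eX, mul_zero, add_zero] at hsum
  have hsum2 := integral_add (iP.add (iR.const_mul (2 * h ^ 3))) (iM.const_mul (h ^ 3))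
  simp only [Pi.add_apply] at hsum2
  rw [integral_const_mul, eM, mul_zero, add_zero] at hsum2
  have hsum3 := integral_add iP (iR.const_mul (2 * h ^ 3))
  rw [integral_const_mul, eR] at hsum3
  rw [← hsum3, ← hsum2, ← hsum]
  refine integral_mono_ae (iL.const_mul _) (((iP.add (iR.const_mul (2 * h ^ 3))).add
    (iM.const_mul (h ^ 3))).add (iX.const_mul (2 * h))) ?_
  filter_upwards [ae_mem_closure_restrict hΩ] with x hx
  have hκm : κ ∈ Icc (0 : ℝ) 1 := ⟨hκ.le, hκ1⟩
  have bl : |l x| ≤ M₃ := hB₃ x hx κ hκm 0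
  have bDL : |(1 + κ * Φ x) * L x + κ * N x| ≤ M₃ := hB₃ x hx κ hκm 1
  have bN : |N x| ≤ M₃ := hB₃ x hx κ hκm 2
  have bΦ : |Φ x| ≤ M₃ := hB₃ x hx κ hκm 3
  have hMle : ∀ {a b : ℝ}, 0 ≤ a → a ≤ b → ∀ {X : ℝ}, 0 ≤ X → a ^ 2 * X ≤ b ^ 2 * X :=
    fun ha hab _ hX => mul_le_mul_of_nonneg_right (pow_le_pow_left₀ ha hab 2) hX
  have hX0 : 0 ≤ ∑ j, w1 j x ^ 2 := Finset.sum_nonneg fun j _ => sq_nonneg _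
  have bY := (sq_sum_mul_le (b := fun j => w1 j x) (hB₂ x hx κ hκm)).trans
    (hMle (b := M) (by positivity) (by linarith) hX0)
  have bD := (sq_sum_mul_le (b := fun j => w1 j x) (hB₁ x hx κ hκm)).trans
    (hMle (b := M) (by positivity) (by linarith) hX0)
  have hη : 1 / 2 ≤ 1 + κ * Φ x ∧ 1 + κ * Φ x ≤ 3 / 2 := by
    have h2 : κ * M₃ ≤ 1 / 2 := by
      have := (le_div_iff₀ (by positivity)).1 hκκ
      linarith
    have h3 := mul_le_mul_of_nonneg_left (abs_le.1 bΦ).1 hκ.le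
    have h4 := mul_le_mul_of_nonneg_left (abs_le.1 bΦ).2 hκ.le
    constructor <;> linarith
  have key := carleman_pointwise (w := w x) (Lw := ∑ j, w2 j j x)
    (s := ∑ j, pderiv3 j Φ x * w1 j x) hh hκ hκε hκ1 hδ0.le (min_le_left _ _) hc₀
    hX0 hη.1 hη.2 (hc₀N x hx) ((le_abs_self _).trans (bN.trans (by linarith)))
    bY bD (bl.trans (by linarith)) (bDL.trans (by linarith)) hδM
    ((le_div_iff₀ (by positivity)).1 (hεε.trans (min_le_left _ _)))
    ((le_div_iff₀ (by positivity)).1 (hεε.trans (min_le_right _ _)))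
    (min_le_left (c₀ ^ 2 / 4) (δ / 2)) (min_le_right _ _)
  simp only [hdX, pderiv3_multiplier hΦ hLs hNs hl]
  simp only [pderiv3_pderiv3_convexify hΦ]
  simp only [pderiv3_convexify hΦ]
  refine key.trans (le_of_eq ?_)
  have hYs : ∑ j, Y j x * w1 j x = (∑ i, ∑ j, pderiv3 i (pderiv3 j Φ) x * pderiv3 i Φ x * w1 j x) /
      N x := by
    simp only [Y, Fin.sum_univ_three]
    ring
  have hHx := hH x hx fun j => w1 j x
  rw [show ∑ j, pderiv3 j Φ x ^ 2 = N x from rfl, ← hYs] at hHx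
  have hlx := hlN x hx
  rw [show ∑ j, pderiv3 j Φ x ^ 2 = N x from rfl] at hlx
  have S1 : ∑ j, ((1 + κ * Φ x) * pderiv3 j Φ x) ^ 2 = (1 + κ * Φ x) ^ 2 * N x := by
    simp only [N, Fin.sum_univ_three]
    ring
  have S2 : ∑ j, (1 + κ * Φ x) * pderiv3 j Φ x * w1 j x =
      (1 + κ * Φ x) * ∑ j, pderiv3 j Φ x * w1 j x := by
    simp only [Fin.sum_univ_three]
    ring
  have S3 : ∑ j, ((1 + κ * Φ x) * pderiv3 j (pderiv3 j Φ) x + κ * pderiv3 j Φ x * pderiv3 j Φ x) =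
      (1 + κ * Φ x) * L x + κ * N x := by
    simp only [L, N, Fin.sum_univ_three]
    ring
  have S4 : ∑ i, ∑ j, ((1 + κ * Φ x) * pderiv3 i (pderiv3 j Φ) x +
      κ * pderiv3 i Φ x * pderiv3 j Φ x) * w1 i x * w1 j x =
      (1 + κ * Φ x) * (∑ i, ∑ j, pderiv3 i (pderiv3 j Φ) x * w1 i x * w1 j x) +
        κ * (∑ j, pderiv3 j Φ x * w1 j x) ^ 2 := by
    simp only [Fin.sum_univ_three]
    ring
  have S5 : ∑ j, (1 + κ * Φ x) ^ 2 * N x * ((1 + κ * Φ x) * pderiv3 j Φ x) * w1 j x =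
      (1 + κ * Φ x) ^ 3 * N x * ∑ j, pderiv3 j Φ x * w1 j x := by
    simp only [Fin.sum_univ_three]
    ring
  have S6 : ∑ j, ((1 + κ * Φ x) ^ 2 * N x * ((1 + κ * Φ x) * pderiv3 j (pderiv3 j Φ) x +
      κ * pderiv3 j Φ x * pderiv3 j Φ x) + (1 + κ * Φ x) * pderiv3 j Φ x *
        ∑ k, 2 * ((1 + κ * Φ x) * pderiv3 k Φ x) * ((1 + κ * Φ x) * pderiv3 j (pderiv3 k Φ) x +
      κ * pderiv3 j Φ x * pderiv3 k Φ x)) = 2 * ((1 + κ * Φ x) ^ 3 *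
        (∑ i, ∑ j, pderiv3 i (pderiv3 j Φ) x * pderiv3 i Φ x * pderiv3 j Φ x) +
        κ * (1 + κ * Φ x) ^ 2 * N x ^ 2) +
        (1 + κ * Φ x) ^ 2 * N x * ((1 + κ * Φ x) * L x + κ * N x) := by
    simp only [L, N, Fin.sum_univ_three]
    ring
  -- The limiting condition enters here: `hHx` rewrites Φ''(∇w,∇w) and `hlx` rewrites Φ''(∇Φ,∇Φ) as
  -- lN.
  rw [S1, S2, S3, S4, S5, S6, hHx, ← hlx]
  simp only [dm]
  ring

end ConjugatedEstimate

/-! ### Undoing the conjugation. -/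

section WeightedEstimate

open Set

theorem pderiv3_exp_div {ψ : E3 → ℝ} (hψ : ContDiff ℝ ∞ ψ) (h : ℝ) (j : Fin 3) :
    pderiv3 j (fun x => Real.exp (ψ x / h)) = fun x =>
      Real.exp (ψ x / h) * (h⁻¹ * pderiv3 j ψ x) := by
  ext x
  have h1 : HasFDerivAt (fun x => Real.exp (ψ x / h))
      (Real.exp (ψ x / h) • h⁻¹ • fderiv ℝ ψ x) x := by
    simp only [div_eq_mul_inv]
    exact (((hψ.differentiable (by simp) x).hasFDerivAt).mul_const h⁻¹).exp
  simp [pderiv3, h1.fderiv]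

theorem pderiv3_pderiv3_exp_div {ψ : E3 → ℝ} (hψ : ContDiff ℝ ∞ ψ) (h : ℝ) (i j : Fin 3) (x : E3) :
    pderiv3 i (pderiv3 j (fun x => Real.exp (ψ x / h))) x =
      Real.exp (ψ x / h) * (h⁻¹ * pderiv3 i (pderiv3 j ψ) x +
        h⁻¹ * pderiv3 i ψ x * (h⁻¹ * pderiv3 j ψ x)) := by
  have hd := (contDiff_pderiv3 hψ j).differentiable (by simp) x
  have hψd := hψ.differentiable (by simp) x
  rw [pderiv3_exp_div hψ, pderiv3_mul (by fun_prop) (by fun_prop), pderiv3_exp_div hψ,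
    pderiv3_const_mul hd]
  ring

/-- Data on a smooth function `Φ` that make it a limiting Carleman weight on `K`. -/
structure IsSmoothCarlemanWeight (K : Set E3) (Φ l : E3 → ℝ) : Prop where
  contDiff : ContDiff ℝ ∞ Φ
  contDiff_factor : ContDiff ℝ ∞ l
  pos : ∀ x ∈ K, 0 < ∑ j, pderiv3 j Φ x ^ 2
  factor_mul : ∀ x ∈ K, l x * (∑ j, pderiv3 j Φ x ^ 2) =
    ∑ i, ∑ j, pderiv3 i (pderiv3 j Φ) x * pderiv3 i Φ x * pderiv3 j Φ x
  hessian_eq : ∀ x ∈ K, ∀ ξ : Fin 3 → ℝ, ∑ i, ∑ j, pderiv3 i (pderiv3 j Φ) x * ξ i * ξ j =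
    -(l x) * (∑ j, ξ j ^ 2) + 2 * (∑ j, pderiv3 j Φ x * ξ j) *
      ((∑ i, ∑ j, pderiv3 i (pderiv3 j Φ) x * pderiv3 i Φ x * ξ j) / ∑ j, pderiv3 j Φ x ^ 2)

/-- The weight `e^{ψ/h}` for the convexification `ψ` of `Φ`. -/
def expConvexify (κ h : ℝ) (Φ : E3 → ℝ) (x : E3) : ℝ := Real.exp (convexify κ Φ x / h)

theorem contDiff_expConvexify {κ h : ℝ} {Φ : E3 → ℝ} (hΦ : ContDiff ℝ ∞ Φ) :
    ContDiff ℝ ∞ (expConvexify κ h Φ) :=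
  Real.contDiff_exp.comp ((contDiff_convexify hΦ).div_const h)

/-- The Carleman estimate for real valued functions. -/
theorem exists_carleman_real {Ω : Set E3} (hΩ : IsOpen Ω) (hb : Bornology.IsBounded Ω)
    (hs : HasSmoothBoundary Ω) {Φ l : E3 → ℝ} (hW : IsSmoothCarlemanWeight (closure Ω) Φ l) :
    ∃ c > (0 : ℝ), ∃ ε₁ > (0 : ℝ), ∃ κ₁ > (0 : ℝ),
      (∀ κ, 0 < κ → κ ≤ κ₁ → ∀ x ∈ closure Ω, 1 / 2 ≤ 1 + κ * Φ x ∧ 1 + κ * Φ x ≤ 3 / 2) ∧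
      ∀ h ε κ : ℝ, 0 < h → 0 < ε → ε ≤ ε₁ → 0 < κ → κ ≤ κ₁ → κ * ε = h →
      ∀ (v : E3 → ℝ) (v1 : Fin 3 → E3 → ℝ) (v2 : Fin 3 → Fin 3 → E3 → ℝ) (T : Fin 3 → E3 → ℝ),
        IsH2Zero Ω v v1 v2 T →
        c * (h * κ) * (∫ x in Ω, expConvexify κ h Φ x ^ 2 *
            (v x ^ 2 + h ^ 2 * ∑ j, v1 j x ^ 2)) ≤
          (∫ x in Ω, expConvexify κ h Φ x ^ 2 * (h ^ 2 * ∑ j, v2 j j x) ^ 2) +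
          2 * h ^ 3 * ∫ x, (1 + κ * Φ x) * (∑ j, pderiv3 j Φ x * outerNormal Ω x j) *
            (expConvexify κ h Φ x ^ 2 * (∑ j, outerNormal Ω x j * T j x) ^ 2)
            ∂(surfaceMeasure Ω) := by
  obtain ⟨c, hc, ε₁, hε₁, κ₁, hκ₁, hκ₁1, hη, H⟩ := exists_carleman_conjugated hΩ hb hs hW.1 hW.2 hW.3
    hW.4 hW.5
  have hΦ := hW.contDiff
  obtain ⟨B, hB⟩ := hb.isCompact_closure.exists_bound_of_continuousOn
    (continuous_finsetSum Finset.univ fun j _ => (contDiff_pderiv3 hΦ j).continuous.pow 2).continuousOn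
  have hB0 : ∀ x ∈ closure Ω, ∑ j, pderiv3 j Φ x ^ 2 ≤ |B| := fun x hx =>
    ((le_abs_self _).trans (hB x hx)).trans (le_abs_self _)
  -- From f h∂_jv = h∂_jw - ∂_jψ w and |∇ψ|² ≤ (9/4)|B|, the weighted energy of v is at most
  -- 2h²|∇w|² + (1 + (9/2)|B|)w².
  set B' : ℝ := 2 + 9 / 2 * |B| with hB'
  have hB'0 : 0 < B' := by positivity
  refine ⟨c / B', by positivity, ε₁, hε₁, κ₁, hκ₁, hη, ?_⟩
  intro h ε κ hh hε hεε hκ hκκ hκε v v1 v2 T hv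
  have hψ : ContDiff ℝ ∞ (convexify κ Φ) := contDiff_convexify hΦ
  have hf : ContDiff ℝ ∞ (expConvexify κ h Φ) := contDiff_expConvexify hΦ
  have hw := hv.mul hΩ hb hf
  have key := H h ε κ hh hε hεε hκ hκκ hκε _ _ _ _ hw
  have hfj : ∀ j, pderiv3 j (expConvexify κ h Φ) = fun x =>
      expConvexify κ h Φ x * (h⁻¹ * pderiv3 j (convexify κ Φ) x) := pderiv3_exp_div hψ h
  have hfjj : ∀ j x, pderiv3 j (pderiv3 j (expConvexify κ h Φ)) x =
      expConvexify κ h Φ x * (h⁻¹ * pderiv3 j (pderiv3 j (convexify κ Φ)) x +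
        h⁻¹ * pderiv3 j (convexify κ Φ) x * (h⁻¹ * pderiv3 j (convexify κ Φ) x)) := fun j x =>
    pderiv3_pderiv3_exp_div hψ h j j x
  -- The conjugation itself: for w = e^{ψ/h}v the conjugated operator returns -e^{ψ/h}h²Δv.
  have e1 : ∀ x, (-h ^ 2 * (∑ j, (expConvexify κ h Φ x * v2 j j x + pderiv3 j (expConvexify κ h Φ) x *
      v1 j x + (pderiv3 j (expConvexify κ h Φ) x * v1 j x +
        pderiv3 j (pderiv3 j (expConvexify κ h Φ)) x * v x))) -
      (∑ j, pderiv3 j (convexify κ Φ) x ^ 2) * (expConvexify κ h Φ x * v x) +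
            h * (2 * (∑ j, pderiv3 j (convexify κ Φ) x * (expConvexify κ h Φ x * v1 j x +
              pderiv3 j (expConvexify κ h Φ) x * v x)) +
              (∑ j, pderiv3 j (pderiv3 j (convexify κ Φ)) x) * (expConvexify κ h Φ x * v x))) ^ 2 =
      expConvexify κ h Φ x ^ 2 * (h ^ 2 * ∑ j, v2 j j x) ^ 2 := by
    intro x
    simp only [hfjj]
    simp only [hfj, Fin.sum_univ_three]
    field_simp
    ring
  simp only [e1] at key
  have e2 : ∀ x, (∑ j, pderiv3 j (convexify κ Φ) x * outerNormal Ω x j) *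
      (∑ j, outerNormal Ω x j * (expConvexify κ h Φ x * T j x)) ^ 2 =
      (1 + κ * Φ x) * (∑ j, pderiv3 j Φ x * outerNormal Ω x j) *
            (expConvexify κ h Φ x ^ 2 * (∑ j, outerNormal Ω x j * T j x) ^ 2) := by
    intro x
    simp only [pderiv3_convexify hΦ, Fin.sum_univ_three]
    ring
  simp only [e2] at key
  refine le_trans ?_ key
  have m0 := hw.isH1Trace.memLp
  have m1 := hw.isH1Trace.memLp_partial
  have hmul : ∀ {c f : E3 → ℝ}, Continuous c → MemLp f 2 (volume.restrict Ω) →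
      MemLp (fun x => c x * f x) 2 (volume.restrict Ω) := fun hc hf =>
    memLp_smul_of_continuous hΩ hb hc hf
  have i1 : IntegrableOn (fun x => (expConvexify κ h Φ x * v x) ^ 2 + h ^ 2 * ∑ j,
      (expConvexify κ h Φ x * v1 j x + pderiv3 j (expConvexify κ h Φ) x * v x) ^ 2) Ω :=
    m0.integrable_sq.add ((integrable_finsetSum _ fun j _ => (m1 j).integrable_sq).const_mul _)
  have i2 : IntegrableOn (fun x => expConvexify κ h Φ x ^ 2 *
      (v x ^ 2 + h ^ 2 * ∑ j, v1 j x ^ 2)) Ω := by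
    have := m0.integrable_sq.add ((integrable_finsetSum Finset.univ fun j _ =>
      (hmul hf.continuous (hv.isH1Trace.memLp_partial j)).integrable_sq).const_mul (h ^ 2))
    refine this.congr (Eventually.of_forall fun x => ?_)
    simp only [Pi.add_apply, Fin.sum_univ_three]
    ring
  have hle : ∫ x in Ω, expConvexify κ h Φ x ^ 2 * (v x ^ 2 + h ^ 2 * ∑ j, v1 j x ^ 2) ≤
      B' * ∫ x in Ω, ((expConvexify κ h Φ x * v x) ^ 2 + h ^ 2 * ∑ j,
      (expConvexify κ h Φ x * v1 j x + pderiv3 j (expConvexify κ h Φ) x * v x) ^ 2) := by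
    rw [← integral_const_mul]
    refine integral_mono_ae i2 (i1.const_mul _) ?_
    filter_upwards [ae_mem_closure_restrict hΩ] with x hx
    have hηx := hη κ hκ hκκ x hx
    have hη2 : (1 + κ * Φ x) ^ 2 ≤ 9 / 4 := by nlinarith [hηx.1, hηx.2]
    have hBx := hB0 x hx
    have hNb : ∑ j, pderiv3 j (convexify κ Φ) x ^ 2 ≤ 9 / 4 * |B| := by
      have : ∑ j, pderiv3 j (convexify κ Φ) x ^ 2 =
          (1 + κ * Φ x) ^ 2 * ∑ j, pderiv3 j Φ x ^ 2 := by
        simp only [pderiv3_convexify hΦ, Fin.sum_univ_three]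
        ring
      rw [this]
      exact mul_le_mul hη2 hBx (Finset.sum_nonneg fun j _ => sq_nonneg _) (by norm_num)
    have hfx : ∀ j, pderiv3 j (expConvexify κ h Φ) x =
        expConvexify κ h Φ x * (h⁻¹ * pderiv3 j (convexify κ Φ) x) := fun j => by rw [hfj]
    generalize expConvexify κ h Φ x = f at *
    have hj : ∀ j, f ^ 2 * (h ^ 2 * v1 j x ^ 2) ≤ 2 * (h ^ 2 * (f * v1 j x +
        pderiv3 j (expConvexify κ h Φ) x * v x) ^ 2) +
        2 * (pderiv3 j (convexify κ Φ) x ^ 2 * (f * v x) ^ 2) := by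
      intro j
      have h1 : h * (f * v1 j x + pderiv3 j (expConvexify κ h Φ) x * v x) =
          f * h * v1 j x + pderiv3 j (convexify κ Φ) x * (f * v x) := by
        rw [hfx]
        field_simp
      rw [← mul_pow h (f * v1 j x + _), h1]
      linarith [sq_nonneg (f * h * v1 j x + 2 * (pderiv3 j (convexify κ Φ) x * (f * v x)))]
    have hw0 : 0 ≤ (f * v x) ^ 2 := sq_nonneg _
    have h3 := mul_le_mul_of_nonneg_right hNb hw0
    have h4 : 0 ≤ h ^ 2 * ∑ j, (f * v1 j x + pderiv3 j (expConvexify κ h Φ) x * v x) ^ 2 := by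
      positivity
    have h5 := mul_nonneg (abs_nonneg B) h4
    have h6 := mul_nonneg (abs_nonneg B) hw0
    simp only [Fin.sum_univ_three] at h3 h4 h5 h6 ⊢
    rw [hB']
    linarith [hj 0, hj 1, hj 2]
  have hhk : 0 < h * κ := mul_pos hh hκ
  calc c / B' * (h * κ) * _ ≤ c / B' * (h * κ) * (B' * _) :=
        mul_le_mul_of_nonneg_left hle (by positivity)
    _ = _ := by field_simp

end WeightedEstimate

/-! ### Complex valued functions and the sign splitting of the boundary term. -/

section ComplexEstimate

open Set

theorem MemH2.isH2Zero_comp {Ω : Set E3} (hΩ : IsOpen Ω) (hb : Bornology.IsBounded Ω)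
    (hs : HasSmoothBoundary Ω) {v : E3 → ℂ} (hv : MemH2 Ω v) (h0 : IsTrace Ω v 0) (L : ℂ →L[ℝ] ℝ) :
    IsH2Zero Ω (fun x => L (v x)) (fun j x => L (weakPartial Ω j v x))
      (fun j i x => L (weakPartial Ω i (weakPartial Ω j v) x))
      (fun j x => L (boundaryTrace Ω (weakPartial Ω j v) x)) := by
  refine ⟨?_, fun j => (isTrace_boundaryTrace hΩ hb hs (hv.2 j)).isH1Trace_comp L, fun i j => ?_⟩
  · have := h0.isH1Trace_comp L
    simp only [Pi.zero_apply, map_zero] at this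
    exact this
  · filter_upwards [weakPartial_comm_ae hΩ hb hv i j] with x hx
    rw [hx]

theorem norm_sq_eq_re_add_im (z : ℂ) : ‖z‖ ^ 2 = z.re ^ 2 + z.im ^ 2 := by
  rw [Complex.sq_norm, Complex.normSq_apply]
  ring

theorem memLp_normalDeriv {Ω : Set E3} (hΩ : IsOpen Ω) (hb : Bornology.IsBounded Ω)
    (hs : HasSmoothBoundary Ω) {v : E3 → ℂ} (hv : MemH2 Ω v) :
    MemLp (normalDeriv Ω v) 2 (surfaceMeasure Ω) := by
  refine memLp_finsetSum _ fun j _ => ?_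
  have hc : ContinuousOn (fun x => outerNormal Ω x j) (frontier Ω) :=
    (EuclideanSpace.proj (𝕜 := ℝ) j).continuous.comp_continuousOn (continuousOn_outerNormal hΩ hs)
  have := memLp_smul_of_continuousOn (isCompact_frontier_of_isBounded hb)
    (ae_mem_frontier_surfaceMeasure Ω) hc (aestronglyMeasurable_surfaceMeasure_of_continuousOn hc)
    (isTrace_boundaryTrace hΩ hb hs (hv.2 j)).2.1
  simpa only [Complex.real_smul] using this

theorem integrable_mul_norm_sq {α : Type*} [MeasurableSpace α] [TopologicalSpace α]
    {μ : Measure α} {K : Set α} (hK : IsCompact K) (hμ : ∀ᵐ x ∂μ, x ∈ K) {g : α → ℝ}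
    (hg : ContinuousOn g K) (hgm : AEStronglyMeasurable g μ) {F : α → ℂ} (hF : MemLp F 2 μ) :
    Integrable (fun x => g x * ‖F x‖ ^ 2) μ := by
  have h1 := memLp_smul_of_continuousOn hK hμ hg hgm hF.norm
  refine (h1.integrable_mul hF.norm).congr (Eventually.of_forall fun x => ?_)
  simp only [Pi.mul_apply, smul_eq_mul]
  ring

/-- The Carleman estimate for complex valued functions. -/
theorem exists_carleman_complex {Ω : Set E3} (hΩ : IsOpen Ω) (hb : Bornology.IsBounded Ω)
    (hs : HasSmoothBoundary Ω) {Φ l : E3 → ℝ} (hW : IsSmoothCarlemanWeight (closure Ω) Φ l) :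
    ∃ c > (0 : ℝ), ∃ ε₁ > (0 : ℝ), ∃ κ₁ > (0 : ℝ),
      (∀ κ, 0 < κ → κ ≤ κ₁ → ∀ x ∈ closure Ω, 1 / 2 ≤ 1 + κ * Φ x ∧ 1 + κ * Φ x ≤ 3 / 2) ∧
      ∀ h ε κ : ℝ, 0 < h → 0 < ε → ε ≤ ε₁ → 0 < κ → κ ≤ κ₁ → κ * ε = h →
      ∀ v : E3 → ℂ, MemH2 Ω v → IsTrace Ω v 0 →
        c * (h * κ) * (∫ x in Ω, expConvexify κ h Φ x ^ 2 *
            (‖v x‖ ^ 2 + h ^ 2 * ∑ j, ‖weakPartial Ω j v x‖ ^ 2)) ≤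
          (∫ x in Ω, expConvexify κ h Φ x ^ 2 * (h ^ 4 * ‖weakLaplacian Ω v x‖ ^ 2)) +
          2 * h ^ 3 * ∫ x, (1 + κ * Φ x) * (∑ j, pderiv3 j Φ x * outerNormal Ω x j) *
            (expConvexify κ h Φ x ^ 2 * ‖normalDeriv Ω v x‖ ^ 2) ∂(surfaceMeasure Ω) := by
  obtain ⟨c, hc, ε₁, hε₁, κ₁, hκ₁, hη, H⟩ := exists_carleman_real hΩ hb hs hW
  refine ⟨c, hc, ε₁, hε₁, κ₁, hκ₁, hη, ?_⟩
  intro h ε κ hh hε hεε hκ hκκ hκε v hv hv0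
  -- Laplacian, weight and normal are real, so real and imaginary parts satisfy the estimate
  -- separately, and squared moduli add.
  have hr := hv.isH2Zero_comp hΩ hb hs hv0 Complex.reCLM
  have hi := hv.isH2Zero_comp hΩ hb hs hv0 Complex.imCLM
  have kr := H h ε κ hh hε hεε hκ hκκ hκε _ _ _ _ hr
  have ki := H h ε κ hh hε hεε hκ hκκ hκε _ _ _ _ hi
  have hf : Continuous (expConvexify κ h Φ) := (contDiff_expConvexify hW.contDiff).continuous
  have hmul : ∀ {f : E3 → ℝ}, MemLp f 2 (volume.restrict Ω) →
      MemLp (fun x => expConvexify κ h Φ x * f x) 2 (volume.restrict Ω) := fun hF =>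
    memLp_smul_of_continuous hΩ hb hf hF
  have hI : ∀ {u : E3 → ℝ} {u1 : Fin 3 → E3 → ℝ} {u2 : Fin 3 → Fin 3 → E3 → ℝ} {T : Fin 3 → E3 → ℝ},
      IsH2Zero Ω u u1 u2 T →
      IntegrableOn (fun x => expConvexify κ h Φ x ^ 2 * (u x ^ 2 + h ^ 2 * ∑ j, u1 j x ^ 2)) Ω ∧
      IntegrableOn (fun x => expConvexify κ h Φ x ^ 2 * (h ^ 2 * ∑ j, u2 j j x) ^ 2) Ω := by
    intro u u1 u2 T hu
    constructor
    · have := (hmul hu.isH1Trace.memLp).integrable_sq.add ((integrable_finsetSum Finset.univ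
        fun j _ => (hmul (hu.isH1Trace.memLp_partial j)).integrable_sq).const_mul (h ^ 2))
      refine this.congr (Eventually.of_forall fun x => ?_)
      simp only [Pi.add_apply, Fin.sum_univ_three]
      ring
    · have := (hmul ((memLp_finsetSum Finset.univ fun j _ =>
        (hu.isH1Trace_partial j).memLp_partial j).const_mul (h ^ 2))).integrable_sq
      refine this.congr (Eventually.of_forall fun x => ?_)
      simp only [mul_pow]
  have hS : ∀ {T : Fin 3 → E3 → ℝ}, (∀ j, MemLp (T j) 2 (surfaceMeasure Ω)) →
      Integrable (fun x => (1 + κ * Φ x) * (∑ j, pderiv3 j Φ x * outerNormal Ω x j) *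
            (expConvexify κ h Φ x ^ 2 * (∑ j, outerNormal Ω x j * T j x) ^ 2))
            (surfaceMeasure Ω) := by
    intro T hT
    have hνc : ∀ j, ContinuousOn (fun x => outerNormal Ω x j) (frontier Ω) := fun j =>
      (EuclideanSpace.proj (𝕜 := ℝ) j).continuous.comp_continuousOn (continuousOn_outerNormal hΩ hs)
    have hK := isCompact_frontier_of_isBounded hb
    have hμ := ae_mem_frontier_surfaceMeasure Ω
    have h1 : MemLp (fun x => ∑ j, outerNormal Ω x j * T j x) 2 (surfaceMeasure Ω) :=
      memLp_finsetSum _ fun j _ => memLp_smul_of_continuousOn hK hμ (hνc j)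
        (aestronglyMeasurable_surfaceMeasure_of_continuousOn (hνc j)) (hT j)
    have h2 : ContinuousOn (fun x => (1 + κ * Φ x) * (∑ j, pderiv3 j Φ x * outerNormal Ω x j) *
        expConvexify κ h Φ x ^ 2) (frontier Ω) := by
      refine ContinuousOn.mul (ContinuousOn.mul ?_ ?_) (hf.pow 2).continuousOn
      · exact (continuous_const.add (continuous_const.mul hW.contDiff.continuous)).continuousOn
      · exact continuousOn_finsetSum _ fun j _ =>
          (contDiff_pderiv3 hW.contDiff j).continuous.continuousOn.mul (hνc j)
    have h3 := (memLp_smul_of_continuousOn hK hμ h2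
      (aestronglyMeasurable_surfaceMeasure_of_continuousOn h2) h1).integrable_mul h1
    refine h3.congr (Eventually.of_forall fun x => ?_)
    simp only [Pi.mul_apply, smul_eq_mul]
    ring
  have e1 := integral_add (hI hr).1 (hI hi).1
  have e2 := integral_add (hI hr).2 (hI hi).2
  have e3 := integral_add (hS fun j => (hr.isH1Trace_partial j).memLp_trace)
    (hS fun j => (hi.isH1Trace_partial j).memLp_trace)
  have c1 : ∀ x, expConvexify κ h Φ x ^ 2 *
      (‖v x‖ ^ 2 + h ^ 2 * ∑ j, ‖weakPartial Ω j v x‖ ^ 2) =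
      expConvexify κ h Φ x ^ 2 * (Complex.reCLM (v x) ^ 2 + h ^ 2 * ∑ j,
        Complex.reCLM (weakPartial Ω j v x) ^ 2) + expConvexify κ h Φ x ^ 2 *
        (Complex.imCLM (v x) ^ 2 + h ^ 2 * ∑ j, Complex.imCLM (weakPartial Ω j v x) ^ 2) := by
    intro x
    simp only [norm_sq_eq_re_add_im, Finset.sum_add_distrib, Complex.reCLM_apply,
      Complex.imCLM_apply]
    ring
  have c2 : ∀ x, expConvexify κ h Φ x ^ 2 * (h ^ 4 * ‖weakLaplacian Ω v x‖ ^ 2) =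
      expConvexify κ h Φ x ^ 2 * (h ^ 2 * ∑ j, Complex.reCLM
        (weakPartial Ω j (weakPartial Ω j v) x)) ^ 2 + expConvexify κ h Φ x ^ 2 *
        (h ^ 2 * ∑ j, Complex.imCLM (weakPartial Ω j (weakPartial Ω j v) x)) ^ 2 := by
    intro x
    simp only [norm_sq_eq_re_add_im, weakLaplacian, Complex.reCLM_apply, Complex.imCLM_apply,
      Complex.re_sum, Complex.im_sum]
    ring
  have c3 : ∀ x, (1 + κ * Φ x) * (∑ j, pderiv3 j Φ x * outerNormal Ω x j) *
            (expConvexify κ h Φ x ^ 2 * ‖normalDeriv Ω v x‖ ^ 2) =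
      (1 + κ * Φ x) * (∑ j, pderiv3 j Φ x * outerNormal Ω x j) *
            (expConvexify κ h Φ x ^ 2 * (∑ j, outerNormal Ω x j *
              Complex.reCLM (boundaryTrace Ω (weakPartial Ω j v) x)) ^ 2) +
      (1 + κ * Φ x) * (∑ j, pderiv3 j Φ x * outerNormal Ω x j) *
            (expConvexify κ h Φ x ^ 2 * (∑ j, outerNormal Ω x j *
              Complex.imCLM (boundaryTrace Ω (weakPartial Ω j v) x)) ^ 2) := by
    intro x
    simp only [norm_sq_eq_re_add_im, normalDeriv, Complex.reCLM_apply, Complex.imCLM_apply,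
      Complex.re_sum, Complex.im_sum, Complex.re_ofReal_mul, Complex.im_ofReal_mul]
    ring
  simp only [c1, c2, c3]
  rw [e1, e2, e3]
  linarith

theorem measurableSet_boundaryPlus {Ω : Set E3} {φ : E3 → ℝ}
    (hφ : ContinuousOn (normalDerivWeight Ω φ) (frontier Ω)) :
    MeasurableSet (boundaryPlus Ω φ) :=
  (hφ.preimage_isClosed_of_isClosed isClosed_frontier isClosed_Ici).measurableSet

theorem measurableSet_boundaryMinus {Ω : Set E3} {φ : E3 → ℝ}
    (hφ : ContinuousOn (normalDerivWeight Ω φ) (frontier Ω)) :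
    MeasurableSet (boundaryMinus Ω φ) :=
  (hφ.neg.preimage_isClosed_of_isClosed isClosed_frontier isClosed_Ici).measurableSet

/-- Splitting of the boundary term. -/
theorem integral_surfaceMeasure_le {Ω : Set E3} {φ η G : E3 → ℝ}
    (hφ : ContinuousOn (normalDerivWeight Ω φ) (frontier Ω))
    (hη : ∀ x ∈ frontier Ω, 1 / 2 ≤ η x ∧ η x ≤ 3 / 2) (hG : ∀ x, 0 ≤ G x)
    (hi : Integrable (fun x => normalDerivWeight Ω φ x * G x) (surfaceMeasure Ω))
    (hi' : Integrable (fun x => η x * normalDerivWeight Ω φ x * G x) (surfaceMeasure Ω)) :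
    2 * ∫ x, η x * normalDerivWeight Ω φ x * G x ∂(surfaceMeasure Ω) ≤
      (∫ x in boundaryMinus Ω φ, normalDerivWeight Ω φ x * G x ∂(surfaceMeasure Ω)) +
      3 * ∫ x in boundaryPlus Ω φ, normalDerivWeight Ω φ x * G x ∂(surfaceMeasure Ω) := by
  have hp := measurableSet_boundaryPlus hφ
  have hm := measurableSet_boundaryMinus hφ
  rw [← integral_indicator hp, ← integral_indicator hm, ← integral_const_mul, ← integral_const_mul,
    ← integral_add (hi.indicator hm) ((hi.indicator hp).const_mul 3)]
  refine integral_mono_ae (hi'.const_mul 2) ((hi.indicator hm).add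
    ((hi.indicator hp).const_mul 3)) ?_
  filter_upwards [ae_mem_frontier_surfaceMeasure Ω] with x hx
  have hηx := hη x hx
  -- The bound 2η ≤ 3 is used where ∂_νφ ≥ 0, and 2η ≥ 1 where ∂_νφ < 0. The two boundary parts
  -- overlap only where the integrand vanishes.
  rcases le_or_gt 0 (normalDerivWeight Ω φ x) with h0 | h0
  · have h1 : x ∈ boundaryPlus Ω φ := ⟨hx, h0⟩
    have hg := mul_nonneg h0 (hG x)
    rw [indicator_of_mem h1]
    by_cases h2 : x ∈ boundaryMinus Ω φ
    · rw [indicator_of_mem h2]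
      nlinarith
    · rw [indicator_of_notMem h2]
      nlinarith
  · have h1 : x ∉ boundaryPlus Ω φ := fun h => absurd h.2 (not_le.2 h0)
    have h2 : x ∈ boundaryMinus Ω φ := ⟨hx, by simpa using h0.le⟩
    have hg := mul_nonneg (neg_nonneg.2 h0.le) (hG x)
    rw [indicator_of_notMem h1, indicator_of_mem h2]
    nlinarith

end ComplexEstimate

/-! ### Bounds and measurability for the cut-off lower order terms. -/

section Coefficients

open Set

/-- The first derivatives of a function that is smooth up to the boundary are bounded. -/
theorem exists_norm_pderiv3_le {Ω : Set E3} (hΩ : IsOpen Ω) (hb : Bornology.IsBounded Ω)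
    {q : E3 → ℂ} (hq : ContDiffOn ℝ ∞ q (closure Ω)) :
    ∃ B, ∀ x ∈ Ω, ∀ j, ‖pderiv3 j q x‖ ≤ B := by
  -- Smoothness on the closure controls `fderiv` only at interior points, where it agrees with a
  -- derivative within the closure. The latter is continuous near each point of the closure, and
  -- compactness glues the local bounds.
  have h : ∃ B, ∀ x ∈ closure Ω ∩ Ω, ‖fderiv ℝ q x‖ ≤ B := by
    refine hb.isCompact_closure.induction_on (p := fun t => ∃ B, ∀ x ∈ t ∩ Ω, ‖fderiv ℝ q x‖ ≤ B)
      ⟨0, by simp⟩ ?_ ?_ ?_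
    · rintro s t hst ⟨B, hB⟩
      exact ⟨B, fun x hx => hB x ⟨hst hx.1, hx.2⟩⟩
    · rintro s t ⟨B, hB⟩ ⟨B', hB'⟩
      refine ⟨max B B', ?_⟩
      rintro x ⟨hx | hx, hxΩ⟩
      · exact (hB x ⟨hx, hxΩ⟩).trans (le_max_left _ _)
      · exact (hB' x ⟨hx, hxΩ⟩).trans (le_max_right _ _)
    · intro x hx
      have h1 : ContDiffWithinAt ℝ (0 + 1) q (closure Ω) x := (hq x hx).of_le (by simp)
      obtain ⟨u, hu, -, -, f', hf', hc⟩ :=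
        (contDiffWithinAt_succ_iff_hasFDerivWithinAt' (by simp)).1 h1
      rw [insert_eq_of_mem hx] at hu
      have h2 : ∀ᶠ y in 𝓝[closure Ω] x, ‖f' y‖ < ‖f' x‖ + 1 :=
        hc.continuousWithinAt.norm.eventually_lt tendsto_const_nhds (by linarith)
      refine ⟨_, inter_mem hu h2, ‖f' x‖ + 1, ?_⟩
      rintro y ⟨⟨hyu, hy⟩, hyΩ⟩
      have h3 : HasFDerivAt q (f' y) y := (hf' y hyu).hasFDerivAt
        (mem_of_superset (hΩ.mem_nhds hyΩ) subset_closure)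
      rw [h3.fderiv]
      exact le_of_lt hy
  obtain ⟨B, hB⟩ := h
  refine ⟨B, fun x hx j => ?_⟩
  have h1 := (fderiv ℝ q x).le_opNorm (EuclideanSpace.single j 1)
  simp only [PiLp.norm_single, norm_one, mul_one] at h1
  exact h1.trans (hB x ⟨subset_closure hx, hx⟩)

theorem norm_pauli_apply_le (j : Fin 3) (a b : Fin 2) : ‖pauli j a b‖ ≤ 1 := by
  fin_cases j <;> fin_cases a <;> fin_cases b <;> simp [pauli]

theorem norm_sigmaDot_apply_le {z : Fin 3 → ℂ} {B : ℝ} (hz : ∀ j, ‖z j‖ ≤ B) (a b : Fin 2) :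
    ‖sigmaDot z a b‖ ≤ 3 * B := by
  have hB : 0 ≤ B := (norm_nonneg _).trans (hz 0)
  rw [sigmaDot, Matrix.sum_apply]
  refine (norm_sum_le _ _).trans ?_
  have : ∀ j, ‖(z j • pauli j) a b‖ ≤ B := fun j => by
    rw [Matrix.smul_apply, smul_eq_mul, norm_mul]
    exact (mul_le_mul (hz j) (norm_pauli_apply_le j a b) (norm_nonneg _) hB).trans (by simp)
  refine (Finset.sum_le_sum fun j _ => this j).trans ?_
  simp

theorem norm_mulVec_le {M : Matrix (Fin 2) (Fin 2) ℂ} {m : ℝ} (hM : ∀ a b, ‖M a b‖ ≤ m)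
    (u : Fin 2 → ℂ) (a : Fin 2) : ‖M.mulVec u a‖ ≤ m * ∑ b, ‖u b‖ := by
  simp only [Matrix.mulVec, dotProduct]
  refine (norm_sum_le _ _).trans ?_
  rw [Finset.mul_sum]
  refine Finset.sum_le_sum fun b _ => ?_
  rw [norm_mul]
  exact mul_le_mul_of_nonneg_right (hM a b) (norm_nonneg _)

/-- The cut-off replaces the possibly unbounded factor 1/q by √|log h^α|, which is uniform in x even
where q vanishes. -/
theorem norm_cutoffMatrix_apply_le {q : E3 → ℂ} {α h B : ℝ} {x : E3}
    (hq : ∀ j, ‖pderiv3 j q x‖ ≤ B) (a b : Fin 2) :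
    ‖cutoffMatrix q α h x a b‖ ≤ √(absLog α h) * (3 * B) := by
  have hB : 0 ≤ B := (norm_nonneg _).trans (hq 0)
  unfold cutoffMatrix
  split_ifs with hx
  · rw [Matrix.smul_apply, smul_eq_mul, norm_mul]
    refine mul_le_mul hx.2 (norm_sigmaDot_apply_le (fun j => ?_) a b) (norm_nonneg _)
      (Real.sqrt_nonneg _)
    simpa using hq j
  · simp only [Matrix.zero_apply, norm_zero]
    positivity

theorem norm_weakD (Ω : Set E3) (j : Fin 3) (w : E3 → ℂ) (x : E3) :
    ‖weakD Ω j w x‖ = ‖weakPartial Ω j w x‖ := by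
  simp [weakD]

/-- The lower order terms `Â v + q̂ v`. -/
def lowerOrder (Ω : Set E3) (A : E3 → E3) (q qt : E3 → ℂ) (α h : ℝ) (v : Fin 2 → E3 → ℂ) (x : E3)
    (a : Fin 2) : ℂ :=
  hatA Ω A q α h v x a + (hatq A q qt α h x).mulVec (fun a => v a x) a

theorem hatOp_apply (Ω : Set E3) (A : E3 → E3) (q qt : E3 → ℂ) (α h : ℝ) (v : Fin 2 → E3 → ℂ)
    (x : E3) (a : Fin 2) :
    hatOp Ω A q qt α h v x a = -weakLaplacian Ω (v a) x + lowerOrder Ω A q qt α h v x a := by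
  simp only [hatOp, lowerOrder, Pi.add_apply]
  ring

theorem norm_lowerOrder_le {Ω : Set E3} {A : E3 → E3} {q qt : E3 → ℂ} {α h B : ℝ}
    {v : Fin 2 → E3 → ℂ} {x : E3} (hB : 1 ≤ B) (hA : ∀ j, ‖A x j‖ ≤ B)
    (hq : ∀ j, ‖pderiv3 j q x‖ ≤ B) (hqt : ‖qt x‖ ≤ B) (a : Fin 2) :
    ‖lowerOrder Ω A q qt α h v x a‖ ≤ 27 * B ^ 2 * (1 + √(absLog α h)) *
      ((∑ j, ∑ b, ‖weakPartial Ω j (v b) x‖) + ∑ b, ‖v b x‖) := by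
  set r := √(absLog α h) with hr
  have hr0 : 0 ≤ r := Real.sqrt_nonneg _
  set S1 := ∑ j, ∑ b, ‖weakPartial Ω j (v b) x‖ with hS1
  set S0 := ∑ b, ‖v b x‖ with hS0
  have hS1' : 0 ≤ S1 := Finset.sum_nonneg fun j _ => Finset.sum_nonneg fun b _ => norm_nonneg _
  have hS0' : 0 ≤ S0 := Finset.sum_nonneg fun b _ => norm_nonneg _
  have hcut : ∀ a b, ‖cutoffMatrix q α h x a b‖ ≤ r * (3 * B) :=
    norm_cutoffMatrix_apply_le hq
  have t1 : ‖2 * ∑ j, (A x j : ℂ) * weakD Ω j (v a) x‖ ≤ 2 * (B * S1) := by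
    rw [norm_mul, Complex.norm_two]
    refine mul_le_mul_of_nonneg_left ((norm_sum_le _ _).trans ?_) (by norm_num)
    rw [hS1, Finset.mul_sum]
    refine Finset.sum_le_sum fun j _ => ?_
    rw [norm_mul, norm_weakD, Complex.norm_real]
    exact mul_le_mul (hA j) (Finset.single_le_sum (f := fun b => ‖weakPartial Ω j (v b) x‖)
      (fun b _ => norm_nonneg _) (Finset.mem_univ a)) (norm_nonneg _) (by linarith)
  have t2 : ∀ b, ‖(∑ j, (pauli j).mulVec (fun a => weakD Ω j (v a) x)) b‖ ≤ S1 := by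
    intro b
    rw [Finset.sum_apply]
    refine (norm_sum_le _ _).trans (Finset.sum_le_sum fun j _ => ?_)
    refine (norm_mulVec_le (norm_pauli_apply_le j) _ _).trans (le_of_eq ?_)
    simp only [norm_weakD, one_mul]
  have t3 : ‖(cutoffMatrix q α h x).mulVec
      (∑ j, (pauli j).mulVec (fun a => weakD Ω j (v a) x)) a‖ ≤ r * (3 * B) * (2 * S1) := by
    refine (norm_mulVec_le hcut _ _).trans (mul_le_mul_of_nonneg_left ?_ (by positivity))
    refine (Finset.sum_le_sum fun b _ => t2 b).trans (le_of_eq ?_)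
    simp
  have t4 : ∀ a b, ‖hatq A q qt α h x a b‖ ≤ 18 * r * B ^ 2 + B := by
    intro a b
    rw [hatq, Matrix.add_apply, Matrix.neg_apply, Matrix.mul_apply]
    refine (norm_add_le _ _).trans (add_le_add ?_ ?_)
    · rw [norm_neg]
      refine (norm_sum_le _ _).trans ?_
      have : ∀ k, ‖cutoffMatrix q α h x a k * sigmaDot (fun j => (A x j : ℂ)) k b‖ ≤
          r * (3 * B) * (3 * B) := fun k => by
        rw [norm_mul]
        refine mul_le_mul (hcut a k) (norm_sigmaDot_apply_le (fun j => ?_) k b) (norm_nonneg _)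
          (by positivity)
        rw [Complex.norm_real]
        exact hA j
      refine (Finset.sum_le_sum fun k _ => this k).trans (le_of_eq ?_)
      simp
      ring
    · rw [Matrix.smul_apply, smul_eq_mul, norm_mul]
      have h1 : ‖(1 : Matrix (Fin 2) (Fin 2) ℂ) a b‖ ≤ 1 := by
        rw [Matrix.one_apply]
        split_ifs <;> simp
      exact (mul_le_mul hqt h1 (norm_nonneg _) (by linarith)).trans (mul_one B).le
  have t5 := norm_mulVec_le t4 (fun a => v a x) a
  rw [lowerOrder, hatA, Pi.sub_apply]
  refine (norm_add_le _ _).trans ((add_le_add (norm_sub_le _ _) le_rfl).trans ?_)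
  refine (add_le_add (add_le_add t1 t3) t5).trans ?_
  change _ + (18 * r * B ^ 2 + B) * S0 ≤ _
  have hB2 : B ≤ B ^ 2 := by nlinarith
  have e1 : B * S1 ≤ B ^ 2 * S1 := mul_le_mul_of_nonneg_right hB2 hS1'
  have e2 : B * S0 ≤ B ^ 2 * S0 := mul_le_mul_of_nonneg_right hB2 hS0'
  have e3 : r * (B * S1) ≤ r * (B ^ 2 * S1) := mul_le_mul_of_nonneg_left e1 hr0
  have p1 : 0 ≤ B ^ 2 * S1 := by positivity
  have p2 : 0 ≤ B ^ 2 * S0 := by positivity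
  have p3 : 0 ≤ r * (B ^ 2 * S1) := by positivity
  have p4 : 0 ≤ r * (B ^ 2 * S0) := by positivity
  linarith

/-- Squaring turns the growth √|log h^α| into |log h^α|, the order of 1/ε, so a large C₀ can absorb
it. -/
theorem sum_norm_lowerOrder_sq_le {Ω : Set E3} {A : E3 → E3} {q qt : E3 → ℂ} {α h B : ℝ}
    {v : Fin 2 → E3 → ℂ} {x : E3} (hB : 1 ≤ B) (hA : ∀ j, ‖A x j‖ ≤ B)
    (hq : ∀ j, ‖pderiv3 j q x‖ ≤ B) (hqt : ‖qt x‖ ≤ B) :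
    ∑ a, ‖lowerOrder Ω A q qt α h v x a‖ ^ 2 ≤ 32 * (27 * B ^ 2) ^ 2 * (1 + absLog α h) *
      ∑ b, (‖v b x‖ ^ 2 + ∑ j, ‖weakPartial Ω j (v b) x‖ ^ 2) := by
  have h1 := norm_lowerOrder_le (Ω := Ω) (v := v) (α := α) (h := h) hB hA hq hqt
  set S := (∑ j, ∑ b, ‖weakPartial Ω j (v b) x‖) + ∑ b, ‖v b x‖ with hS
  have hS2 : S ^ 2 ≤ 8 * ∑ b, (‖v b x‖ ^ 2 + ∑ j, ‖weakPartial Ω j (v b) x‖ ^ 2) := by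
    have h4 : ∀ y z t s : ℝ, (y + z + t + s) ^ 2 ≤ 4 * (y ^ 2 + z ^ 2 + t ^ 2 + s ^ 2) := by
      intro y z t s
      linarith [sq_nonneg (y - z), sq_nonneg (y - t), sq_nonneg (y - s), sq_nonneg (z - t),
        sq_nonneg (z - s), sq_nonneg (t - s)]
    have e0 := h4 ‖v 0 x‖ ‖weakPartial Ω 0 (v 0) x‖ ‖weakPartial Ω 1 (v 0) x‖
      ‖weakPartial Ω 2 (v 0) x‖
    have e1 := h4 ‖v 1 x‖ ‖weakPartial Ω 0 (v 1) x‖ ‖weakPartial Ω 1 (v 1) x‖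
      ‖weakPartial Ω 2 (v 1) x‖
    have e2 := add_sq_le
      (a := ‖v 0 x‖ + ‖weakPartial Ω 0 (v 0) x‖ + ‖weakPartial Ω 1 (v 0) x‖ +
        ‖weakPartial Ω 2 (v 0) x‖)
      (b := ‖v 1 x‖ + ‖weakPartial Ω 0 (v 1) x‖ + ‖weakPartial Ω 1 (v 1) x‖ +
        ‖weakPartial Ω 2 (v 1) x‖)
    rw [hS]
    simp only [Fin.sum_univ_three, Fin.sum_univ_two]
    linarith
  have hL : 0 ≤ absLog α h := abs_nonneg _
  have hr2 : (1 + √(absLog α h)) ^ 2 ≤ 2 * (1 + absLog α h) := by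
    have := Real.sq_sqrt hL
    nlinarith [sq_nonneg (1 - √(absLog α h))]
  have h2 : ∀ a, ‖lowerOrder Ω A q qt α h v x a‖ ^ 2 ≤
      (27 * B ^ 2) ^ 2 * (2 * (1 + absLog α h)) *
        (8 * ∑ b, (‖v b x‖ ^ 2 + ∑ j, ‖weakPartial Ω j (v b) x‖ ^ 2)) := by
    intro a
    refine (pow_le_pow_left₀ (norm_nonneg _) (h1 a) 2).trans ?_
    rw [mul_pow, mul_pow]
    refine mul_le_mul (mul_le_mul_of_nonneg_left hr2 (by positivity)) hS2 (sq_nonneg _)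
      (by positivity)
  refine (Finset.sum_le_sum fun a _ => h2 a).trans (le_of_eq ?_)
  rw [Fin.sum_univ_two]
  ring

/-- As q is controlled only on Ω, the cut-off set is replaced by that of the extension of q by zero,
which is Borel measurable and yields the same matrix on Ω. -/
theorem aestronglyMeasurable_cutoffMatrix {Ω : Set E3} (hΩ : IsOpen Ω) {q : E3 → ℂ}
    (hq : ContinuousOn q Ω) (α h : ℝ) (a b : Fin 2) :
    AEStronglyMeasurable (fun x => cutoffMatrix q α h x a b) (volume.restrict Ω) := by
  classical
  let q' : E3 → ℂ := Ω.indicator q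
  have hq' : Measurable q' := by
    have := (hq.measurable_piecewise (g := fun _ => (0 : ℂ)) continuousOn_const hΩ.measurableSet)
    exact this
  have hset : MeasurableSet (cutoffSet q' α h) :=
    ((hq' (measurableSet_singleton 0)).compl).inter
      (measurableSet_le ((measurable_const.div hq').norm) measurable_const)
  have hd : ∀ j, Measurable (pderiv3 j q) := fun j => measurable_fderiv_apply_const ℝ q _
  have hm : Measurable ((cutoffSet q' α h).indicator fun x =>
      1 / q' x * ∑ j, -Complex.I * pderiv3 j q x * pauli j a b) := by
    refine Measurable.indicator ?_ hset
    refine (measurable_const.div hq').mul (Finset.measurable_sum _ fun j _ => ?_)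
    exact (measurable_const.mul (hd j)).mul_const _
  refine hm.aestronglyMeasurable.congr ?_
  filter_upwards [ae_restrict_mem hΩ.measurableSet] with x hx
  have hqx : q' x = q x := indicator_of_mem hx q
  have hmem : x ∈ cutoffSet q' α h ↔ x ∈ cutoffSet q α h := by
    change (_ ∧ _) ↔ (_ ∧ _)
    rw [hqx]
  unfold cutoffMatrix
  by_cases h1 : x ∈ cutoffSet q α h
  · rw [if_pos h1, indicator_of_mem (hmem.2 h1), Matrix.smul_apply, sigmaDot, Matrix.sum_apply, hqx]
    simp [Matrix.smul_apply]
  · rw [if_neg h1, indicator_of_notMem (fun h2 => h1 (hmem.1 h2))]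
    simp

theorem aestronglyMeasurable_lowerOrder {Ω : Set E3} (hΩ : IsOpen Ω) {A : E3 → E3}
    (hA : ContinuousOn A Ω) {q qt : E3 → ℂ} (hq : ContinuousOn q Ω) (hqt : ContinuousOn qt Ω)
    (α h : ℝ) {v : Fin 2 → E3 → ℂ} (hv : ∀ a, MemH1 Ω (v a)) (a : Fin 2) :
    AEStronglyMeasurable (fun x => lowerOrder Ω A q qt α h v x a) (volume.restrict Ω) := by
  have hc := aestronglyMeasurable_cutoffMatrix hΩ hq α h
  have hAj : ∀ j, AEStronglyMeasurable (fun x => (A x j : ℂ)) (volume.restrict Ω) := fun j =>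
    (Complex.continuous_ofReal.comp_continuousOn ((EuclideanSpace.proj (𝕜 := ℝ)
      j).continuous.comp_continuousOn hA)).aestronglyMeasurable hΩ.measurableSet
  have hqtm := hqt.aestronglyMeasurable (μ := volume) hΩ.measurableSet
  have hD : ∀ j a, AEStronglyMeasurable (fun x => weakD Ω j (v a) x) (volume.restrict Ω) :=
    fun j a => ((hv a).hasWeakPartial j).1.1.const_mul _
  have hv0 : ∀ a, AEStronglyMeasurable (v a) (volume.restrict Ω) := fun a => (hv a).1.1
  simp only [lowerOrder, hatA, hatq, sigmaDot, Matrix.mulVec, dotProduct, Pi.sub_apply,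
    Finset.sum_apply, Matrix.add_apply, Matrix.neg_apply, Matrix.mul_apply, Matrix.sum_apply,
    Matrix.smul_apply, smul_eq_mul]
  simp only [Fin.sum_univ_three, Fin.sum_univ_two]
  have := hc a 0
  have := hc a 1
  have := hAj 0
  have := hAj 1
  have := hAj 2
  have := hD 0 0
  have := hD 0 1
  have := hD 1 0
  have := hD 1 1
  have := hD 2 0
  have := hD 2 1
  have := hD 0 a
  have := hD 1 a
  have := hD 2 a
  have := hv0 0
  have := hv0 1
  fun_prop

end Coefficients

/-! ### The Carleman estimate for two components, and the choice of small parameters. -/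

section System

open Set

theorem integrableOn_mul_norm_sq {Ω : Set E3} (hΩ : IsOpen Ω) (hb : Bornology.IsBounded Ω)
    {g : E3 → ℝ} (hg : Continuous g) {w : E3 → ℂ} (hw : MemL2 Ω w) :
    IntegrableOn (fun x => g x * ‖w x‖ ^ 2) Ω :=
  integrable_mul_norm_sq hb.isCompact_closure (ae_mem_closure_restrict hΩ) hg.continuousOn
    hg.aestronglyMeasurable hw

theorem memL2_weakLaplacian {Ω : Set E3} {v : E3 → ℂ} (hv : MemH2 Ω v) :
    MemL2 Ω (weakLaplacian Ω v) :=
  memLp_finsetSum _ fun j _ => ((hv.2 j).hasWeakPartial j).1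

theorem integrableOn_energy {Ω : Set E3} (hΩ : IsOpen Ω) (hb : Bornology.IsBounded Ω)
    {f : E3 → ℝ} (hf : Continuous f) (h : ℝ) {v : E3 → ℂ} (hv : MemH1 Ω v) :
    IntegrableOn (fun x => f x ^ 2 * (‖v x‖ ^ 2 + h ^ 2 * ∑ j, ‖weakPartial Ω j v x‖ ^ 2)) Ω := by
  have h1 := (integrableOn_mul_norm_sq hΩ hb (hf.pow 2) hv.1).add
    ((integrable_finsetSum Finset.univ fun j _ =>
      integrableOn_mul_norm_sq hΩ hb (hf.pow 2) (hv.hasWeakPartial j).1).const_mul (h ^ 2))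
  refine h1.congr (Eventually.of_forall fun x => ?_)
  simp only [Pi.add_apply, Fin.sum_univ_three, Pi.pow_apply]
  ring

theorem normalDerivWeight_eq_sum {Ω : Set E3} {φ Φ : E3 → ℝ}
    (hφ : ∀ x ∈ closure Ω, ∀ j, gradient φ x j = pderiv3 j Φ x) {x : E3} (hx : x ∈ frontier Ω) :
    normalDerivWeight Ω φ x = ∑ j, pderiv3 j Φ x * outerNormal Ω x j := by
  rw [normalDerivWeight, inner_eq_sum_E3]
  simp only [hφ x (frontier_subset_closure hx)]

theorem continuousOn_normalDerivWeight {Ω : Set E3} (hΩ : IsOpen Ω) (hs : HasSmoothBoundary Ω)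
    {φ Φ : E3 → ℝ} (hΦ : ContDiff ℝ ∞ Φ)
    (hφ : ∀ x ∈ closure Ω, ∀ j, gradient φ x j = pderiv3 j Φ x) :
    ContinuousOn (normalDerivWeight Ω φ) (frontier Ω) := by
  refine ContinuousOn.congr (continuousOn_finsetSum Finset.univ fun j _ => ?_) fun x hx =>
    normalDerivWeight_eq_sum hφ hx
  exact (contDiff_pderiv3 hΦ j).continuous.continuousOn.mul
    ((EuclideanSpace.proj (𝕜 := ℝ) j).continuous.comp_continuousOn (continuousOn_outerNormal hΩ hs))

/-- The Carleman estimate for `ℂ²`-valued functions, with the boundary term split according to the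
sign of the normal derivative of the weight. -/
theorem exists_carleman_system {Ω : Set E3} (hΩ : IsOpen Ω) (hb : Bornology.IsBounded Ω)
    (hs : HasSmoothBoundary Ω) {φ Φ l : E3 → ℝ} (hW : IsSmoothCarlemanWeight (closure Ω) Φ l)
    (hφ : ∀ x ∈ closure Ω, ∀ j, gradient φ x j = pderiv3 j Φ x) :
    ∃ c > (0 : ℝ), ∃ ε₁ > (0 : ℝ), ∃ κ₁ > (0 : ℝ),
      ∀ h ε κ : ℝ, 0 < h → 0 < ε → ε ≤ ε₁ → 0 < κ → κ ≤ κ₁ → κ * ε = h →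
      ∀ v : Fin 2 → E3 → ℂ, (∀ a, MemH2 Ω (v a)) → (∀ a, IsTrace Ω (v a) 0) →
        c * (h * κ) * (∫ x in Ω, ∑ a, expConvexify κ h Φ x ^ 2 *
            (‖v a x‖ ^ 2 + h ^ 2 * ∑ j, ‖weakPartial Ω j (v a) x‖ ^ 2)) ≤
          (∫ x in Ω, ∑ a, expConvexify κ h Φ x ^ 2 * (h ^ 4 * ‖weakLaplacian Ω (v a) x‖ ^ 2)) +
          h ^ 3 * (∫ x in boundaryMinus Ω φ, normalDerivWeight Ω φ x *
            (∑ a, expConvexify κ h Φ x ^ 2 * ‖normalDeriv Ω (v a) x‖ ^ 2) ∂(surfaceMeasure Ω)) +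
          3 * h ^ 3 * ∫ x in boundaryPlus Ω φ, normalDerivWeight Ω φ x *
            (∑ a, expConvexify κ h Φ x ^ 2 * ‖normalDeriv Ω (v a) x‖ ^ 2)
              ∂(surfaceMeasure Ω) := by
  obtain ⟨c, hc, ε₁, hε₁, κ₁, hκ₁, hη, H⟩ := exists_carleman_complex hΩ hb hs hW
  refine ⟨c, hc, ε₁, hε₁, κ₁, hκ₁, ?_⟩
  intro h ε κ hh hε hεε hκ hκκ hκε v hv hv0
  have k := fun a => H h ε κ hh hε hεε hκ hκκ hκε (v a) (hv a) (hv0 a)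
  have hf : Continuous (expConvexify κ h Φ) := (contDiff_expConvexify hW.contDiff).continuous
  have hF := isCompact_frontier_of_isBounded hb
  have hσ := ae_mem_frontier_surfaceMeasure Ω
  have hgc := continuousOn_normalDerivWeight hΩ hs hW.contDiff hφ
  have hgf : ContinuousOn (fun x => normalDerivWeight Ω φ x * expConvexify κ h Φ x ^ 2)
      (frontier Ω) := hgc.mul (hf.pow 2).continuousOn
  have hηgf : ContinuousOn (fun x => (1 + κ * Φ x) * (normalDerivWeight Ω φ x *
      expConvexify κ h Φ x ^ 2)) (frontier Ω) :=
    (continuous_const.add (continuous_const.mul hW.contDiff.continuous)).continuousOn.mul hgf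
  have i1 : ∀ a, Integrable (fun x => normalDerivWeight Ω φ x *
      (expConvexify κ h Φ x ^ 2 * ‖normalDeriv Ω (v a) x‖ ^ 2)) (surfaceMeasure Ω) := fun a => by
    simpa only [mul_assoc] using integrable_mul_norm_sq hF hσ hgf
      (aestronglyMeasurable_surfaceMeasure_of_continuousOn hgf) (memLp_normalDeriv hΩ hb hs (hv a))
  have i2 : ∀ a, Integrable (fun x => (1 + κ * Φ x) * normalDerivWeight Ω φ x *
      (expConvexify κ h Φ x ^ 2 * ‖normalDeriv Ω (v a) x‖ ^ 2)) (surfaceMeasure Ω) := fun a => by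
    simpa only [mul_assoc] using integrable_mul_norm_sq hF hσ hηgf
      (aestronglyMeasurable_surfaceMeasure_of_continuousOn hηgf) (memLp_normalDeriv hΩ hb hs (hv a))
  have hsplit := integral_surfaceMeasure_le (Ω := Ω) (φ := φ) (η := fun x => 1 + κ * Φ x)
    (G := fun x => ∑ a, expConvexify κ h Φ x ^ 2 * ‖normalDeriv Ω (v a) x‖ ^ 2) hgc
    (fun x hx => hη κ hκ hκκ x (frontier_subset_closure hx))
    (fun x => Finset.sum_nonneg fun a _ => by positivity)
    (by simpa only [Finset.mul_sum] using integrable_finsetSum Finset.univ fun a _ => i1 a)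
    (by simpa only [Finset.mul_sum] using integrable_finsetSum Finset.univ fun a _ => i2 a)
  have e3 : ∫ x, (1 + κ * Φ x) * normalDerivWeight Ω φ x *
      (∑ a, expConvexify κ h Φ x ^ 2 * ‖normalDeriv Ω (v a) x‖ ^ 2) ∂(surfaceMeasure Ω) =
      ∑ a, ∫ x, (1 + κ * Φ x) * (∑ j, pderiv3 j Φ x * outerNormal Ω x j) *
            (expConvexify κ h Φ x ^ 2 * ‖normalDeriv Ω (v a) x‖ ^ 2) ∂(surfaceMeasure Ω) := by
    simp only [Finset.mul_sum]
    rw [integral_finsetSum _ fun a _ => i2 a]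
    refine Finset.sum_congr rfl fun a _ => integral_congr_ae ?_
    filter_upwards [hσ] with x hx
    rw [normalDerivWeight_eq_sum hφ hx]
    simp only [Finset.mul_sum]
  rw [e3] at hsplit
  rw [integral_finsetSum _ fun a _ => integrableOn_energy hΩ hb hf h (hv a).1,
    integral_finsetSum _ fun a _ => ?_]
  · have h3 : 0 < h ^ 3 := by positivity
    have hs' := mul_le_mul_of_nonneg_left hsplit h3.le
    simp only [Fin.sum_univ_two] at hs' ⊢
    linarith [k 0, k 1]
  · refine ((integrableOn_mul_norm_sq hΩ hb (hf.pow 2) (memL2_weakLaplacian (hv a))).const_mul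
      (h ^ 4)).congr (Eventually.of_forall fun x => ?_)
    simp only [Pi.pow_apply]
    ring

/-- As h → 0, |log h^α| tends to infinity and h|log h| to zero, which makes both ε and κ = h/ε
small. The threshold depends on α, whereas C₀, ε₁ and κ₁ are given beforehand. -/
theorem exists_forall_small_parameter {α C₀ ε₁ κ₁ : ℝ} (hα : 0 < α) (hC₀ : 0 < C₀) (hε₁ : 0 < ε₁)
    (hκ₁ : 0 < κ₁) :
    ∃ h₀ > (0 : ℝ), h₀ < 1 ∧ ∀ h, 0 < h → h ≤ h₀ →
      1 ≤ absLog α h ∧ epsh C₀ α h ≤ ε₁ ∧ h / epsh C₀ α h ≤ κ₁ := by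
  have hlog : ∀ h : ℝ, 0 < h → absLog α h = α * |Real.log h| := fun h hh => by
    rw [absLog, Real.log_rpow hh, abs_mul, abs_of_pos hα]
  have t1 : Tendsto (fun h : ℝ => α * |Real.log h|) (𝓝[>] 0) atTop :=
    (tendsto_abs_atBot_atTop.comp Real.tendsto_log_nhdsGT_zero).const_mul_atTop hα
  have t2 : Tendsto (fun h : ℝ => C₀ * (α * |Real.log h * h|)) (𝓝[>] 0) (𝓝 0) := by
    have h1 := tendsto_log_mul_rpow_nhdsGT_zero zero_lt_one
    simp only [Real.rpow_one] at h1
    simpa using (h1.abs.const_mul α).const_mul C₀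
  have hev := (t1.eventually_ge_atTop 1).and ((t1.eventually_ge_atTop (1 / (C₀ * ε₁))).and
    ((t2.eventually_le_const hκ₁).and (Ioo_mem_nhdsGT (zero_lt_one (α := ℝ)))))
  obtain ⟨u, hu, hsub⟩ := mem_nhdsGT_iff_exists_Ioc_subset.1 hev
  have hu0 : (0 : ℝ) < u := hu
  refine ⟨u, hu0, (hsub ⟨hu0, le_rfl⟩).2.2.2.2, fun h hh hhu => ?_⟩
  obtain ⟨e1, e2, e3, -⟩ := hsub ⟨hh, hhu⟩
  have hL := hlog h hh
  rw [← hL] at e1 e2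
  have hLpos : 0 < absLog α h := lt_of_lt_of_le one_pos e1
  refine ⟨e1, ?_, ?_⟩
  · rw [epsh]
    refine inv_le_of_inv_le₀ hε₁ ?_
    rw [div_le_iff₀ (by positivity)] at e2
    rw [inv_le_iff_one_le_mul₀ hε₁]
    linarith
  · rw [epsh, div_inv_eq_mul, hL]
    rw [abs_mul, abs_of_pos hh] at e3
    linarith

end System

/-! ### Absorption of the lower order terms. -/

section Absorption

open Set

theorem exists_coefficient_bound {Ω : Set E3} (hΩ : IsOpen Ω) (hb : Bornology.IsBounded Ω)
    {A : E3 → E3} (hA : ContDiffOn ℝ ∞ A (closure Ω)) {q qt : E3 → ℂ}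
    (hq : ContDiffOn ℝ ∞ q (closure Ω)) (hqt : ContDiffOn ℝ ∞ qt (closure Ω)) :
    ∃ B, 1 ≤ B ∧ ∀ x ∈ Ω, (∀ j, ‖A x j‖ ≤ B) ∧ (∀ j, ‖pderiv3 j q x‖ ≤ B) ∧ ‖qt x‖ ≤ B := by
  obtain ⟨B₁, h₁⟩ := hb.isCompact_closure.exists_bound_of_continuousOn hA.continuousOn
  obtain ⟨B₂, h₂⟩ := exists_norm_pderiv3_le hΩ hb hq
  obtain ⟨B₃, h₃⟩ := hb.isCompact_closure.exists_bound_of_continuousOn hqt.continuousOn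
  refine ⟨1 + |B₁| + |B₂| + |B₃|, by linarith [abs_nonneg B₁, abs_nonneg B₂, abs_nonneg B₃],
    fun x hx => ⟨fun j => ?_, fun j => ?_, ?_⟩⟩
  · have := (PiLp.norm_apply_le (A x) j).trans (h₁ x (subset_closure hx))
    linarith [abs_nonneg B₂, abs_nonneg B₃, le_abs_self B₁]
  · have := h₂ x hx j
    linarith [abs_nonneg B₁, abs_nonneg B₃, le_abs_self B₂]
  · have := h₃ x (subset_closure hx)
    linarith [abs_nonneg B₁, abs_nonneg B₂, le_abs_self B₃]

/-- The lower order terms are absorbed by the left hand side of the Carleman estimate. -/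
theorem sum_laplacian_le {Ω : Set E3} {A : E3 → E3} {q qt : E3 → ℂ} {α h B c C₀ f : ℝ}
    {v : Fin 2 → E3 → ℂ} {x : E3} (hB : 1 ≤ B) (hA : ∀ j, ‖A x j‖ ≤ B)
    (hq : ∀ j, ‖pderiv3 j q x‖ ≤ B) (hqt : ‖qt x‖ ≤ B) (hh : 0 < h) (hh1 : h ≤ 1)
    (hL : 1 ≤ absLog α h) (hC : 8 * (32 * (27 * B ^ 2) ^ 2) ≤ c * C₀) :
    ∑ a, f ^ 2 * (h ^ 4 * ‖weakLaplacian Ω (v a) x‖ ^ 2) ≤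
      2 * (∑ a, f ^ 2 * (h ^ 4 * ‖hatOp Ω A q qt α h v x a‖ ^ 2)) +
      c / 2 * (h ^ 2 * (C₀ * absLog α h)) * ∑ a, f ^ 2 *
        (‖v a x‖ ^ 2 + h ^ 2 * ∑ j, ‖weakPartial Ω j (v a) x‖ ^ 2) := by
  have hR := sum_norm_lowerOrder_sq_le (Ω := Ω) (v := v) (α := α) (h := h) hB hA hq hqt
  set K : ℝ := 32 * (27 * B ^ 2) ^ 2 with hK
  have hK0 : 0 ≤ K := by positivity
  have hp : ∀ a, ‖weakLaplacian Ω (v a) x‖ ^ 2 ≤ 2 * ‖hatOp Ω A q qt α h v x a‖ ^ 2 +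
      2 * ‖lowerOrder Ω A q qt α h v x a‖ ^ 2 := by
    intro a
    have h1 : weakLaplacian Ω (v a) x =
        lowerOrder Ω A q qt α h v x a - hatOp Ω A q qt α h v x a := by
      rw [hatOp_apply]
      ring
    have h2 : ‖weakLaplacian Ω (v a) x‖ ≤ ‖lowerOrder Ω A q qt α h v x a‖ +
        ‖hatOp Ω A q qt α h v x a‖ := by
      rw [h1]
      exact norm_sub_le _ _
    have h3 := pow_le_pow_left₀ (norm_nonneg _) h2 2
    have h4 := add_sq_le (a := ‖lowerOrder Ω A q qt α h v x a‖) (b := ‖hatOp Ω A q qt α h v x a‖)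
    linarith
  have hsum : ∑ a, ‖weakLaplacian Ω (v a) x‖ ^ 2 ≤ 2 * (∑ a, ‖hatOp Ω A q qt α h v x a‖ ^ 2) +
      2 * (K * (1 + absLog α h) * ∑ b, (‖v b x‖ ^ 2 + ∑ j, ‖weakPartial Ω j (v b) x‖ ^ 2)) := by
    simp only [Fin.sum_univ_two] at hR ⊢
    linarith [hp 0, hp 1]
  -- For h ≤ 1 the unscaled energy costs a factor h⁻² against the semiclassical one; the h⁴ in front
  -- of the lower order terms leaves h², matching the h² of the gain.
  have hE : h ^ 2 * ∑ b, (‖v b x‖ ^ 2 + ∑ j, ‖weakPartial Ω j (v b) x‖ ^ 2) ≤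
      ∑ b, (‖v b x‖ ^ 2 + h ^ 2 * ∑ j, ‖weakPartial Ω j (v b) x‖ ^ 2) := by
    rw [Finset.mul_sum]
    refine Finset.sum_le_sum fun b _ => ?_
    have : h ^ 2 * ‖v b x‖ ^ 2 ≤ 1 * ‖v b x‖ ^ 2 :=
      mul_le_mul_of_nonneg_right (pow_le_one₀ hh.le hh1) (sq_nonneg _)
    linarith
  set E0 := ∑ b, (‖v b x‖ ^ 2 + ∑ j, ‖weakPartial Ω j (v b) x‖ ^ 2) with hE0
  set E1 := ∑ b, (‖v b x‖ ^ 2 + h ^ 2 * ∑ j, ‖weakPartial Ω j (v b) x‖ ^ 2) with hE1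
  have hE1' : 0 ≤ E1 := Finset.sum_nonneg fun b _ => by positivity
  have hkey : 2 * (K * (1 + absLog α h) * (h ^ 4 * E0)) ≤
      c / 2 * (h ^ 2 * (C₀ * absLog α h)) * E1 := by
    have s1 : K * (1 + absLog α h) ≤ K * (2 * absLog α h) :=
      mul_le_mul_of_nonneg_left (by linarith) hK0
    have s2 : h ^ 4 * E0 ≤ h ^ 2 * E1 := by
      have := mul_le_mul_of_nonneg_left hE (sq_nonneg h)
      linarith
    have s3 : K * (1 + absLog α h) * (h ^ 4 * E0) ≤ K * (2 * absLog α h) * (h ^ 2 * E1) :=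
      mul_le_mul s1 s2 (mul_nonneg (by positivity) (Finset.sum_nonneg fun b _ => by positivity))
        (by positivity)
    have s4 := mul_le_mul_of_nonneg_right hC
      (by positivity : 0 ≤ absLog α h * (h ^ 2 * E1) / 2)
    linarith
  have hf := mul_le_mul_of_nonneg_left hsum (by positivity : 0 ≤ f ^ 2 * h ^ 4)
  have hf' := mul_le_mul_of_nonneg_left hkey (sq_nonneg f)
  have r1 : ∑ a, f ^ 2 * (h ^ 4 * ‖weakLaplacian Ω (v a) x‖ ^ 2) =
      f ^ 2 * h ^ 4 * ∑ a, ‖weakLaplacian Ω (v a) x‖ ^ 2 := by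
    rw [Finset.mul_sum]
    exact Finset.sum_congr rfl fun _ _ => by ring
  have r2 : ∑ a, f ^ 2 * (h ^ 4 * ‖hatOp Ω A q qt α h v x a‖ ^ 2) =
      f ^ 2 * h ^ 4 * ∑ a, ‖hatOp Ω A q qt α h v x a‖ ^ 2 := by
    rw [Finset.mul_sum]
    exact Finset.sum_congr rfl fun _ _ => by ring
  rw [r1, r2, ← Finset.mul_sum]
  linarith

/-- Square integrability of the right hand side is indispensable: the integral of a nonintegrable
function is zero by convention, and the absorbing comparison of integrals would fail. -/
theorem memL2_hatOp {Ω : Set E3} (hΩ : IsOpen Ω) {A : E3 → E3}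
    (hA : ContDiffOn ℝ ∞ A (closure Ω)) {q qt : E3 → ℂ}
    (hq : ContDiffOn ℝ ∞ q (closure Ω)) (hqt : ContDiffOn ℝ ∞ qt (closure Ω)) {B : ℝ} (hB1 : 1 ≤ B)
    (hB : ∀ x ∈ Ω, (∀ j, ‖A x j‖ ≤ B) ∧ (∀ j, ‖pderiv3 j q x‖ ≤ B) ∧ ‖qt x‖ ≤ B) (α h : ℝ)
    {v : Fin 2 → E3 → ℂ} (hv : ∀ a, MemH2 Ω (v a)) (a : Fin 2) :
    MemL2 Ω fun x => hatOp Ω A q qt α h v x a := by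
  have hm := aestronglyMeasurable_lowerOrder hΩ (hA.continuousOn.mono subset_closure)
    (hq.continuousOn.mono subset_closure) (hqt.continuousOn.mono subset_closure) α h
    (fun a => (hv a).1) a
  have hS : MemLp (fun x => (∑ j, ∑ b, ‖weakPartial Ω j (v b) x‖) + ∑ b, ‖v b x‖) 2
      (volume.restrict Ω) :=
    (memLp_finsetSum _ fun j _ => memLp_finsetSum _ fun b _ =>
      ((hv b).1.hasWeakPartial j).1.norm).add (memLp_finsetSum _ fun b _ => (hv b).1.1.norm)
  have hR : MemL2 Ω fun x => lowerOrder Ω A q qt α h v x a := by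
    refine (hS.const_mul (27 * B ^ 2 * (1 + √(absLog α h)))).mono' hm ?_
    filter_upwards [ae_restrict_mem hΩ.measurableSet] with x hx
    obtain ⟨h1, h2, h3⟩ := hB x hx
    exact norm_lowerOrder_le hB1 h1 h2 h3 a
  have h1 := (memL2_weakLaplacian (hv a)).neg.add hR
  refine h1.ae_eq (Eventually.of_forall fun x => ?_)
  simp only [hatOp_apply, Pi.add_apply, Pi.neg_apply]

theorem IsLimitingCarlemanWeight.exists_isSmoothCarlemanWeight {φ : E3 → ℝ} {U K : Set E3}
    (hφ : IsLimitingCarlemanWeight φ U) (hU : IsOpen U) (hK : IsCompact K) (hKU : K ⊆ U) :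
    ∃ Φ l : E3 → ℝ, IsSmoothCarlemanWeight K Φ l ∧ ∀ x ∈ K, Φ x = φ x ∧
      ∀ j, gradient φ x j = pderiv3 j Φ x := by
  obtain ⟨Φ, l, hΦ, hl, H⟩ := hφ.exists_extension hU hK hKU
  exact ⟨Φ, l, ⟨hΦ, hl, fun x hx => (H x hx).2.2.1, fun x hx => (H x hx).2.2.2.1,
    fun x hx => (H x hx).2.2.2.2⟩, fun x hx => ⟨(H x hx).1, (H x hx).2.1⟩⟩

end Absorption
end

/-! ### The main estimate: choice of constants and conclusion. -/

theorem lemma5p1 (Ω : Set E3) (hΩo : IsOpen Ω) (hΩb : Bornology.IsBounded Ω)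
    (hΩs : HasSmoothBoundary Ω)
    (A : E3 → E3) (hA : ContDiffOn ℝ ∞ A (closure Ω))
    (q qt : E3 → ℂ) (hq : ContDiffOn ℝ ∞ q (closure Ω)) (hqt : ContDiffOn ℝ ∞ qt (closure Ω))
    (U : Set E3) (hU : IsOpen U) (hΩU : closure Ω ⊆ U)
    (φ : E3 → ℝ) (hφ : IsLimitingCarlemanWeight φ U) :
    ∃ C₀ > (0 : ℝ), ∃ C > (0 : ℝ), ∀ α : ℝ, 0 < α → α < 1 →
      ∃ h₀ > (0 : ℝ), h₀ < 1 ∧ ∀ h : ℝ, 0 < h → h ≤ h₀ →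
        ∀ v : Fin 2 → E3 → ℂ, (∀ a, MemH2 Ω (v a)) → (∀ a, IsTrace Ω (v a) 0) →
          h ^ 2 / epsh C₀ α h *
              ((∫ x in Ω, ∑ a, ‖(expWeight φ C₀ α h x : ℂ) * v a x‖ ^ 2)
                + ∫ x in Ω, ∑ j, ∑ a,
                    ‖(expWeight φ C₀ α h x : ℂ) * ((h : ℂ) * weakD Ω j (v a) x)‖ ^ 2)
            - h ^ 3 * ∫ x in boundaryMinus Ω φ, normalDerivWeight Ω φ x *
                (∑ a, ‖(expWeight φ C₀ α h x : ℂ) * normalDeriv Ω (v a) x‖ ^ 2)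
                ∂(surfaceMeasure Ω)
          ≤ C * (∫ x in Ω, ∑ a,
                ‖(expWeight φ C₀ α h x : ℂ) * ((h : ℂ) ^ 2 * hatOp Ω A q qt α h v x a)‖ ^ 2)
            + C * h ^ 3 * ∫ x in boundaryPlus Ω φ, normalDerivWeight Ω φ x *
                (∑ a, ‖(expWeight φ C₀ α h x : ℂ) * normalDeriv Ω (v a) x‖ ^ 2)
                ∂(surfaceMeasure Ω) := by
  obtain ⟨Φ, l, hW, hΦ⟩ :=
    hφ.exists_isSmoothCarlemanWeight hU hΩb.isCompact_closure hΩU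
  obtain ⟨c, hc, ε₁, hε₁, κ₁, hκ₁, H⟩ :=
    exists_carleman_system hΩo hΩb hΩs hW fun x hx => (hΦ x hx).2
  obtain ⟨B, hB1, hB⟩ := exists_coefficient_bound hΩo hΩb hA hq hqt
  -- With K = 32(27B²)², absorption needs 2K(1 + |log h^α|) ≤ 4K|log h^α| ≤ (c/2)C₀|log h^α|, that
  -- is 8K ≤ cC₀. Neither K nor c depends on α.
  have hC₀ : 0 < 8 * (32 * (27 * B ^ 2) ^ 2) / c := by positivity
  refine ⟨8 * (32 * (27 * B ^ 2) ^ 2) / c, hC₀, 3 * (2 / c + 1), by positivity, fun α hα _ => ?_⟩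
  have hcC : 8 * (32 * (27 * B ^ 2) ^ 2) ≤ c * (8 * (32 * (27 * B ^ 2) ^ 2) / c) :=
    le_of_eq (by field_simp)
  generalize 8 * (32 * (27 * B ^ 2) ^ 2) / c = C₀ at hC₀ hcC ⊢
  obtain ⟨h₀, hh₀, hh₀1, Hh⟩ := exists_forall_small_parameter hα hC₀ hε₁ hκ₁
  refine ⟨h₀, hh₀, hh₀1, fun h hh hhh v hv hv0 => ?_⟩
  obtain ⟨hL, hε, hκ⟩ := Hh h hh hhh
  have hL0 : 0 < absLog α h := lt_of_lt_of_le one_pos hL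
  have hεpos : 0 < epsh C₀ α h := by unfold epsh; positivity
  have hκpos : 0 < h / epsh C₀ α h := div_pos hh hεpos
  have key := H h (epsh C₀ α h) (h / epsh C₀ α h) hh hεpos hε hκpos hκ (by field_simp) v hv hv0
  have hf : Continuous (expConvexify (h / epsh C₀ α h) h Φ) :=
    (contDiff_expConvexify hW.contDiff).continuous
  -- The smooth extension Φ agrees with φ on the closure of Ω, which is all that the integrals see.
  have hfe : ∀ x ∈ closure Ω, expWeight φ C₀ α h x = expConvexify (h / epsh C₀ α h) h Φ x :=
    fun x hx => by
      simp only [expWeight, convexWeight, expConvexify, convexify, (hΦ x hx).1]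
  have hκL : h * (h / epsh C₀ α h) = h ^ 2 * (C₀ * absLog α h) := by
    unfold epsh
    field_simp
  have hκ2 : h ^ 2 / epsh C₀ α h = h * (h / epsh C₀ α h) := by ring
  have hnorm : ∀ (r : ℝ) (z : ℂ), ‖(r : ℂ) * z‖ ^ 2 = r ^ 2 * ‖z‖ ^ 2 := fun r z => by
    rw [norm_mul, mul_pow, Complex.norm_real, Real.norm_eq_abs, sq_abs]
  have hnormh : ∀ z : ℂ, ‖(h : ℂ) ^ 2 * z‖ ^ 2 = h ^ 4 * ‖z‖ ^ 2 := fun z => by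
    rw [← Complex.ofReal_pow, hnorm]
    ring
  simp only [hnorm, hnormh, norm_weakD]
  have hΩcl := ae_mem_closure_restrict hΩo
  have hσ : ∀ s : Set E3, ∀ᵐ x ∂((surfaceMeasure Ω).restrict s), x ∈ frontier Ω := fun s =>
    ae_restrict_of_ae (ae_mem_frontier_surfaceMeasure Ω)
  have hbdry : ∀ s : Set E3, ∫ x in s, normalDerivWeight Ω φ x *
      (∑ a, expWeight φ C₀ α h x ^ 2 * ‖normalDeriv Ω (v a) x‖ ^ 2) ∂(surfaceMeasure Ω) =
      ∫ x in s, normalDerivWeight Ω φ x * (∑ a, expConvexify (h / epsh C₀ α h) h Φ x ^ 2 *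
        ‖normalDeriv Ω (v a) x‖ ^ 2) ∂(surfaceMeasure Ω) := fun s => by
    refine integral_congr_ae ?_
    filter_upwards [hσ s] with x hx
    rw [hfe x (frontier_subset_closure hx)]
  have hP : ∫ x in Ω, ∑ a, expWeight φ C₀ α h x ^ 2 * (h ^ 4 * ‖hatOp Ω A q qt α h v x a‖ ^ 2) =
      ∫ x in Ω, ∑ a, expConvexify (h / epsh C₀ α h) h Φ x ^ 2 *
        (h ^ 4 * ‖hatOp Ω A q qt α h v x a‖ ^ 2) := by
    refine integral_congr_ae ?_
    filter_upwards [hΩcl] with x hx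
    rw [hfe x hx]
  have hQ : (∫ x in Ω, ∑ a, expWeight φ C₀ α h x ^ 2 * ‖v a x‖ ^ 2) +
      ∫ x in Ω, ∑ j, ∑ a, expWeight φ C₀ α h x ^ 2 * (h ^ 2 * ‖weakPartial Ω j (v a) x‖ ^ 2) =
      ∫ x in Ω, ∑ a, expConvexify (h / epsh C₀ α h) h Φ x ^ 2 *
            (‖v a x‖ ^ 2 + h ^ 2 * ∑ j, ‖weakPartial Ω j (v a) x‖ ^ 2) := by
    have i0 : IntegrableOn (fun x => ∑ a, expConvexify (h / epsh C₀ α h) h Φ x ^ 2 *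
        ‖v a x‖ ^ 2) Ω :=
      integrable_finsetSum _ fun a _ => integrableOn_mul_norm_sq hΩo hΩb (hf.pow 2) (hv a).1.1
    have i1 : IntegrableOn (fun x => h ^ 2 * ∑ j, ∑ a, expConvexify (h / epsh C₀ α h) h Φ x ^ 2 *
        ‖weakPartial Ω j (v a) x‖ ^ 2) Ω :=
      (integrable_finsetSum _ fun j _ => integrable_finsetSum _ fun a _ =>
        integrableOn_mul_norm_sq hΩo hΩb (hf.pow 2) ((hv a).1.hasWeakPartial j).1).const_mul _
    have c0 : ∫ x in Ω, ∑ a, expWeight φ C₀ α h x ^ 2 * ‖v a x‖ ^ 2 =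
        ∫ x in Ω, ∑ a, expConvexify (h / epsh C₀ α h) h Φ x ^ 2 * ‖v a x‖ ^ 2 := by
      refine integral_congr_ae ?_
      filter_upwards [hΩcl] with x hx
      rw [hfe x hx]
    have c1 : ∫ x in Ω, ∑ j, ∑ a, expWeight φ C₀ α h x ^ 2 *
          (h ^ 2 * ‖weakPartial Ω j (v a) x‖ ^ 2) =
        ∫ x in Ω, h ^ 2 * ∑ j, ∑ a, expConvexify (h / epsh C₀ α h) h Φ x ^ 2 *
          ‖weakPartial Ω j (v a) x‖ ^ 2 := by
      refine integral_congr_ae ?_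
      filter_upwards [hΩcl] with x hx
      rw [hfe x hx]
      simp only [Fin.sum_univ_three, Fin.sum_univ_two]
      ring
    rw [c0, c1, ← integral_add i0 i1]
    congr 1
    ext x
    simp only [Fin.sum_univ_three, Fin.sum_univ_two]
    ring
  rw [hbdry, hbdry, hP, hQ, hκ2]
  have iP : IntegrableOn (fun x => ∑ a, expConvexify (h / epsh C₀ α h) h Φ x ^ 2 *
      (h ^ 4 * ‖hatOp Ω A q qt α h v x a‖ ^ 2)) Ω := by
    refine integrable_finsetSum _ fun a _ => ?_
    refine (integrableOn_mul_norm_sq hΩo hΩb ((hf.pow 2).mul_const (h ^ 4))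
      (memL2_hatOp hΩo hA hq hqt hB1 hB α h hv a)).congr (Eventually.of_forall fun x => ?_)
    simp only [Pi.pow_apply]
    ring
  have iL : IntegrableOn (fun x => ∑ a, expConvexify (h / epsh C₀ α h) h Φ x ^ 2 *
      (h ^ 4 * ‖weakLaplacian Ω (v a) x‖ ^ 2)) Ω := by
    refine integrable_finsetSum _ fun a _ => ?_
    refine (integrableOn_mul_norm_sq hΩo hΩb ((hf.pow 2).mul_const (h ^ 4))
      (memL2_weakLaplacian (hv a))).congr (Eventually.of_forall fun x => ?_)
    simp only [Pi.pow_apply]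
    ring
  have iQ : IntegrableOn (fun x => ∑ a, expConvexify (h / epsh C₀ α h) h Φ x ^ 2 *
      (‖v a x‖ ^ 2 + h ^ 2 * ∑ j, ‖weakPartial Ω j (v a) x‖ ^ 2)) Ω :=
    integrable_finsetSum _ fun a _ => integrableOn_energy hΩo hΩb hf h (hv a).1
  have habs : ∫ x in Ω, ∑ a, expConvexify (h / epsh C₀ α h) h Φ x ^ 2 *
      (h ^ 4 * ‖weakLaplacian Ω (v a) x‖ ^ 2) ≤
      2 * (∫ x in Ω, ∑ a, expConvexify (h / epsh C₀ α h) h Φ x ^ 2 *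
        (h ^ 4 * ‖hatOp Ω A q qt α h v x a‖ ^ 2)) + c / 2 * (h * (h / epsh C₀ α h)) *
      ∫ x in Ω, ∑ a, expConvexify (h / epsh C₀ α h) h Φ x ^ 2 *
        (‖v a x‖ ^ 2 + h ^ 2 * ∑ j, ‖weakPartial Ω j (v a) x‖ ^ 2) := by
    rw [← integral_const_mul, ← integral_const_mul, ← integral_add (iP.const_mul _)
      (iQ.const_mul _)]
    refine integral_mono_ae iL ((iP.const_mul _).add (iQ.const_mul _)) ?_
    filter_upwards [ae_restrict_mem hΩo.measurableSet] with x hx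
    obtain ⟨hAx, hqx, hqtx⟩ := hB x hx
    rw [hκL]
    exact sum_laplacian_le hB1 hAx hqx hqtx hh (hhh.trans hh₀1.le) hL hcC
  have hgc := continuousOn_normalDerivWeight hΩo hΩs hW.contDiff fun x hx => (hΦ x hx).2
  have hQ0 : 0 ≤ ∫ x in Ω, ∑ a, expConvexify (h / epsh C₀ α h) h Φ x ^ 2 *
      (‖v a x‖ ^ 2 + h ^ 2 * ∑ j, ‖weakPartial Ω j (v a) x‖ ^ 2) :=
    integral_nonneg fun x => Finset.sum_nonneg fun a _ => by positivity
  have hP0 : 0 ≤ ∫ x in Ω, ∑ a, expConvexify (h / epsh C₀ α h) h Φ x ^ 2 *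
      (h ^ 4 * ‖hatOp Ω A q qt α h v x a‖ ^ 2) :=
    integral_nonneg fun x => Finset.sum_nonneg fun a _ => by positivity
  have hM0 : ∫ x in boundaryMinus Ω φ, normalDerivWeight Ω φ x *
      (∑ a, expConvexify (h / epsh C₀ α h) h Φ x ^ 2 * ‖normalDeriv Ω (v a) x‖ ^ 2)
      ∂(surfaceMeasure Ω) ≤ 0 := by
    refine setIntegral_nonpos (measurableSet_boundaryMinus hgc) fun x hx => ?_
    exact mul_nonpos_of_nonpos_of_nonneg (neg_nonneg.1 hx.2)
      (Finset.sum_nonneg fun a _ => by positivity)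
  have hPl0 : 0 ≤ ∫ x in boundaryPlus Ω φ, normalDerivWeight Ω φ x *
      (∑ a, expConvexify (h / epsh C₀ α h) h Φ x ^ 2 * ‖normalDeriv Ω (v a) x‖ ^ 2)
      ∂(surfaceMeasure Ω) := by
    refine setIntegral_nonneg (measurableSet_boundaryPlus hgc) fun x hx => ?_
    exact mul_nonneg hx.2 (Finset.sum_nonneg fun a _ => by positivity)
  generalize (∫ x in Ω, ∑ a, expConvexify (h / epsh C₀ α h) h Φ x ^ 2 *
      (‖v a x‖ ^ 2 + h ^ 2 * ∑ j, ‖weakPartial Ω j (v a) x‖ ^ 2)) = Q at *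
  generalize (∫ x in Ω, ∑ a, expConvexify (h / epsh C₀ α h) h Φ x ^ 2 *
      (h ^ 4 * ‖hatOp Ω A q qt α h v x a‖ ^ 2)) = P at *
  generalize (∫ x in boundaryMinus Ω φ, normalDerivWeight Ω φ x *
      (∑ a, expConvexify (h / epsh C₀ α h) h Φ x ^ 2 * ‖normalDeriv Ω (v a) x‖ ^ 2)
      ∂(surfaceMeasure Ω)) = M at *
  generalize (∫ x in boundaryPlus Ω φ, normalDerivWeight Ω φ x *
      (∑ a, expConvexify (h / epsh C₀ α h) h Φ x ^ 2 * ‖normalDeriv Ω (v a) x‖ ^ 2)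
      ∂(surfaceMeasure Ω)) = N at *
  have hk : 0 ≤ h * (h / epsh C₀ α h) * Q := by positivity
  have h3 : 0 < h ^ 3 := by positivity
  have hM1 : 0 ≤ -(h ^ 3 * M) := by nlinarith
  have hN1 : 0 ≤ h ^ 3 * N := by positivity
  -- Half of the energy on the left has absorbed the lower order terms; the other half remains.
  have e1 : c / 2 * (h * (h / epsh C₀ α h) * Q) - h ^ 3 * M ≤ 2 * P + 3 * (h ^ 3 * N) := by
    linarith
  -- The factor 2/c + 1 is at least 2/c and at least 1, so both the energy and the nonnegative
  -- boundary term -h³M end up with coefficient at least 1. On the right, 3(2/c + 1) is the declared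
  -- constant.
  have e2 := mul_le_mul_of_nonneg_left e1 (by positivity : 0 ≤ 2 / c + 1)
  have e3 : (2 / c + 1) * (c / 2 * (h * (h / epsh C₀ α h) * Q) - h ^ 3 * M) =
      h * (h / epsh C₀ α h) * Q - h ^ 3 * M + (c / 2 * (h * (h / epsh C₀ α h) * Q) +
        2 / c * (-(h ^ 3 * M))) := by
    field_simp
    ring
  have e4 : 0 ≤ c / 2 * (h * (h / epsh C₀ α h) * Q) := by positivity
  have e5 : 0 ≤ 2 / c * (-(h ^ 3 * M)) := by positivity
  have e6 : 0 ≤ (2 / c + 1) * P := by positivity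
  linarith
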